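/- **Theorem 1.1 (A $\mathbb Z_2$-index theorem).** Let $n,k\ge 0$ be integers and let $S:[0,1]\times\mathbb R\to \mathrm{Mat}(n,\mathbb R)$, $S_\lambda(t)=S(\lambda,t)$, be smooth. Assume: (A1) as $t\to\pm\infty$, $S_\lambda(t)$ converges, uniformly in $\lambda\in[0,1]$, to matrices $S_\lambda^{\pm}$, and no eigenvalue of $S^+_\lambda$ or $S^-_\lambda$ lies on the imaginary axis, for every $\lambda\in[0,1]$; (A2) for $\lambda=0$ and for $\lambda=1$, the only solution $u:\mathbb R\to\mathbb R^n$ of $u'(t)=S_\lambda(t)u(t)$ with $\lim_{t\to\pm\infty}u(t)=0$ is $u\equiv 0$; (A3) for every $\lambda\in[0,1]$, $\dim V^+(S^-_\lambda)=k$ and $\dim V^-(S^+_\lambda)=n-k$, where $V^{-}(M)$ and $V^+(M)$ are the spectral subspaces of $\mathbb R^n$ belonging to the eigenvalues of $M$ with negative, respectively positive, real part. Let $A_\lambda=\frac{d}{dt}-S_\lambda: W^{1,2}(\mathbb R,\mathbb R^n)\to L^2(\mathbb R,\mathbb R^n)$, and let $E^s_\lambda(0)$ (respectively $E^u_\lambda(0)$)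 be the space of initial values $u(0)$ of solutions of $u'=S_\lambda u$ on $\mathbb R$ with $u(t)\to0$ as $t\to+\infty$ (respectively $t\to-\infty$). Then the parity of $\lambda\mapsto A_\lambda$ and the $\mathbb Z_2$-index of $\lambda\mapsto(E^s_\lambda(0),E^u_\lambda(0))$ are both well defined, and they are equal in $\mathbb Z_2$: $$\mathrm{parity}\big(A_\lambda;\ \lambda\in[0,1]\big)=\iota\big(E^s_\lambda(0),E^u_\lambda(0);\ \lambda\in[0,1]\big).$$ Here the two invariants are the following. *Parity.* Let $T:[0,1]\to\mathcal L(X,Y)$ be a norm-continuous path of Fredholm operators of index $0$ with $T(0)$, $T(1)$ invertible. Choose a finite-dimensional subspace $V\subset Y$ with $\mathrm{Ran}\,T(s)+V=Y$ for all $s\in[0,1]$, and let $E$ be the vector bundle over $[0,1]$ with fibres $E_s=T(s)^{-1}(V)$. Take two copies of $[0,1]$, with $E$ over the first and the trivial bundle with fibre $V$ over the second, and glue them over $s=0$ and $s=1$ by the isomorphisms $T(s):E_s\to V$; this gives a vector bundle $E_T$ over the circle. The parity of $T$ is $w_1(E_T)\in\mathbb Z_2$, that is, $0$ if $E_T$ is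 orientable and $1$ if it is not. Well defined means here that $T$ is such a path, that such a $V$ exists, and that $w_1(E_T)$ is the same for all such $V$. *$\mathbb Z_2$-index.* Let $V$ and $W$ be paths, continuous in the gap metric (the operator norm distance of the orthogonal projections), of subspaces of $\mathbb R^n$ of dimensions $p$ and $q$, $p+q=n$, with $V(s)+W(s)=\mathbb R^n$ for $s=0,1$. Choose continuous frames $v_1,\dots,v_p$ of $V$ and $w_1,\dots,w_q$ of $W$, and let $M(s)=[v_1(s)|\cdots|v_p(s)|w_1(s)|\cdots|w_q(s)]$. Then $\iota(V,W)=0$ if $\det(M(0)M(1))>0$ and $\iota(V,W)=1$ if $\det(M(0)M(1))<0$. Well defined means here that $(V,W)$ is such a pair of paths, that such frames exist, and that the value is the same for all of them. -/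

import Mathlib

open Set Filter Topology MeasureTheory
open scoped ContDiff ENNReal unitInterval

noncomputable section

namespace Z2Index

/-! ### Linear systems `u' = S u` on the real line -/

/-- `ℝⁿ` with the Euclidean norm. -/
abbrev Rn (n : ℕ) : Type := EuclideanSpace ℝ (Fin n)

/-- A real `n × n` matrix acting on `ℝⁿ`, as a bounded operator. -/
abbrev act {n : ℕ} (M : Matrix (Fin n) (Fin n) ℝ) : Rn n →L[ℝ] Rn n :=
  Matrix.toEuclideanCLM (𝕜 := ℝ) M

/-- `u` is a (classical, global) solution of `u'(t) = S(t) u(t)`, `t ∈ ℝ`. -/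
def IsSolution {n : ℕ} (S : ℝ → Matrix (Fin n) (Fin n) ℝ) (u : ℝ → Rn n) : Prop :=
  ∀ t : ℝ, HasDerivAt u (act (S t) (u t)) t

/-- The stable subspace at time `τ`: the initial values at time `τ` whose solution tends to `0` at
`+∞`. (For continuous `S` the solution with value `v` at `τ` exists, is unique, and is
`t ↦ γ_τ(t) v`, with `γ_τ` the fundamental matrix normalised by `γ_τ(τ) = I`.) -/
def stableSpace {n : ℕ} (S : ℝ → Matrix (Fin n) (Fin n) ℝ) (τ : ℝ) : Submodule ℝ (Rn n) where
  carrier := {v | ∃ u : ℝ → Rn n, IsSolution S u ∧ u τ = v ∧ Tendsto u atTop (𝓝 0)}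
  add_mem' := by
    rintro _ _ ⟨u, hu, rfl, hu0⟩ ⟨w, hw, rfl, hw0⟩
    refine ⟨fun t => u t + w t, fun t => ?_, rfl, by simpa using hu0.add hw0⟩
    rw [map_add]
    exact (hu t).add (hw t)
  zero_mem' := ⟨fun _ => 0, fun t => by simpa using hasDerivAt_const t (0 : Rn n), rfl,
    tendsto_const_nhds⟩
  smul_mem' := by
    rintro c _ ⟨u, hu, rfl, hu0⟩
    refine ⟨fun t => c • u t, fun t => ?_, rfl, by simpa using hu0.const_smul c⟩
    rw [map_smul]
    exact (hu t).const_smul c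

/-- The unstable subspace at time `τ`: the initial values at time `τ` whose solution tends to `0`
at `-∞`. -/
def unstableSpace {n : ℕ} (S : ℝ → Matrix (Fin n) (Fin n) ℝ) (τ : ℝ) : Submodule ℝ (Rn n) where
  carrier := {v | ∃ u : ℝ → Rn n, IsSolution S u ∧ u τ = v ∧ Tendsto u atBot (𝓝 0)}
  add_mem' := by
    rintro _ _ ⟨u, hu, rfl, hu0⟩ ⟨w, hw, rfl, hw0⟩
    refine ⟨fun t => u t + w t, fun t => ?_, rfl, by simpa using hu0.add hw0⟩
    rw [map_add]
    exact (hu t).add (hw t)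
  zero_mem' := ⟨fun _ => 0, fun t => by simpa using hasDerivAt_const t (0 : Rn n), rfl,
    tendsto_const_nhds⟩
  smul_mem' := by
    rintro c _ ⟨u, hu, rfl, hu0⟩
    refine ⟨fun t => c • u t, fun t => ?_, rfl, by simpa using hu0.const_smul c⟩
    rw [map_smul]
    exact (hu t).const_smul c

/-! ### Hyperbolic matrices and their spectral spaces -/

/-- The complexification of a real matrix. -/
abbrev complexMatrix {n : ℕ} (M : Matrix (Fin n) (Fin n) ℝ) : Matrix (Fin n) (Fin n) ℂ :=
  M.map ((↑) : ℝ → ℂ)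

/-- No (complex) eigenvalue lies on the imaginary axis. -/
def IsHyperbolic {n : ℕ} (M : Matrix (Fin n) (Fin n) ℝ) : Prop :=
  ∀ z ∈ spectrum ℂ (complexMatrix M), z.re ≠ 0

/-- The inclusion `ℝⁿ → ℂⁿ`. -/
def complexInclusion (n : ℕ) : Rn n →ₗ[ℝ] (Fin n → ℂ) where
  toFun v := fun i => (v i : ℂ)
  map_add' v w := by ext i; simp
  map_smul' c v := by ext i; simp

/-- The real spectral space of `M` belonging to a conjugation invariant set `Ω` of eigenvalues:
the real vectors in the sum of the complex generalized eigenspaces with eigenvalue in `Ω`. -/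
def spectralSpace {n : ℕ} (M : Matrix (Fin n) (Fin n) ℝ) (Ω : Set ℂ) : Submodule ℝ (Rn n) :=
  ((⨆ z ∈ Ω, Module.End.maxGenEigenspace
    (Matrix.toLin' (complexMatrix M)) z).restrictScalars ℝ).comap (complexInclusion n)

/-- `V⁻(M)`. -/
def negSpace {n : ℕ} (M : Matrix (Fin n) (Fin n) ℝ) : Submodule ℝ (Rn n) :=
  spectralSpace M {z | z.re < 0}

/-- `V⁺(M)`. -/
def posSpace {n : ℕ} (M : Matrix (Fin n) (Fin n) ℝ) : Submodule ℝ (Rn n) :=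
  spectralSpace M {z | 0 < z.re}

/-! ### The assumptions on the family -/

/-- `S` is smooth on `[0,1] × ℝ`, and `S_l(t)` converges, uniformly in `l ∈ [0,1]`, to hyperbolic
matrices `S_l⁺` and `S_l⁻` as `t → +∞` and `t → -∞`. -/
structure AsymptoticallyHyperbolic {n : ℕ} (S : ℝ → ℝ → Matrix (Fin n) (Fin n) ℝ)
    (Splus Sminus : ℝ → Matrix (Fin n) (Fin n) ℝ) : Prop where
  smooth : ∀ i j : Fin n,
    ContDiffOn ℝ ∞ (fun p : ℝ × ℝ => S p.1 p.2 i j) (Icc 0 1 ×ˢ univ)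
  tendsto_atTop : TendstoUniformlyOn (fun t l => S l t) Splus atTop (Icc 0 1)
  tendsto_atBot : TendstoUniformlyOn (fun t l => S l t) Sminus atBot (Icc 0 1)
  hyperbolic_plus : ∀ l ∈ Icc (0 : ℝ) 1, IsHyperbolic (Splus l)
  hyperbolic_minus : ∀ l ∈ Icc (0 : ℝ) 1, IsHyperbolic (Sminus l)

/-- The only solution of `u' = S u` that tends to `0` at both ends is `u = 0`. -/
def OnlyTrivialSolution {n : ℕ} (S : ℝ → Matrix (Fin n) (Fin n) ℝ) : Prop :=
  ∀ u : ℝ → Rn n, IsSolution S u → Tendsto u atBot (𝓝 0) → Tendsto u atTop (𝓝 0) → u = 0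

/-- Each coefficient path `t ↦ S_l(t)` is bounded and measurable. -/
theorem AsymptoticallyHyperbolic.memLp {n : ℕ} {S : ℝ → ℝ → Matrix (Fin n) (Fin n) ℝ}
    {Splus Sminus : ℝ → Matrix (Fin n) (Fin n) ℝ} (h : AsymptoticallyHyperbolic S Splus Sminus)
    (l : I) : MemLp (fun t => act (S l t)) ∞ (volume : Measure ℝ) := by
  have hact : Continuous (fun M : Matrix (Fin n) (Fin n) ℝ => act M) :=
    ((Matrix.toEuclideanCLM (n := Fin n) (𝕜 := ℝ)).toAlgEquiv.toLinearMap).continuous_of_finiteDimensional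
  have hS : Continuous (S l) := by
    refine continuous_matrix fun i j => ?_
    have h1 := (h.smooth i j).continuousOn
    have h2 : Continuous (fun t : ℝ => ((l : ℝ), t)) := by fun_prop
    exact h1.comp_continuous h2 fun t => ⟨l.2, mem_univ _⟩
  have hc : Continuous (fun t => act (S l t)) := hact.comp hS
  have ht := (hact.tendsto _).comp (h.tendsto_atTop.tendsto_at l.2)
  have hb := (hact.tendsto _).comp (h.tendsto_atBot.tendsto_at l.2)
  obtain ⟨C, hC⟩ : ∃ C, ∀ t, ‖act (S l t)‖ ≤ C := by
    have e1 := ht.norm.eventually_le_const (lt_add_one _)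
    have e2 := hb.norm.eventually_le_const (lt_add_one _)
    obtain ⟨b, hb⟩ := eventually_atTop.1 e1
    obtain ⟨a, ha⟩ := eventually_atBot.1 e2
    obtain ⟨C, hC⟩ := (isCompact_Icc (a := a) (b := b)).exists_bound_of_continuousOn
      hc.continuousOn
    refine ⟨max C (max (‖act (Splus l)‖ + 1) (‖act (Sminus l)‖ + 1)), fun t => ?_⟩
    rcases le_total t a with h1 | h1
    · exact (ha t h1).trans ((le_max_right _ _).trans (le_max_right _ _))
    rcases le_total b t with h2 | h2
    · exact (hb t h2).trans ((le_max_left _ _).trans (le_max_right _ _))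
    · exact (hC t ⟨h1, h2⟩).trans (le_max_left _ _)
  exact memLp_top_of_bound hc.aestronglyMeasurable C (Eventually.of_forall hC)

/-! ### The Sobolev space and the differential operator -/

/-- `L²(ℝ, ℝⁿ)`. -/
abbrev L2 (n : ℕ) : Type := Lp (Rn n) 2 (volume : Measure ℝ)

/-- `v` is the weak derivative of `u`. -/
def IsWeakDeriv {n : ℕ} (u v : L2 n) : Prop :=
  ∀ φ : ℝ → ℝ, ContDiff ℝ ∞ φ → HasCompactSupport φ →
    ∫ t, deriv φ t • u t = - ∫ t, φ t • v t

theorem integrable_test_smul {n : ℕ} {φ : ℝ → ℝ} (hφ : Continuous φ) (hc : HasCompactSupport φ)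
    (u : L2 n) : Integrable (fun t => φ t • u t) :=
  memLp_one_iff_integrable.1
    ((Lp.memLp u).smul (hφ.memLp_of_hasCompactSupport hc : MemLp φ 2 volume))

/-- `W^{1,2}(ℝ, ℝⁿ)`: the functions `u ∈ L²` with a weak derivative in `L²`. The element `u` is
stored as the pair `(u, u')`, and the norm is `(‖u‖² + ‖u'‖²)^{1/2}`. -/
def W12 (n : ℕ) : Submodule ℝ (WithLp 2 (L2 n × L2 n)) where
  carrier := {x | IsWeakDeriv x.fst x.snd}
  add_mem' := by
    intro x y hx hy φ hφ hc
    have hd : Continuous (deriv φ) := hφ.continuous_deriv (by simp)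
    have e1 : ∫ t, deriv φ t • (x + y).fst t = ∫ t, (deriv φ t • x.fst t + deriv φ t • y.fst t) := by
      refine integral_congr_ae ?_
      filter_upwards [Lp.coeFn_add x.fst y.fst] with t ht
      rw [WithLp.add_fst, ht, Pi.add_apply, smul_add]
    have e2 : ∫ t, φ t • (x + y).snd t = ∫ t, (φ t • x.snd t + φ t • y.snd t) := by
      refine integral_congr_ae ?_
      filter_upwards [Lp.coeFn_add x.snd y.snd] with t ht
      rw [WithLp.add_snd, ht, Pi.add_apply, smul_add]
    rw [e1, e2, integral_add (integrable_test_smul hd hc.deriv _) (integrable_test_smul hd hc.deriv _),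
      integral_add (integrable_test_smul hφ.continuous hc _)
        (integrable_test_smul hφ.continuous hc _), hx φ hφ hc, hy φ hφ hc, neg_add]
  zero_mem' := by
    intro φ hφ hc
    have e : ∀ f : ℝ → ℝ, ∫ t, f t • (0 : L2 n) t = 0 := by
      intro f
      rw [← integral_zero ℝ (Rn n)]
      refine integral_congr_ae ?_
      filter_upwards [Lp.coeFn_zero (Rn n) 2 (volume : Measure ℝ)] with t ht
      rw [ht, Pi.zero_apply, smul_zero]
    exact (e (deriv φ)).trans (by rw [← neg_zero]; exact congrArg _ (e φ).symm)
  smul_mem' := by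
    intro c x hx φ hφ hc
    have e1 : ∫ t, deriv φ t • (c • x).fst t = ∫ t, c • (deriv φ t • x.fst t) := by
      refine integral_congr_ae ?_
      filter_upwards [Lp.coeFn_smul c x.fst] with t ht
      rw [WithLp.smul_fst, ht, Pi.smul_apply, smul_comm]
    have e2 : ∫ t, φ t • (c • x).snd t = ∫ t, c • (φ t • x.snd t) := by
      refine integral_congr_ae ?_
      filter_upwards [Lp.coeFn_smul c x.snd] with t ht
      rw [WithLp.smul_snd, ht, Pi.smul_apply, smul_comm]
    rw [e1, e2, integral_smul, integral_smul, hx φ hφ hc, smul_neg]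

/-- The inclusion `W^{1,2} → L²`. -/
def sobolevIncl (n : ℕ) : W12 n →L[ℝ] L2 n :=
  WithLp.fstL 2 ℝ (L2 n) (L2 n) ∘L (W12 n).subtypeL

/-- The (weak) derivative `d/dt : W^{1,2} → L²`. -/
def sobolevDeriv (n : ℕ) : W12 n →L[ℝ] L2 n :=
  WithLp.sndL 2 ℝ (L2 n) (L2 n) ∘L (W12 n).subtypeL

/-- Multiplication by a bounded measurable operator valued function, on `L²`. -/
def mulOp {n : ℕ} {B : ℝ → Rn n →L[ℝ] Rn n} (hB : MemLp B ∞ (volume : Measure ℝ)) :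
    L2 n →L[ℝ] L2 n :=
  (ContinuousLinearMap.id ℝ (Rn n →L[ℝ] Rn n)).holderL volume ∞ 2 2 hB.toLp

/-- The operator `d/dt - S : W^{1,2}(ℝ, ℝⁿ) → L²(ℝ, ℝⁿ)`. -/
def diffOp {n : ℕ} (S : ℝ → Matrix (Fin n) (Fin n) ℝ)
    (hS : MemLp (fun t => act (S t)) ∞ (volume : Measure ℝ)) : W12 n →L[ℝ] L2 n :=
  sobolevDeriv n - mulOp hS ∘L sobolevIncl n

/-! ### The parity of a path of Fredholm operators of index zero -/

section Parity

/-- Fredholm of index `0`. -/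
def IsFredholmIndexZero {X Y : Type*} [NormedAddCommGroup X] [NormedSpace ℝ X]
    [NormedAddCommGroup Y] [NormedSpace ℝ Y] (T : X →L[ℝ] Y) : Prop :=
  T.IsFredholm ∧ Module.finrank ℝ T.ker = Module.finrank ℝ (Y ⧸ T.range)

/-- A norm continuous path, parametrised by `[0,1]`, of Fredholm operators of index `0` with
invertible end points. -/
structure IsFredholmPath {X Y : Type*} [NormedAddCommGroup X] [NormedSpace ℝ X]
    [NormedAddCommGroup Y] [NormedSpace ℝ Y] (T : I → X →L[ℝ] Y) : Prop where
  continuous : Continuous T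
  fredholm : ∀ s, IsFredholmIndexZero (T s)
  invertible_zero : (T 0).IsInvertible
  invertible_one : (T 1).IsInvertible

/-- `V` is finite dimensional and `Ran T(s) + V = Y` for all `s`. -/
def IsTransversal {X Y : Type*} [NormedAddCommGroup X] [NormedSpace ℝ X]
    [NormedAddCommGroup Y] [NormedSpace ℝ Y] (T : I → X →L[ℝ] Y) (V : Submodule ℝ Y) : Prop :=
  FiniteDimensional ℝ V ∧ ∀ s, (T s).range ⊔ V = ⊤

/-- The fibre `E_s = T(s)⁻¹(V)` of the vector bundle `E = {(s, x) | T(s) x ∈ V}` over `[0,1]`. -/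
def fibre {X Y : Type*} [NormedAddCommGroup X] [NormedSpace ℝ X]
    [NormedAddCommGroup Y] [NormedSpace ℝ Y] (T : I → X →L[ℝ] Y) (V : Submodule ℝ Y) (s : I) :
    Submodule ℝ X :=
  V.comap (T s : X →ₗ[ℝ] Y)

/-- A (continuous) orientation of a family `F` of `m`-dimensional subspaces of `X` parametrised by
`[0,1]`: an orientation of each `F s` that is, near every parameter, the orientation of a
continuous frame of `F`. -/
def IsContinuousOrientation {X : Type*} [NormedAddCommGroup X] [NormedSpace ℝ X] {m : ℕ}
    (F : I → Submodule ℝ X) (o : ∀ s, Orientation ℝ (F s) (Fin m)) : Prop :=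
  ∀ s₀ : I, ∃ U ∈ 𝓝 s₀, ∃ b : ∀ s : U, Module.Basis (Fin m) ℝ (F s),
    (Continuous fun (s : U) (j : Fin m) => (b s j : X)) ∧ ∀ s : U, (b s).orientation = o s

/-- The bundle `E_T` over the circle, obtained from two copies of `[0,1]`, with `E` over the first
and the trivial bundle with fibre `V` over the second, by glueing the two intervals at their end
points `s = 0, 1` and the fibres over these by the isomorphisms `T(s) : E_s → V`.
It is orientable if and only if both pieces have orientations which the two glueing maps respect. -/
def ClutchedBundleOrientable {X Y : Type*} [NormedAddCommGroup X] [NormedSpace ℝ X]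
    [NormedAddCommGroup Y] [NormedSpace ℝ Y] (T : I → X →L[ℝ] Y) (V : Submodule ℝ Y) : Prop :=
  ∃ (o : ∀ s, Orientation ℝ (fibre T V s) (Fin (Module.finrank ℝ V)))
    (o' : I → Orientation ℝ V (Fin (Module.finrank ℝ V))),
    IsContinuousOrientation (fibre T V) o ∧ IsContinuousOrientation (fun _ => V) o' ∧
    ∀ s : I, s = 0 ∨ s = 1 → ∃ φ : fibre T V s ≃ₗ[ℝ] V,
      (∀ x, (φ x : Y) = T s x) ∧ Orientation.map (Fin (Module.finrank ℝ V)) φ (o s) = o' s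

open Classical in
/-- The first Stiefel-Whitney class `w₁(E_T) ∈ H¹(S¹; ℤ₂) = ℤ₂`: it is `0` if `E_T` is orientable
and `1` if it is not. -/
def w1 {X Y : Type*} [NormedAddCommGroup X] [NormedSpace ℝ X]
    [NormedAddCommGroup Y] [NormedSpace ℝ Y] (T : I → X →L[ℝ] Y) (V : Submodule ℝ Y) : ZMod 2 :=
  if ClutchedBundleOrientable T V then 0 else 1

/-- The parity of the path `T` is defined and equal to `p`: `T` is a continuous path of Fredholm
operators of index `0` with invertible end points, there is a finite dimensional `V` transversal to
`T`, and `w₁(E_T) = p` for every choice of such a `V`. -/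
def HasParity {X Y : Type*} [NormedAddCommGroup X] [NormedSpace ℝ X]
    [NormedAddCommGroup Y] [NormedSpace ℝ Y] (T : I → X →L[ℝ] Y) (p : ZMod 2) : Prop :=
  IsFredholmPath T ∧ (∃ V, IsTransversal T V) ∧ ∀ V, IsTransversal T V → w1 T V = p

end Parity

/-! ### The `ℤ₂`-index of a pair of paths of subspaces of `ℝⁿ` -/

/-- A path in the Grassmannian of `k`-dimensional subspaces of `ℝⁿ`, continuous for the gap metric
`d(V, W) = ‖P_V - P_W‖`, with `P` the orthogonal projections. -/
def IsGrassmannPath {n : ℕ} (k : ℕ) (V : I → Submodule ℝ (Rn n)) : Prop :=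
  (∀ s, Module.finrank ℝ (V s) = k) ∧ Continuous fun s => (V s).starProjection

/-- `v` is a continuous frame of `V`. -/
def IsFrame {n k : ℕ} (V : I → Submodule ℝ (Rn n)) (v : I → Fin k → Rn n) : Prop :=
  Continuous v ∧ ∀ s, LinearIndependent ℝ (v s) ∧ Submodule.span ℝ (range (v s)) = V s

/-- The square matrix `[v₁ | ⋯ | v_k | w₁ | ⋯ | w_m]` with the given columns, `k + m = n`. -/
def columns {n k m : ℕ} (h : k + m = n) (v : Fin k → Rn n) (w : Fin m → Rn n) :
    Matrix (Fin n) (Fin n) ℝ :=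
  Matrix.of fun i j => Fin.append v w (Fin.cast h.symm j) i

/-- The `ℤ₂`-index of the pair `(V, W)` is defined and equal to `p`: for some `k + m = n`, `V` and
`W` are continuous paths of `k`- and `m`-dimensional subspaces of `ℝⁿ` which are transversal at
both end points, there are continuous frames of `V` and of `W`, and for all such frames
`M = [v | w]` has `det (M(0) M(1)) > 0` if `p = 0`, `det (M(0) M(1)) < 0` if `p = 1`. -/
def HasZ2Index {n : ℕ} (V W : I → Submodule ℝ (Rn n)) (p : ZMod 2) : Prop :=
  ∃ (k m : ℕ) (h : k + m = n), IsGrassmannPath k V ∧ IsGrassmannPath m W ∧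
    V 0 ⊔ W 0 = ⊤ ∧ V 1 ⊔ W 1 = ⊤ ∧
    (∃ v : I → Fin k → Rn n, IsFrame V v) ∧ (∃ w : I → Fin m → Rn n, IsFrame W w) ∧
    ∀ (v : I → Fin k → Rn n) (w : I → Fin m → Rn n), IsFrame V v → IsFrame W w →
      (p = 0 ∧ 0 < (columns h (v 0) (w 0) * columns h (v 1) (w 1)).det) ∨
      (p = 1 ∧ (columns h (v 0) (w 0) * columns h (v 1) (w 1)).det < 0)

end Z2Index

end

/-! The link between the two invariants is an extension of `A_λ` to functions with a jump at 0. Add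
to `u ∈ W^{1,2}` the function `e^{-t} c` on `t > 0` and apply `d/dt - S_λ` away from 0: this is an
operator `(u, c) ↦ A_λ u + B_λ c` on `W^{1,2} × ℝⁿ`. An element of its kernel is a pair of decaying
solutions, one on each half-line, with values `u(0) + c ∈ E^s` and `u(0) ∈ E^u`; so the kernel is
`E^s × E^u`, of dimension `n`. The extended operator is onto. Hence `A_λ` is Fredholm of index 0,
and a continuous path of right inverses yields continuous frames of `E^s` and `E^u`.
`SplitExtension` records these facts, and both invariants are treated from it alone.

Comparison. Let `V` be transversal, `f` a basis of `V`, `e` a frame of the fibres `A⁻¹(V)`, and `C`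
the matrix of `A` in these bases. The clutched bundle is orientable iff `det C(0) det C(1) > 0`.
Write `f_i = A x_i + B d_i` by means of the right inverse. Then `(e_j, 0) - ∑ C_ij (x_i, d_i)` lies
in the kernel, and expanding its two boundary values in the frames `v`, `w` gives `K` with `M K + D
C = 0`, where `M = [v | w]` and `D` has columns `d_i`. Here `[M D]` is onto and `[K; C]` is a frame
of its kernel, and for such a path `det M` and `det C` change sign together (`det_mul_pos_iff`). The
resulting equivalence `orientable_iff_det_pos` has one side free of the frames and the other free of
`V`, so it proves that both invariants are well defined as well as equal.

Analysis. A hyperbolic matrix `M` has a symmetric form `b` with `b(x, M x) ≥ δ|x|²`, negative on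
`V⁻` and positive on `V⁺` (`exists_lyapunov`). Along solutions `b(u, u)` increases at large times,
which gives `dim E^s = dim V⁻(S⁺)` (`finrank_stableSpace`). With a weight that takes care of bounded
times it gives `‖u‖ ≤ C (‖A u‖ + |u(0)|)` (`exists_norm_le`), hence closed range. The range of the
extension is dense because compactly supported forcing can be solved from either end and glued
across the jump. The negative half-line is reduced to the positive one by `t ↦ -t`; norm continuity
in `λ` comes from the uniformity of the limits. -/

namespace Z2Index

/-! ### Continuous frames of families of subspaces -/

section Frames

variable {Z X : Type*} [NormedAddCommGroup X] [NormedSpace ℝ X] {d : ℕ}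

/-- `v s` is a basis of `F s` for every `s ∈ U`. -/
def FrameOn (U : Set Z) (F : Z → Submodule ℝ X) (v : Z → Fin d → X) : Prop :=
  ∀ s ∈ U, LinearIndependent ℝ (v s) ∧ Submodule.span ℝ (range (v s)) = F s

theorem span_eq_of_linearIndependent {F : Submodule ℝ X} {v : Fin d → X} (hF : Module.finrank ℝ F = d)
    [FiniteDimensional ℝ F] (hv : LinearIndependent ℝ v) (hm : ∀ i, v i ∈ F) :
    Submodule.span ℝ (range v) = F := by
  refine Submodule.eq_of_le_of_finrank_eq (Submodule.span_le.2 (range_subset_iff.2 hm)) ?_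
  rw [finrank_span_eq_card hv, Fintype.card_fin, hF]

theorem exists_change_of_basis {F : Submodule ℝ X} {v w : Fin d → X}
    (hvF : Submodule.span ℝ (range v) = F)
    (hwF : Submodule.span ℝ (range w) = F) :
    ∃ g : Matrix (Fin d) (Fin d) ℝ, ∀ j, v j = ∑ i, g i j • w i := by
  have : ∀ j, ∃ c : Fin d → ℝ, ∑ i, c i • w i = v j := fun j => by
    rw [← Submodule.mem_span_range_iff_exists_fun, hwF, ← hvF]
    exact Submodule.subset_span (mem_range_self j)
  choose c hc using this
  exact ⟨Matrix.of fun i j => c j i, fun j => (hc j).symm⟩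

theorem FrameOn.change {U : Set Z} {F : Z → Submodule ℝ X} [∀ s, FiniteDimensional ℝ (F s)]
    {b : Z → Fin d → X} (hb : FrameOn U F b)
    {g : Matrix (Fin d) (Fin d) ℝ} (hg : g.det ≠ 0) :
    FrameOn U F fun s j => ∑ i, g i j • b s i := by
  intro s hs
  have hli : LinearIndependent ℝ fun j => ∑ i, g i j • b s i := by
    rw [Fintype.linearIndependent_iff]
    intro c hc
    have h1 : ∑ i, (g.mulVec c) i • b s i = 0 := by
      rw [← hc]
      simp only [Matrix.mulVec, dotProduct, Finset.sum_smul, Finset.smul_sum, smul_smul]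
      rw [Finset.sum_comm]
      simp only [mul_comm]
    have h2 := Fintype.linearIndependent_iff.1 (hb s hs).1 _ h1
    exact fun i => congrFun (Matrix.eq_zero_of_mulVec_eq_zero hg (funext h2)) i
  have hd : Module.finrank ℝ (F s) = d := by
    rw [← (hb s hs).2, finrank_span_eq_card (hb s hs).1, Fintype.card_fin]
  refine ⟨hli, span_eq_of_linearIndependent hd hli fun j => ?_⟩
  refine Submodule.sum_mem _ fun i _ => Submodule.smul_mem _ _ ?_
  rw [← (hb s hs).2]
  exact Submodule.subset_span (mem_range_self i)

variable [TopologicalSpace Z]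

/-- The coordinates of a continuous section in a continuous frame are continuous. -/
theorem continuous_coordinates {v : Z → Fin d → X} (hv : Continuous v)
    (hli : ∀ s, LinearIndependent ℝ (v s)) {g : Z → Fin d → ℝ}
    (hx : Continuous fun s => ∑ i, g s i • v s i) : Continuous g := by
  rw [continuous_iff_continuousAt]
  intro s₀
  let T : (Fin d → ℝ) →L[ℝ] X := LinearMap.toContinuousLinearMap (Fintype.linearCombination ℝ (v s₀))
  have hT : Function.Injective T := by
    rw [injective_iff_map_eq_zero]
    intro c hc
    exact funext (Fintype.linearIndependent_iff.1 (hli s₀) c hc)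
  have hT' : ∃ L : X →L[ℝ] (Fin d → ℝ), ∀ c, L (T c) = c := by
    obtain ⟨p, hp⟩ := Submodule.ClosedComplemented.of_finiteDimensional
      (LinearMap.range (T : (Fin d → ℝ) →ₗ[ℝ] X))
    let e := LinearEquiv.ofInjective (T : (Fin d → ℝ) →ₗ[ℝ] X) hT
    refine ⟨LinearMap.toContinuousLinearMap (e.symm : _ →ₗ[ℝ] Fin d → ℝ) ∘L p, fun c => ?_⟩
    have h1 : p (T c) = e c := hp (e c)
    simp [h1]
  obtain ⟨L, hL⟩ := hT'
  -- `L` is a left inverse of the frame at `s₀`. Seen through `L` the frame is the identity matrix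
  -- at `s₀`, hence invertible nearby, and Cramer's rule expresses the coordinates continuously.
  let A : Z → Matrix (Fin d) (Fin d) ℝ := fun s => Matrix.of fun i j => L (v s j) i
  have hA : Continuous A := by
    refine continuous_matrix fun i j => ?_
    exact (continuous_apply i).comp (L.continuous.comp ((continuous_apply j).comp hv))
  have hA0 : A s₀ = 1 := by
    ext i j
    have : L (T (Pi.single j 1)) i = (1 : Matrix (Fin d) (Fin d) ℝ) i j := by
      rw [hL, Matrix.one_apply, Pi.single_apply]
    simpa [T, A, Fintype.linearCombination_apply, Pi.single_apply] using this
  have hdet : ∀ᶠ s in 𝓝 s₀, (A s).det ≠ 0 := by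
    have : ContinuousAt (fun s => (A s).det) s₀ := (hA.matrix_det).continuousAt
    exact this.eventually_ne (by simp [hA0])
  have hg : ∀ᶠ s in 𝓝 s₀, (A s).det⁻¹ • ((A s).adjugate.mulVec (L (∑ i, g s i • v s i))) = g s := by
    filter_upwards [hdet] with s hs
    have : L (∑ i, g s i • v s i) = (A s).mulVec (g s) := by
      ext i
      simp [A, Matrix.mulVec, dotProduct, mul_comm]
    rw [this, Matrix.mulVec_mulVec, Matrix.adjugate_mul, Matrix.smul_mulVec, smul_smul,
      inv_mul_cancel₀ hs, one_smul, Matrix.one_mulVec]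
  refine ContinuousAt.congr ?_ hg
  refine ContinuousAt.smul ((hA.matrix_det).continuousAt.inv₀ (by simp [hA0])) ?_
  exact (Continuous.matrix_mulVec hA.matrix_adjugate (L.continuous.comp hx)).continuousAt

/-- A family of subspaces of constant finite dimension with enough continuous sections has local
frames. -/
theorem exists_local_frame {F : Z → Submodule ℝ X} [∀ s, FiniteDimensional ℝ (F s)]
    (hF : ∀ s, Module.finrank ℝ (F s) = d)
    (hsec : ∀ s₀, ∀ v ∈ F s₀, ∃ τ : Z → X, Continuous τ ∧ τ s₀ = v ∧ ∀ s, τ s ∈ F s) (s₀ : Z) :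
    ∃ U ∈ 𝓝 s₀, ∃ v : Z → Fin d → X, Continuous v ∧ FrameOn U F v := by
  let b := Module.finBasisOfFinrankEq ℝ (F s₀) (hF s₀)
  choose τ hτ hτ0 hτm using fun i => hsec s₀ (b i) (b i).2
  have hc : Continuous fun s (i : Fin d) => τ i s := continuous_pi hτ
  have h0 : LinearIndependent ℝ fun i => τ i s₀ := by
    simp only [hτ0]
    exact b.linearIndependent.map' (F s₀).subtype (Submodule.ker_subtype _)
  refine ⟨_, hc.continuousAt.eventually h0.eventually, _, hc, fun s hs => ⟨hs, ?_⟩⟩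
  exact span_eq_of_linearIndependent (hF s) hs fun i => hτm i s

/-- Local frames over the unit interval can be patched to a global frame. -/
theorem exists_global_frame {F : I → Submodule ℝ X} [∀ s, FiniteDimensional ℝ (F s)]
    (hloc : ∀ s₀, ∃ U ∈ 𝓝 s₀, ∃ v : I → Fin d → X, Continuous v ∧ FrameOn U F v) :
    ∃ v : I → Fin d → X, Continuous v ∧ FrameOn univ F v := by
  choose U hU v hv hfr using hloc
  obtain ⟨t, ht0, htm, ⟨N, hN⟩, hsub⟩ := exists_monotone_Icc_subset_open_cover_unitInterval
    (c := fun s => interior (U s)) (fun s => isOpen_interior)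
    (fun s _ => mem_iUnion.2 ⟨s, mem_interior_iff_mem_nhds.2 (hU s)⟩)
  have key : ∀ k, ∃ w : I → Fin d → X, Continuous w ∧ FrameOn (Iic (t k)) F w := by
    intro k
    induction k with
    | zero =>
      refine ⟨v 0, hv 0, fun s hs => hfr 0 s ?_⟩
      have : s = 0 := le_antisymm (by simpa [ht0] using hs) unitInterval.nonneg'
      subst this; exact mem_of_mem_nhds (hU 0)
    | succ k ih =>
      obtain ⟨w, hw, hwf⟩ := ih
      obtain ⟨i, hi⟩ := hsub k
      have hb : FrameOn (Icc (t k) (t (k + 1))) F (v i) := fun s hs =>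
        hfr i s (interior_subset (hi hs))
      have hk := hb (t k) ⟨le_rfl, htm k.le_succ⟩
      have hk' := hwf (t k) self_mem_Iic
      -- A constant change of basis makes the next local frame agree with `w` at the common point `t
      -- k`.
      obtain ⟨g, hg⟩ := exists_change_of_basis hk'.2 hk.2
      have hdet : g.det ≠ 0 := by
        intro h0
        obtain ⟨c, hc, hgc⟩ := Matrix.exists_mulVec_eq_zero_iff.2 h0
        apply hc
        have h1 : ∑ j, c j • w (t k) j = 0 := by
          have : ∑ j, c j • w (t k) j = ∑ i', (g.mulVec c) i' • v i (t k) i' := by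
            simp only [hg, Matrix.mulVec, dotProduct, Finset.sum_smul, Finset.smul_sum, smul_smul]
            rw [Finset.sum_comm]
            simp only [mul_comm]
          rw [this, hgc]; simp
        exact funext (Fintype.linearIndependent_iff.1 hk'.1 c h1)
      have hb' := hb.change hdet
      set b : I → Fin d → X := fun s j => ∑ i', g i' j • v i s i' with hbdef
      have hbc : Continuous b := by
        refine continuous_pi fun j => continuous_finsetSum _ fun i' _ => ?_
        exact ((continuous_apply i').comp (hv i)).const_smul _
      have hbk : b (t k) = w (t k) := funext fun j => (hg j).symm
      -- A single formula for the concatenation: the terms at `t k` cancel on either side, and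
      -- continuity needs no case distinction.
      refine ⟨fun s => w (min s (t k)) + (b (max s (t k)) - b (t k)), ?_, fun s hs => ?_⟩
      · exact (hw.comp (continuous_id.min continuous_const)).add
          ((hbc.comp (continuous_id.max continuous_const)).sub continuous_const)
      · rcases le_total s (t k) with h | h
        · simpa [min_eq_left h, max_eq_right h] using hwf s h
        · simpa [min_eq_right h, max_eq_left h, hbk] using hb' s ⟨h, hs⟩
  obtain ⟨w, hw, hwf⟩ := key N
  refine ⟨w, hw, fun s _ => hwf s ?_⟩
  rw [hN N le_rfl]
  exact unitInterval.le_one'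

end Frames

/-- The orthogonal projections onto a family of subspaces with a continuous frame are continuous. -/
theorem continuous_starProjection {Z : Type*} [TopologicalSpace Z] {n d : ℕ}
    {F : Z → Submodule ℝ (Rn n)} {v : Z → Fin d → Rn n} (hv : Continuous v)
    (hf : FrameOn univ F v) : Continuous fun s => (F s).starProjection := by
  let A : Z → EuclideanSpace ℝ (Fin d) →L[ℝ] Rn n := fun s =>
    ∑ i, (ContinuousLinearMap.toSpanSingleton ℝ (v s i)) ∘L (EuclideanSpace.proj i)
  have hA : Continuous A := by
    refine continuous_finsetSum _ fun i _ => ?_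
    refine Continuous.clm_comp ?_ continuous_const
    exact (ContinuousLinearMap.toSpanSingletonLE ℝ ℝ (Rn n)).toLinearMap.continuous_of_finiteDimensional.comp
      ((continuous_apply i).comp hv)
  have hAa : ∀ s c, A s c = ∑ i, c i • v s i := by
    intro s c; simp [A]
  have hinj : ∀ s, Function.Injective (A s) := by
    intro s
    rw [injective_iff_map_eq_zero]
    intro c hc
    rw [hAa] at hc
    have := Fintype.linearIndependent_iff.1 (hf s (mem_univ s)).1 _ hc
    ext i; exact this i
  let Q : Z → (EuclideanSpace ℝ (Fin d) →L[ℝ] EuclideanSpace ℝ (Fin d)) := fun s =>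
    ContinuousLinearMap.adjoint (A s) ∘L A s
  have hadj : Continuous fun s => ContinuousLinearMap.adjoint (A s) :=
    (ContinuousLinearMap.adjoint (𝕜 := ℝ)).continuous.comp hA
  have hQ : Continuous Q := hadj.clm_comp hA
  have hQinj : ∀ s, Function.Injective (Q s) := by
    intro s
    rw [injective_iff_map_eq_zero]
    intro c hc
    have : inner ℝ (A s c) (A s c) = 0 := by
      rw [← ContinuousLinearMap.adjoint_inner_left]
      have : (ContinuousLinearMap.adjoint (A s)) (A s c) = 0 := hc
      rw [this, inner_zero_left]
    exact (injective_iff_map_eq_zero _).1 (hinj s) _ (inner_self_eq_zero.1 this)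
  have hQu : ∀ s, IsUnit (Q s) := by
    intro s
    rw [ContinuousLinearMap.isUnit_iff_bijective]
    exact ⟨hQinj s, (LinearMap.injective_iff_surjective (f := (Q s).toLinearMap)).1 (hQinj s)⟩
  -- The formula `P = A (A*A)⁻¹ A*` for the projection onto the range of an injective `A`; each
  -- factor is continuous in `s`.
  have hP : ∀ s, (F s).starProjection =
      A s ∘L (Ring.inverse (Q s) ∘L ContinuousLinearMap.adjoint (A s)) := by
    intro s
    ext1 x
    refine Submodule.eq_starProjection_of_mem_of_inner_eq_zero ?_ ?_
    · simp only [ContinuousLinearMap.comp_apply, hAa]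
      rw [← (hf s (mem_univ s)).2]
      exact Submodule.sum_mem _ fun i _ => Submodule.smul_mem _ _ (Submodule.subset_span (mem_range_self i))
    · intro w hw
      rw [← (hf s (mem_univ s)).2, Submodule.mem_span_range_iff_exists_fun] at hw
      obtain ⟨c, rfl⟩ := hw
      have : ∑ i, c i • v s i = A s (WithLp.toLp 2 c) := by rw [hAa]
      rw [this, ← ContinuousLinearMap.adjoint_inner_left, map_sub]
      have h2 : (ContinuousLinearMap.adjoint (A s)) ((A s ∘L (Ring.inverse (Q s) ∘L
          ContinuousLinearMap.adjoint (A s))) x) =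
          (Q s * Ring.inverse (Q s)) (ContinuousLinearMap.adjoint (A s) x) := rfl
      rw [h2, Ring.mul_inverse_cancel _ (hQu s)]
      simp
  simp only [hP]
  refine hA.clm_comp (Continuous.clm_comp ?_ hadj)
  rw [continuous_iff_continuousAt]
  intro s
  obtain ⟨u, hu⟩ := hQu s
  have := NormedRing.inverse_continuousAt u
  rw [hu] at this
  exact ContinuousAt.comp (f := Q) this hQ.continuousAt

/-! ### Signs of determinants and orientations -/

theorem mul_pos_of_continuous_of_ne_zero {f : I → ℝ} (hf : Continuous f) (h0 : ∀ s, f s ≠ 0) :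
    0 < f 0 * f 1 := by
  rcases lt_or_gt_of_ne (h0 0) with h | h <;> rcases lt_or_gt_of_ne (h0 1) with h' | h'
  · exact mul_pos_of_neg_of_neg h h'
  · obtain ⟨s, hs⟩ := mem_range_of_exists_le_of_exists_ge hf ⟨0, h.le⟩ ⟨1, h'.le⟩
    exact absurd hs (h0 s)
  · obtain ⟨s, hs⟩ := mem_range_of_exists_le_of_exists_ge hf ⟨1, h'.le⟩ ⟨0, h.le⟩
    exact absurd hs (h0 s)
  · exact mul_pos h h'

open Matrix in
/-- If `[M D]` is onto and `[K; C]` is a frame of its kernel, then the determinants of `M` and `C`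
change sign together. -/
theorem det_mul_pos_iff {n m : ℕ} {M : I → Matrix (Fin n) (Fin n) ℝ}
    {D K : I → Matrix (Fin n) (Fin m) ℝ} {C : I → Matrix (Fin m) (Fin m) ℝ}
    (hM : Continuous M) (hD : Continuous D) (hK : Continuous K) (hC : Continuous C)
    (hker : ∀ s, M s * K s + D s * C s = 0)
    (honto : ∀ s, ∀ z, ∃ a b, M s *ᵥ a + D s *ᵥ b = z)
    (hinj : ∀ s b, K s *ᵥ b = 0 → C s *ᵥ b = 0 → b = 0) :
    0 < (M 0).det * (M 1).det ↔ 0 < (C 0).det * (C 1).det := by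
  -- The columns of `[Mᵀ; Dᵀ]` span the orthogonal complement of the kernel of `[M D]` and those of
  -- `[K; C]` span the kernel, so `W` is invertible and its determinant keeps its sign.
  let W : I → Matrix (Fin n ⊕ Fin m) (Fin n ⊕ Fin m) ℝ := fun s =>
    fromBlocks (M s)ᵀ (K s) (D s)ᵀ (C s)
  let G : I → Matrix (Fin n) (Fin n) ℝ := fun s => M s * (M s)ᵀ + D s * (D s)ᵀ
  have hWc : Continuous W := hM.matrix_transpose.matrix_fromBlocks hK hD.matrix_transpose hC
  have hGinj : ∀ s a, G s *ᵥ a = 0 → (M s)ᵀ *ᵥ a = 0 ∧ (D s)ᵀ *ᵥ a = 0 := by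
    intro s a ha
    have h1 : a ⬝ᵥ (G s *ᵥ a) =
        ((M s)ᵀ *ᵥ a) ⬝ᵥ ((M s)ᵀ *ᵥ a) + ((D s)ᵀ *ᵥ a) ⬝ᵥ ((D s)ᵀ *ᵥ a) := by
      simp only [G, add_mulVec, dotProduct_add, ← mulVec_mulVec]
      rw [dotProduct_mulVec a (M s), dotProduct_mulVec a (D s), ← mulVec_transpose,
        ← mulVec_transpose]
    rw [ha, dotProduct_zero] at h1
    have e1 : 0 ≤ ((M s)ᵀ *ᵥ a) ⬝ᵥ ((M s)ᵀ *ᵥ a) := by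
      simpa using dotProduct_star_self_nonneg ((M s)ᵀ *ᵥ a)
    have e2 : 0 ≤ ((D s)ᵀ *ᵥ a) ⬝ᵥ ((D s)ᵀ *ᵥ a) := by
      simpa using dotProduct_star_self_nonneg ((D s)ᵀ *ᵥ a)
    exact ⟨dotProduct_self_eq_zero.1 (by linarith), dotProduct_self_eq_zero.1 (by linarith)⟩
  have hG0 : ∀ s a, G s *ᵥ a = 0 → a = 0 := by
    intro s a ha
    obtain ⟨h1, h2⟩ := hGinj s a ha
    obtain ⟨b, c, hbc⟩ := honto s a
    have : a ⬝ᵥ a = 0 := by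
      nth_rewrite 2 [← hbc]
      rw [dotProduct_add, dotProduct_mulVec, dotProduct_mulVec, ← mulVec_transpose,
        ← mulVec_transpose, h1, h2]
      simp
    exact dotProduct_self_eq_zero.1 this
  have hGpos : ∀ s, 0 < (G s).det := by
    intro s
    have h1 : (G s).PosSemidef := by
      have a1 := posSemidef_self_mul_conjTranspose (M s)
      have a2 := posSemidef_self_mul_conjTranspose (D s)
      simpa [G] using a1.add a2
    refine lt_of_le_of_ne h1.det_nonneg fun h => ?_
    obtain ⟨v, hv, hv'⟩ := exists_mulVec_eq_zero_iff.2 h.symm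
    exact hv (hG0 s v hv')
  have hWdet : ∀ s, (W s).det ≠ 0 := by
    intro s h
    obtain ⟨v, hv, hv'⟩ := exists_mulVec_eq_zero_iff.2 h
    apply hv
    obtain ⟨a, b, rfl⟩ : ∃ a b, v = Sum.elim a b := ⟨v ∘ Sum.inl, v ∘ Sum.inr, by simp⟩
    simp only [W, fromBlocks_mulVec, Sum.elim_comp_inl, Sum.elim_comp_inr] at hv'
    have hx : (M s)ᵀ *ᵥ a + K s *ᵥ b = 0 := funext fun i => congrFun hv' (Sum.inl i)
    have hy : (D s)ᵀ *ᵥ a + C s *ᵥ b = 0 := funext fun i => congrFun hv' (Sum.inr i)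
    have h3 : G s *ᵥ a = 0 := by
      have h4 : M s *ᵥ ((M s)ᵀ *ᵥ a + K s *ᵥ b) + D s *ᵥ ((D s)ᵀ *ᵥ a + C s *ᵥ b) =
          G s *ᵥ a + (M s * K s + D s * C s) *ᵥ b := by
        simp only [G, mulVec_add, add_mulVec, mulVec_mulVec]; abel
      rw [hx, hy, hker] at h4
      simpa using h4.symm
    have ha := hG0 s a h3
    subst ha
    have hb := hinj s b (by simpa using hx) (by simpa using hy)
    subst hb
    ext (i | i) <;> rfl
  have hmul : ∀ s, (M s).det * (W s).det = (G s).det * (C s).det := by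
    intro s
    -- Both the left factor and the product are block triangular, whence `det M · det W = det G ·
    -- det C` with `det G > 0`.
    have h1 : fromBlocks (M s) (D s) 0 (1 : Matrix (Fin m) (Fin m) ℝ) * W s =
        fromBlocks (G s) 0 (D s)ᵀ (C s) := by
      simp [W, fromBlocks_multiply, G, hker]
    have h2 := congrArg Matrix.det h1
    rwa [det_mul, det_fromBlocks_zero₂₁, det_one, mul_one, det_fromBlocks_zero₁₂] at h2
  have hW := mul_pos_of_continuous_of_ne_zero hWc.matrix_det hWdet
  have hG := mul_pos (hGpos 0) (hGpos 1)
  have : ((M 0).det * (M 1).det) * ((W 0).det * (W 1).det) =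
      ((G 0).det * (G 1).det) * ((C 0).det * (C 1).det) := by
    linear_combination (M 1).det * (W 1).det * hmul 0 + (G 0).det * (C 0).det * hmul 1
  rw [← mul_pos_iff_of_pos_right hW, this, mul_pos_iff_of_pos_left hG]

/-! ### Orientability of the clutched bundle as a sign -/

section Orientation

variable {X : Type*} [NormedAddCommGroup X] [NormedSpace ℝ X] {m : ℕ}

/-- The bases given by a frame. -/
noncomputable def frameBasis {F : I → Submodule ℝ X} {e : I → Fin m → X} (he : FrameOn univ F e) (s : I) :
    Module.Basis (Fin m) ℝ (F s) :=
  (Module.Basis.span (he s (mem_univ s)).1).map (LinearEquiv.ofEq _ _ (he s (mem_univ s)).2)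

theorem frameBasis_apply {F : I → Submodule ℝ X} {e : I → Fin m → X} (he : FrameOn univ F e)
    (s : I) (j : Fin m) : (frameBasis he s j : X) = e s j := by
  simp [frameBasis, Module.Basis.span_apply]

theorem isContinuousOrientation_frame {F : I → Submodule ℝ X} {e : I → Fin m → X}
    (hc : Continuous e) (he : FrameOn univ F e) :
    IsContinuousOrientation F fun s => (frameBasis he s).orientation := by
  intro s₀
  refine ⟨univ, univ_mem, fun s => frameBasis he s, ?_, fun s => rfl⟩
  simp only [frameBasis_apply]
  exact hc.comp continuous_subtype_val

/-- A continuous orientation agrees with that of a global frame at one end if and only if it does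
so at the other. -/
theorem IsContinuousOrientation.eq_iff {F : I → Submodule ℝ X} {e : I → Fin m → X}
    (hc : Continuous e) (he : FrameOn univ F e) {o : ∀ s, Orientation ℝ (F s) (Fin m)}
    (ho : IsContinuousOrientation F o) :
    o 0 = (frameBasis he 0).orientation ↔ o 1 = (frameBasis he 1).orientation := by
  have key : ∀ s₀, ∀ᶠ s in 𝓝 s₀, (o s = (frameBasis he s).orientation ↔
      o s₀ = (frameBasis he s₀).orientation) := by
    intro s₀
    obtain ⟨U, hU, b, hb, hbo⟩ := ho s₀
    -- The transition matrix from the global frame to the local one: the sign of its determinant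
    -- tells whether the orientations agree, and this sign is locally constant.
    let g : U → Matrix (Fin m) (Fin m) ℝ := fun s => (frameBasis he s).toMatrix (b s)
    have hg : Continuous g := by
      refine continuous_matrix fun i j => ?_
      have : Continuous fun (s : U) (i : Fin m) => g s i j := by
        refine continuous_coordinates (v := fun s : U => e s) (hc.comp continuous_subtype_val)
          (fun s => (he s (mem_univ _)).1) ?_
        have : ∀ s : U, ∑ i, g s i j • e s i = b s j := by
          intro s
          have h1 := (frameBasis he s).sum_toMatrix_smul_self (b s) j
          rw [← h1, Submodule.coe_sum]
          simp [frameBasis_apply, g]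
        simp only [this]
        exact (continuous_apply j).comp hb
      exact (continuous_apply i).comp this
    let f : U → ℝ := fun s => (g s).det
    have hf : Continuous f := hg.matrix_det
    have hfdet : ∀ s : U, f s = (frameBasis he s).det (b s) := fun s => rfl
    have hf0 : ∀ s, f s ≠ 0 := fun s => by
      rw [hfdet]
      exact ((frameBasis he s).isUnit_det (b s)).ne_zero
    have hor : ∀ s : U, (o s = (frameBasis he s).orientation ↔ 0 < f s) := by
      intro s
      rw [← hbo s, hfdet, ← Module.Basis.orientation_eq_iff_det_pos, eq_comm]
    let s₁ : U := ⟨s₀, mem_of_mem_nhds hU⟩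
    have hev : ∀ᶠ s in 𝓝 s₁, (0 < f s ↔ 0 < f s₁) := by
      rcases lt_or_gt_of_ne (hf0 s₁) with h | h
      · filter_upwards [hf.continuousAt.eventually_lt_const h] with s hs
        exact iff_of_false hs.not_gt h.not_gt
      · filter_upwards [hf.continuousAt.eventually_const_lt h] with s hs
        exact iff_of_true hs h
    rw [nhds_subtype_eq_comap, eventually_comap] at hev
    filter_upwards [hev, hU] with s hs hsU
    have := hs ⟨s, hsU⟩ rfl
    rwa [← hor, ← hor] at this
  have hcl : IsClopen {s | o s = (frameBasis he s).orientation} := by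
    constructor
    · rw [← isOpen_compl_iff, isOpen_iff_mem_nhds]
      intro s hs
      filter_upwards [key s] with t ht h
      exact hs (ht.1 h)
    · rw [isOpen_iff_mem_nhds]
      intro s hs
      filter_upwards [key s] with t ht
      exact ht.2 hs
  rcases isClopen_iff.1 hcl with h | h
  · have h0 : (0 : I) ∉ {s | o s = (frameBasis he s).orientation} := by rw [h]; simp
    have h1 : (1 : I) ∉ {s | o s = (frameBasis he s).orientation} := by rw [h]; simp
    exact iff_of_false h0 h1
  · have h0 : (0 : I) ∈ {s | o s = (frameBasis he s).orientation} := by rw [h]; simp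
    have h1 : (1 : I) ∈ {s | o s = (frameBasis he s).orientation} := by rw [h]; simp
    exact iff_of_true h0 h1

variable {Y : Type*} [NormedAddCommGroup Y] [NormedSpace ℝ Y]

/-- Orientability of the clutched bundle in terms of a frame of the fibres. -/
theorem clutchedBundleOrientable_iff {T : I → X →L[ℝ] Y} {V : Submodule ℝ Y}
    {e : I → Fin (Module.finrank ℝ V) → X} (hc : Continuous e) (he : FrameOn univ (fibre T V) e)
    (φ₀ : fibre T V 0 ≃ₗ[ℝ] V) (hφ₀ : ∀ x, (φ₀ x : Y) = T 0 x)
    (φ₁ : fibre T V 1 ≃ₗ[ℝ] V) (hφ₁ : ∀ x, (φ₁ x : Y) = T 1 x) :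
    ClutchedBundleOrientable T V ↔
      0 < ((frameBasis he 0).map φ₀).det ((frameBasis he 1).map φ₁) := by
  -- The frame of the fibre at 0, carried over by `φ₀`, is a constant frame of the trivial bundle.
  -- With this choice the glueing at 0 respects the orientations, and only the glueing at 1 is left
  -- to test.
  set f := (frameBasis he 0).map φ₀ with hf
  have hfc : FrameOn (univ : Set I) (fun _ => V) fun _ j => (f j : Y) := by
    intro s _
    refine ⟨f.linearIndependent.map' V.subtype (Submodule.ker_subtype _), ?_⟩
    have : (fun j => (f j : Y)) = V.subtype ∘ f := rfl
    rw [this, range_comp, ← Submodule.map_span, f.span_eq]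
    simp
  have hfb : ∀ s, frameBasis hfc s = f := by
    intro s
    ext j
    rw [frameBasis_apply]
  have hmap : ∀ (s : I) (φ : fibre T V s ≃ₗ[ℝ] V), Orientation.map (Fin (Module.finrank ℝ V)) φ
      (frameBasis he s).orientation = ((frameBasis he s).map φ).orientation :=
    fun s φ => ((frameBasis he s).orientation_map φ).symm
  rw [← Module.Basis.orientation_eq_iff_det_pos]
  constructor
  · rintro ⟨o, o', ho, ho', hg⟩
    have h1 := ho.eq_iff hc he
    have h2 := ho'.eq_iff continuous_const hfc
    rw [hfb, hfb] at h2
    obtain ⟨ψ₀, hψ₀, hm0⟩ := hg 0 (Or.inl rfl)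
    obtain ⟨ψ₁, hψ₁, hm1⟩ := hg 1 (Or.inr rfl)
    -- A glueing map is determined by `T s`, so the ones provided by orientability are `φ₀` and
    -- `φ₁`.
    obtain rfl : ψ₀ = φ₀ := LinearEquiv.ext fun x => Subtype.ext ((hψ₀ x).trans (hφ₀ x).symm)
    obtain rfl : ψ₁ = φ₁ := LinearEquiv.ext fun x => Subtype.ext ((hψ₁ x).trans (hφ₁ x).symm)
    have h3 : o 0 = (frameBasis he 0).orientation ↔ o' 0 = f.orientation := by
      rw [← hm0, hf, ← hmap]
      exact (Orientation.map _ ψ₀).injective.eq_iff.symm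
    have h4 : o 1 = (frameBasis he 1).orientation ↔ o' 1 = ((frameBasis he 1).map ψ₁).orientation := by
      rw [← hm1, ← hmap]
      exact (Orientation.map _ ψ₁).injective.eq_iff.symm
    have h5 : o' 1 = f.orientation ↔ o' 1 = ((frameBasis he 1).map ψ₁).orientation := by
      rw [← h4, ← h1, h3, h2]
    rcases Nat.eq_zero_or_pos (Module.finrank ℝ V) with h0 | h0
    · rw [Module.Basis.orientation_eq_iff_det_pos]
      have : IsEmpty (Fin (Module.finrank ℝ V)) := by rw [h0]; infer_instance
      rw [Module.Basis.det_apply, Matrix.det_isEmpty]; exact one_pos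
    -- There are only two orientations: by `h5`, `o' 1` equals both of those compared or neither,
    -- and in the second case both are its opposite.
    · by_contra hne
      rcases f.orientation_eq_or_eq_neg (o' 1) with h | h
      · exact hne (h.symm.trans (h5.1 h))
      · rcases ((frameBasis he 1).map ψ₁).orientation_eq_or_eq_neg (o' 1) with h' | h'
        · exact hne ((h5.2 h').symm.trans h')
        · exact hne (neg_injective (h.symm.trans h'))
  · intro h
    refine ⟨fun s => (frameBasis he s).orientation, fun _ => f.orientation,
      isContinuousOrientation_frame hc he, ?_, ?_⟩
    · have := isContinuousOrientation_frame continuous_const hfc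
      simpa only [hfb] using this
    · rintro s (rfl | rfl)
      · exact ⟨φ₀, hφ₀, hmap 0 φ₀⟩
      · exact ⟨φ₁, hφ₁, (hmap 1 φ₁).trans h.symm⟩

end Orientation

/-! ### Paths of operators that become onto after adding finitely many dimensions -/

section Algebra

variable {X Y F : Type*} [AddCommGroup X] [Module ℝ X] [AddCommGroup Y] [Module ℝ Y]
  [AddCommGroup F] [Module ℝ F]

theorem finiteDimensional_ker_coprod [FiniteDimensional ℝ F] (A : X →ₗ[ℝ] Y) (B : F →ₗ[ℝ] Y)
    [FiniteDimensional ℝ (LinearMap.ker A)] :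
    FiniteDimensional ℝ (LinearMap.ker (A.coprod B)) := by
  refine Module.Finite.iff_fg.2 (Submodule.fg_of_fg_map_of_fg_inf_ker (LinearMap.snd ℝ X F)
    (IsNoetherian.noetherian _) ?_)
  have hle : LinearMap.ker (A.coprod B) ⊓ LinearMap.ker (LinearMap.snd ℝ X F) ≤
      (LinearMap.ker A).map (LinearMap.inl ℝ X F) := by
    rintro ⟨x, c⟩ ⟨h1, h2⟩
    have h2' : c = 0 := h2
    subst h2'
    exact ⟨x, by simpa using h1, rfl⟩
  have hfg : ((LinearMap.ker A).map (LinearMap.inl ℝ X F)).FG :=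
    (Module.Finite.iff_fg.1 inferInstance).map _
  have := Module.Finite.iff_fg.2 hfg
  exact Module.Finite.iff_fg.1 (Submodule.finiteDimensional_of_le hle)

/-- Dimension count in the sequence `0 → ker A → ker (A ⊕ B) → F → Y / ran A → 0`, which is exact at
its right end because `A ⊕ B` is onto. -/
theorem finrank_ker_coprod [FiniteDimensional ℝ F] {A : X →ₗ[ℝ] Y} {B : F →ₗ[ℝ] Y}
    [FiniteDimensional ℝ (LinearMap.ker A)] (hs : Function.Surjective (A.coprod B)) :
    Module.finrank ℝ (LinearMap.ker (A.coprod B)) + Module.finrank ℝ (Y ⧸ LinearMap.range A) =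
      Module.finrank ℝ F + Module.finrank ℝ (LinearMap.ker A) := by
  have := finiteDimensional_ker_coprod A B
  let π : LinearMap.ker (A.coprod B) →ₗ[ℝ] F := LinearMap.snd ℝ X F ∘ₗ Submodule.subtype _
  let ρ : F →ₗ[ℝ] Y ⧸ LinearMap.range A := (LinearMap.range A).mkQ ∘ₗ B
  have hρ : Function.Surjective ρ := by
    intro y
    obtain ⟨y, rfl⟩ := Submodule.mkQ_surjective _ y
    obtain ⟨⟨x, c⟩, rfl⟩ := hs y
    refine ⟨c, ?_⟩
    simp only [ρ, LinearMap.comp_apply, LinearMap.coprod_apply, map_add]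
    rw [right_eq_add, Submodule.mkQ_apply, Submodule.Quotient.mk_eq_zero]
    exact LinearMap.mem_range_self A x
  have h1 := π.finrank_range_add_finrank_ker
  have h2 := ρ.finrank_range_add_finrank_ker
  rw [LinearMap.range_eq_top.2 hρ, finrank_top] at h2
  have h3 : LinearMap.range π = LinearMap.ker ρ := by
    ext c
    simp only [LinearMap.mem_range, LinearMap.mem_ker, ρ, LinearMap.comp_apply,
      Submodule.mkQ_apply, Submodule.Quotient.mk_eq_zero]
    constructor
    · rintro ⟨⟨⟨x, c⟩, h⟩, rfl⟩
      refine ⟨-x, ?_⟩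
      have h' : A x + B c = 0 := by simpa using h
      rw [map_neg]; exact neg_eq_of_add_eq_zero_right h'
    · rintro ⟨x, hx⟩
      exact ⟨⟨(-x, c), by simp [hx]⟩, rfl⟩
  have h4 : Module.finrank ℝ (LinearMap.ker π) = Module.finrank ℝ (LinearMap.ker A) := by
    refine LinearEquiv.finrank_eq
      { toFun := fun p => ⟨p.1.1.1, ?_⟩
        map_add' := fun p q => rfl
        map_smul' := fun c p => rfl
        invFun := fun x => ⟨⟨(x, 0), by simp⟩, rfl⟩
        left_inv := ?_
        right_inv := fun x => rfl }
    · obtain ⟨⟨⟨x, c⟩, h⟩, h0⟩ := p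
      have h0' : c = 0 := h0
      subst h0'
      simpa using h
    · rintro ⟨⟨⟨x, c⟩, h⟩, h0⟩
      have h0' : c = 0 := h0
      subst h0'
      rfl
  rw [h3] at h1
  omega

end Algebra

/-! ### Right inverses, Fredholm property and transversal subspaces -/

section Operators

variable {X Y : Type*} [NormedAddCommGroup X] [NormedSpace ℝ X] [NormedAddCommGroup Y]
  [NormedSpace ℝ Y]

/-- A finite dimensional kernel has a continuous projection `p`. Then `(T, p)` is a bijection onto
`Y × ker T`, and its inverse is continuous by the open mapping theorem. -/
theorem exists_rightInverse [CompleteSpace X] [CompleteSpace Y] (T : X →L[ℝ] Y)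
    [FiniteDimensional ℝ (LinearMap.ker (T : X →ₗ[ℝ] Y))] (hT : Function.Surjective T) :
    ∃ G : Y →L[ℝ] X, T ∘L G = ContinuousLinearMap.id ℝ Y := by
  obtain ⟨p, hp⟩ := Submodule.ClosedComplemented.of_finiteDimensional
    (LinearMap.ker (T : X →ₗ[ℝ] Y))
  have hinj : LinearMap.ker (T.prod p).toLinearMap = ⊥ := by
    rw [LinearMap.ker_eq_bot']
    intro x hx
    have h1 : T x = 0 := congrArg Prod.fst hx
    have h2 : p x = 0 := congrArg Prod.snd hx
    have h3 := hp ⟨x, h1⟩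
    rw [h2] at h3
    exact (congrArg Subtype.val h3).symm
  have hsurj : LinearMap.range (T.prod p).toLinearMap = ⊤ := by
    rw [LinearMap.range_eq_top]
    rintro ⟨y, z⟩
    obtain ⟨x, rfl⟩ := hT y
    refine ⟨x - p x + z, Prod.ext ?_ ?_⟩
    · have h1 : T (p x) = 0 := (p x).2
      have h2 : T z = 0 := z.2
      simp [h1, h2]
    · simp [hp]
  let e := ContinuousLinearEquiv.ofBijective (T.prod p) hinj hsurj
  refine ⟨e.symm.toContinuousLinearMap ∘L
    ContinuousLinearMap.inl ℝ Y (LinearMap.ker (T : X →ₗ[ℝ] Y)), ?_⟩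
  ext y
  have : T.prod p (e.symm (y, 0)) = (y, 0) :=
    ContinuousLinearEquiv.ofBijective_apply_symm_apply (T.prod p) hinj hsurj (y, 0)
  exact congrArg Prod.fst this

theorem eventually_isUnit_comp [CompleteSpace Y] {Z : Type*} [TopologicalSpace Z]
    {T : Z → X →L[ℝ] Y} (hT : Continuous T)
    {s₀ : Z} {G : Y →L[ℝ] X} (hG : T s₀ ∘L G = ContinuousLinearMap.id ℝ Y) :
    ∀ᶠ s in 𝓝 s₀, IsUnit (T s ∘L G : Y →L[ℝ] Y) := by
  have hc : Continuous fun s => (T s ∘L G : Y →L[ℝ] Y) := hT.clm_comp continuous_const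
  refine hc.continuousAt.eventually (Units.isOpen.mem_nhds ?_)
  change IsUnit (T s₀ ∘L G)
  rw [hG]; exact isUnit_one

/-- A path of operators with right inverses has a continuous path of right inverses. -/
theorem exists_continuous_rightInverse [CompleteSpace Y] {T : I → X →L[ℝ] Y} (hT : Continuous T)
    (h : ∀ s, ∃ G : Y →L[ℝ] X, T s ∘L G = ContinuousLinearMap.id ℝ Y) :
    ∃ G : I → Y →L[ℝ] X, Continuous G ∧ ∀ s y, T s (G s y) = y := by
  -- The right inverses of `T s` form a convex set, so local choices can be averaged by a partition
  -- of unity. The local choice near `s₀` is `G₀ (T(s) G₀)⁻¹`.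
  obtain ⟨G, hG⟩ := exists_continuous_forall_mem_convex_of_local
    (t := fun s : I => {G : Y →L[ℝ] X | T s ∘L G = ContinuousLinearMap.id ℝ Y}) (by
      intro s G hG G' hG' a b _ _ hab
      simp only [mem_ofPred_eq] at hG hG' ⊢
      rw [ContinuousLinearMap.comp_add, ContinuousLinearMap.comp_smul,
        ContinuousLinearMap.comp_smul, hG, hG', ← add_smul, hab, one_smul]) (by
      intro s₀
      obtain ⟨G₀, hG₀⟩ := h s₀
      refine ⟨_, eventually_isUnit_comp hT hG₀, fun s => G₀ ∘L Ring.inverse (T s ∘L G₀), ?_, ?_⟩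
      · intro s hs
        obtain ⟨u, hu⟩ := hs
        refine ContinuousAt.continuousWithinAt ?_
        have h1 := NormedRing.inverse_continuousAt u
        rw [hu] at h1
        have h2 : ContinuousAt (fun s => (T s ∘L G₀ : Y →L[ℝ] Y)) s :=
          (hT.clm_comp continuous_const).continuousAt
        exact continuousAt_const.clm_comp
          (ContinuousAt.comp (f := fun s => (T s ∘L G₀ : Y →L[ℝ] Y)) h1 h2)
      · intro s hs
        have := Ring.mul_inverse_cancel _ hs
        simp only [mem_ofPred_eq]
        rw [← ContinuousLinearMap.comp_assoc]
        exact this)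
  exact ⟨G, G.continuous, fun s y => by simpa using DFunLike.congr_fun (hG s) y⟩

variable {F : Type*} [NormedAddCommGroup F] [NormedSpace ℝ F]

theorem finiteDimensional_ker_of_coprod {A : X →L[ℝ] Y} {B : F →L[ℝ] Y}
    [FiniteDimensional ℝ (LinearMap.ker ((A.coprod B : X × F →L[ℝ] Y) : X × F →ₗ[ℝ] Y))] :
    FiniteDimensional ℝ (LinearMap.ker (A : X →ₗ[ℝ] Y)) := by
  let j : LinearMap.ker (A : X →ₗ[ℝ] Y) →ₗ[ℝ]
      LinearMap.ker ((A.coprod B : X × F →L[ℝ] Y) : X × F →ₗ[ℝ] Y) :=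
    LinearMap.restrict (LinearMap.inl ℝ X F) (by intro x hx; simpa using hx)
  refine FiniteDimensional.of_injective j fun x y h => ?_
  have := congrArg (fun z => z.1.1) h
  exact Subtype.ext this

variable [FiniteDimensional ℝ F]

/-- The `X`-component of a right inverse of `A ⊕ B` inverts `A` up to finite rank: one defect lies
in the projection of the kernel of `A ⊕ B`, the other in the range of `B`. The index comes from
`finrank_ker_coprod`. -/
theorem isFredholmIndexZero_of_coprod [CompleteSpace X] [CompleteSpace Y] {A : X →L[ℝ] Y}
    {B : F →L[ℝ] Y} (hs : Function.Surjective (A.coprod B))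
    [FiniteDimensional ℝ (LinearMap.ker ((A.coprod B : X × F →L[ℝ] Y) : X × F →ₗ[ℝ] Y))]
    (hdim : Module.finrank ℝ (LinearMap.ker ((A.coprod B : X × F →L[ℝ] Y) : X × F →ₗ[ℝ] Y)) =
      Module.finrank ℝ F) : IsFredholmIndexZero A := by
  have hkA : FiniteDimensional ℝ (LinearMap.ker (A : X →ₗ[ℝ] Y)) :=
    finiteDimensional_ker_of_coprod (B := B)
  have hco : ((A.coprod B : X × F →L[ℝ] Y) : X × F →ₗ[ℝ] Y) =
    (A : X →ₗ[ℝ] Y).coprod (B : F →ₗ[ℝ] Y) := rfl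
  constructor
  · obtain ⟨G, hG⟩ := exists_rightInverse (A.coprod B) hs
    have hGy : ∀ y, A (G y).1 + B (G y).2 = y := fun y => by
      simpa using DFunLike.congr_fun hG y
    refine ContinuousLinearMap.IsFredholm.of_isQuasiInverse
      (v := ContinuousLinearMap.fst ℝ X F ∘L G) ?_
    constructor
    · refine LinearMap.FiniteRangeSetoid.equiv_iff_hasNoetherianRange.2 (LinearMap.hasNoetherianRange_iff_range.2 ?_)
      have hle : LinearMap.range ((ContinuousLinearMap.fst ℝ X F ∘L G).toLinearMap ∘ₗ A.toLinearMap -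
          LinearMap.id) ≤ (LinearMap.ker (A.coprod B).toLinearMap).map (LinearMap.fst ℝ X F) := by
        rintro _ ⟨x, rfl⟩
        refine ⟨G (A x) - (x, 0), ?_, rfl⟩
        have := hGy (A x)
        simp [sub_add_eq_add_sub, this]
      have := Submodule.finiteDimensional_of_le hle
      exact inferInstance
    · refine LinearMap.FiniteRangeSetoid.equiv_iff_hasNoetherianRange.2 (LinearMap.hasNoetherianRange_iff_range.2 ?_)
      have hle : LinearMap.range (A.toLinearMap ∘ₗ (ContinuousLinearMap.fst ℝ X F ∘L G).toLinearMap -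
          LinearMap.id) ≤ LinearMap.range B.toLinearMap := by
        rintro _ ⟨y, rfl⟩
        refine ⟨-(G y).2, ?_⟩
        have := hGy y
        simp only [LinearMap.sub_apply, LinearMap.comp_apply, LinearMap.id_apply, map_neg]
        change -B (G y).2 = A (G y).1 - y
        nth_rewrite 3 [← this]
        abel
      have := Submodule.finiteDimensional_of_le hle
      exact inferInstance
  · have h := finrank_ker_coprod (A := (A : X →ₗ[ℝ] Y)) (B := (B : F →ₗ[ℝ] Y)) hs
    rw [hco] at hdim
    rw [hdim] at h
    change Module.finrank ℝ (LinearMap.ker (A : X →ₗ[ℝ] Y)) =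
      Module.finrank ℝ (Y ⧸ LinearMap.range (A : X →ₗ[ℝ] Y))
    omega

/-- Surjectivity is stable: `ran A(s) + ran B(s₀) = Y` for all `s` near `s₀`. By compactness the sum
of finitely many of the spaces `ran B(s₀)` serves for every `s`. -/
theorem exists_isTransversal [CompleteSpace Y] {A : I → X →L[ℝ] Y} (hA : Continuous A)
    {B : I → F →L[ℝ] Y}
    (h : ∀ s, ∃ G : Y →L[ℝ] X × F, (A s).coprod (B s) ∘L G = ContinuousLinearMap.id ℝ Y) :
    ∃ V, IsTransversal A V := by
  have hloc : ∀ s₀, ∀ᶠ s in 𝓝 s₀, (A s).range ⊔ (B s₀).range = ⊤ := by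
    intro s₀
    obtain ⟨G, hG⟩ := h s₀
    have hc : Continuous fun s => (A s).coprod (B s₀) := by
      have : (fun s => (A s).coprod (B s₀)) = fun s =>
          A s ∘L ContinuousLinearMap.fst ℝ X F + B s₀ ∘L ContinuousLinearMap.snd ℝ X F := by
        ext1 s; ext x <;> simp
      rw [this]
      exact (hA.clm_comp continuous_const).add continuous_const
    filter_upwards [eventually_isUnit_comp hc hG] with s hs
    rw [eq_top_iff]
    intro y _
    obtain ⟨z, hz⟩ := (ContinuousLinearMap.isUnit_iff_bijective.1 hs).2 y
    have hz' : A s (G z).1 + B s₀ (G z).2 = y := by simpa using hz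
    rw [← hz']
    exact Submodule.add_mem_sup (LinearMap.mem_range_self _ _) (LinearMap.mem_range_self _ _)
  obtain ⟨t, _, ht⟩ := isCompact_univ.elim_nhds_subcover _ fun s₀ _ => hloc s₀
  refine ⟨t.sup fun s => LinearMap.range (B s).toLinearMap, ?_, fun s => ?_⟩
  · exact Submodule.finiteDimensional_finset_sup _ _
  · obtain ⟨s₀, h0, hs⟩ := mem_iUnion₂.1 (ht (mem_univ s))
    have hs' : (A s).range ⊔ (B s₀).range = ⊤ := hs
    rw [eq_top_iff, ← hs']
    exact sup_le_sup_left (Finset.le_sup (f := fun s => LinearMap.range (B s).toLinearMap) h0) _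

end Operators

/-! ### The abstract index theorem -/

section Columns

variable {n k m : ℕ}

theorem columns_mulVec (h : k + m = n) (v : Fin k → Rn n) (w : Fin m → Rn n) (a : Fin k → ℝ)
    (b : Fin m → ℝ) :
    (columns h v w).mulVec (fun l => Fin.append a b (Fin.cast h.symm l)) =
      ((∑ i, a i • v i + ∑ j, b j • w j : Rn n) : Fin n → ℝ) := by
  subst h
  ext i
  simp [columns, Matrix.mulVec, dotProduct, Fin.sum_univ_add, mul_comm]

theorem columns_mulVec' (h : k + m = n) (v : Fin k → Rn n) (w : Fin m → Rn n) (c : Fin n → ℝ) :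
    (columns h v w).mulVec c =
      ((∑ i, c (Fin.cast h (Fin.castAdd m i)) • v i +
        ∑ j, c (Fin.cast h (Fin.natAdd k j)) • w j : Rn n) : Fin n → ℝ) := by
  rw [← columns_mulVec h]
  congr 1
  subst h
  ext l
  refine Fin.addCases (fun i => ?_) (fun j => ?_) l <;> simp

theorem continuous_columns {Z : Type*} [TopologicalSpace Z] (h : k + m = n) {v : Z → Fin k → Rn n}
    {w : Z → Fin m → Rn n} (hv : Continuous v) (hw : Continuous w) :
    Continuous fun s => columns h (v s) (w s) := by
  subst h
  refine continuous_matrix fun i j => ?_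
  refine Fin.addCases (fun l => ?_) (fun l => ?_) j
  · simp only [columns, Matrix.of_apply, Fin.cast_refl, id_eq, Fin.append_left]
    exact (EuclideanSpace.proj (𝕜 := ℝ) i).continuous.comp ((continuous_apply l).comp hv)
  · simp only [columns, Matrix.of_apply, Fin.cast_refl, id_eq, Fin.append_right]
    exact (EuclideanSpace.proj (𝕜 := ℝ) i).continuous.comp ((continuous_apply l).comp hw)

theorem columns_det_ne_zero (h : k + m = n) {v : Fin k → Rn n} {w : Fin m → Rn n}
    (hv : LinearIndependent ℝ v) (hw : LinearIndependent ℝ w)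
    (hd : Submodule.span ℝ (range v) ⊓ Submodule.span ℝ (range w) = ⊥) :
    (columns h v w).det ≠ 0 := by
  intro h0
  obtain ⟨c, hc, hc'⟩ := Matrix.exists_mulVec_eq_zero_iff.2 h0
  rw [columns_mulVec'] at hc'
  have h1 : ∑ i, c (Fin.cast h (Fin.castAdd m i)) • v i +
        ∑ j, c (Fin.cast h (Fin.natAdd k j)) • w j = 0 := by
    ext i; exact congrFun hc' i
  have hvm : ∑ i, c (Fin.cast h (Fin.castAdd m i)) • v i ∈ Submodule.span ℝ (range v) :=
    Submodule.sum_mem _ fun i _ => Submodule.smul_mem _ _ (Submodule.subset_span (mem_range_self i))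
  have hwm : ∑ j, c (Fin.cast h (Fin.natAdd k j)) • w j ∈ Submodule.span ℝ (range w) :=
    Submodule.sum_mem _ fun i _ => Submodule.smul_mem _ _ (Submodule.subset_span (mem_range_self i))
  have hv0 : ∑ i, c (Fin.cast h (Fin.castAdd m i)) • v i = 0 := by
    rw [← Submodule.mem_bot ℝ, ← hd]
    refine ⟨hvm, ?_⟩
    rw [eq_neg_of_add_eq_zero_left h1]
    exact Submodule.neg_mem _ hwm
  rw [hv0, zero_add] at h1
  apply hc
  subst h
  ext l
  refine Fin.addCases (fun i => ?_) (fun j => ?_) l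
  · exact Fintype.linearIndependent_iff.1 hv _ hv0 i
  · exact Fintype.linearIndependent_iff.1 hw _ h1 j

end Columns

variable {X Y : Type*} [NormedAddCommGroup X] [NormedSpace ℝ X] [NormedAddCommGroup Y]
  [NormedSpace ℝ Y] {n k m : ℕ}

theorem IsFredholmIndexZero.surjective {T : X →L[ℝ] Y} (hT : IsFredholmIndexZero T)
    (hi : Function.Injective T) : Function.Surjective T := by
  have h1 := hT.2
  have h2 : LinearMap.ker T.toLinearMap = ⊥ := LinearMap.ker_eq_bot.2 hi
  have h3 : Module.finrank ℝ (Y ⧸ LinearMap.range T.toLinearMap) = 0 := by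
    refine h1.symm.trans ?_
    rw [h2, finrank_bot]
  have h4 : FiniteDimensional ℝ (Y ⧸ LinearMap.range T.toLinearMap) :=
    hT.1.finite_coker
  have h5 := Module.finrank_zero_iff.1 h3
  rw [Submodule.Quotient.subsingleton_iff] at h5
  exact LinearMap.range_eq_top.1 h5

/-- Operators `A s : X → Y` with an extension `(x, c) ↦ A s x + B s c` to `X × ℝⁿ` that is onto and
whose kernel is identified with `Es s × Eu s` by `(x, c) ↦ (ev x + c, ev x)`. -/
structure SplitExtension (A : I → X →L[ℝ] Y) (B : I → Rn n →L[ℝ] Y) (ev : X →L[ℝ] Rn n)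
    (Es Eu : I → Submodule ℝ (Rn n)) : Prop where
  continuous_left : Continuous A
  continuous_right : Continuous B
  surjective : ∀ s, Function.Surjective ((A s).coprod (B s))
  mem_of_ker : ∀ s x c, A s x + B s c = 0 → ev x + c ∈ Es s ∧ ev x ∈ Eu s
  exists_ker : ∀ s, ∀ a ∈ Es s, ∀ b ∈ Eu s, ∃ x, A s x + B s (a - b) = 0 ∧ ev x = b
  eq_zero : ∀ s x, A s x = 0 → ev x = 0 → x = 0

namespace SplitExtension

variable {A : I → X →L[ℝ] Y} {B : I → Rn n →L[ℝ] Y} {ev : X →L[ℝ] Rn n}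
  {Es Eu : I → Submodule ℝ (Rn n)}

/-- The kernel of the extended operator. -/
noncomputable def kerEquiv (h : SplitExtension A B ev Es Eu) (s : I) :
    LinearMap.ker ((A s).coprod (B s)).toLinearMap ≃ₗ[ℝ] Es s × Eu s := by
  refine LinearEquiv.ofBijective
    { toFun := fun p => (⟨ev p.1.1 + p.1.2, (h.mem_of_ker s p.1.1 p.1.2 p.2).1⟩,
        ⟨ev p.1.1, (h.mem_of_ker s p.1.1 p.1.2 p.2).2⟩)
      map_add' := fun p q => Prod.ext (Subtype.ext ?_) (Subtype.ext ?_)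
      map_smul' := fun c p => Prod.ext (Subtype.ext ?_) (Subtype.ext ?_) } ⟨?_, ?_⟩
  · simp; abel
  · simp
  · simp
  · simp
  · rw [injective_iff_map_eq_zero]
    rintro ⟨⟨x, c⟩, hp⟩ h0
    have h1 : ev x + c = 0 := congrArg (fun z => (z.1 : Rn n)) h0
    have h2 : ev x = 0 := congrArg (fun z => (z.2 : Rn n)) h0
    obtain rfl : c = 0 := by simpa [h2] using h1
    obtain rfl : x = 0 := h.eq_zero s x (by simpa using hp) h2
    rfl
  · rintro ⟨⟨a, ha⟩, ⟨b, hb⟩⟩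
    obtain ⟨x, hx, hxb⟩ := h.exists_ker s a ha b hb
    refine ⟨⟨(x, a - b), by simpa using hx⟩, Prod.ext (Subtype.ext ?_) (Subtype.ext hxb)⟩
    change ev x + (a - b) = a
    rw [hxb]; abel

theorem finiteDimensional_ker (h : SplitExtension A B ev Es Eu) (s : I) :
    FiniteDimensional ℝ (LinearMap.ker ((A s).coprod (B s)).toLinearMap) :=
  (h.kerEquiv s).symm.finiteDimensional

theorem injective (h : SplitExtension A B ev Es Eu) {s : I} (hs : Es s ⊓ Eu s = ⊥) :
    Function.Injective (A s) := by
  rw [injective_iff_map_eq_zero]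
  intro x hx
  have := h.mem_of_ker s x 0 (by simpa using hx)
  rw [add_zero] at this
  refine h.eq_zero s x hx ?_
  rw [← Submodule.mem_bot ℝ, ← hs]
  exact this

variable [CompleteSpace X] [CompleteSpace Y]

theorem exists_rightInverse (h : SplitExtension A B ev Es Eu) :
    ∃ G : I → Y →L[ℝ] X × Rn n, Continuous G ∧ ∀ s y, A s (G s y).1 + B s (G s y).2 = y := by
  have hc : Continuous fun s => (A s).coprod (B s) := by
    have : (fun s => (A s).coprod (B s)) = fun s => A s ∘L ContinuousLinearMap.fst ℝ X (Rn n) +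
        B s ∘L ContinuousLinearMap.snd ℝ X (Rn n) := by
      ext1 s; ext x <;> simp
    rw [this]
    exact (h.continuous_left.clm_comp continuous_const).add
      (h.continuous_right.clm_comp continuous_const)
  obtain ⟨G, hG, hG'⟩ := exists_continuous_rightInverse hc fun s =>
    have := h.finiteDimensional_ker s
    Z2Index.exists_rightInverse _ (h.surjective s)
  exact ⟨G, hG, fun s y => by simpa using hG' s y⟩

/-- Through every element of a kernel there is a continuous section of the kernels. -/
theorem exists_section (h : SplitExtension A B ev Es Eu) (s₀ : I) {a b : Rn n} (ha : a ∈ Es s₀)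
    (hb : b ∈ Eu s₀) : ∃ f g : I → Rn n, Continuous f ∧ Continuous g ∧ f s₀ = a ∧ g s₀ = b ∧
      ∀ s, f s ∈ Es s ∧ g s ∈ Eu s := by
  obtain ⟨G, hG, hGy⟩ := h.exists_rightInverse
  obtain ⟨x, hx, hxb⟩ := h.exists_ker s₀ a ha b hb
  -- The constant pair `(x, a - b)` is known to lie in the kernel at `s₀` only. Subtracting `G s (y
  -- s)` moves it into the kernel at every `s` and changes nothing at `s₀`.
  let y : I → Y := fun s => A s x + B s (a - b)
  have hy : Continuous y := (h.continuous_left.clm_apply continuous_const).add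
    (h.continuous_right.clm_apply continuous_const)
  have hGyc : Continuous fun s => G s (y s) := hG.clm_apply hy
  have hy0 : y s₀ = 0 := hx
  have hmem : ∀ s, ev (x - (G s (y s)).1) + ((a - b) - (G s (y s)).2) ∈ Es s ∧
      ev (x - (G s (y s)).1) ∈ Eu s := fun s => by
    refine h.mem_of_ker s _ _ ?_
    rw [map_sub, map_sub]
    have := hGy s (y s)
    rw [sub_add_sub_comm, this, sub_self]
  refine ⟨_, _, ?_, ?_, ?_, ?_, hmem⟩
  · exact (ev.continuous.comp (continuous_const.sub hGyc.fst)).add (continuous_const.sub hGyc.snd)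
  · exact ev.continuous.comp (continuous_const.sub hGyc.fst)
  · simp [hy0, hxb]
  · simp [hy0, hxb]

theorem exists_frame_left (h : SplitExtension A B ev Es Eu) (hk : ∀ s, Module.finrank ℝ (Es s) = k) :
    ∃ v : I → Fin k → Rn n, Continuous v ∧ FrameOn univ Es v :=
  exists_global_frame (exists_local_frame hk fun s₀ a ha => by
    obtain ⟨f, _, hf, _, hf0, _, hm⟩ := h.exists_section s₀ ha (Submodule.zero_mem _)
    exact ⟨f, hf, hf0, fun s => (hm s).1⟩)

theorem exists_frame_right (h : SplitExtension A B ev Es Eu)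
    (hm : ∀ s, Module.finrank ℝ (Eu s) = m) :
    ∃ v : I → Fin m → Rn n, Continuous v ∧ FrameOn univ Eu v :=
  exists_global_frame (exists_local_frame hm fun s₀ b hb => by
    obtain ⟨_, f, _, hf, _, hf0, hm⟩ := h.exists_section s₀ (Submodule.zero_mem _) hb
    exact ⟨f, hf, hf0, fun s => (hm s).2⟩)

/-- The kernel of the surjective extension has dimension `k + m = n`, which is also the number of
dimensions added to the domain; so the index of `A s` is 0. -/
theorem isFredholmIndexZero (h : SplitExtension A B ev Es Eu) (hkm : k + m = n)
    (hk : ∀ s, Module.finrank ℝ (Es s) = k) (hm : ∀ s, Module.finrank ℝ (Eu s) = m) (s : I) :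
    IsFredholmIndexZero (A s) := by
  have := h.finiteDimensional_ker s
  refine isFredholmIndexZero_of_coprod (h.surjective s) ?_
  rw [(h.kerEquiv s).finrank_eq, Module.finrank_prod, hk, hm, hkm, finrank_euclideanSpace_fin]

theorem isInvertible (h : SplitExtension A B ev Es Eu) (hkm : k + m = n)
    (hk : ∀ s, Module.finrank ℝ (Es s) = k) (hm : ∀ s, Module.finrank ℝ (Eu s) = m) {s : I}
    (hs : Es s ⊓ Eu s = ⊥) : (A s).IsInvertible := by
  have hi := h.injective hs
  exact ⟨ContinuousLinearEquiv.ofBijective (A s) (LinearMap.ker_eq_bot.2 hi)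
    (LinearMap.range_eq_top.2 ((h.isFredholmIndexZero hkm hk hm s).surjective hi)), by ext; rfl⟩

end SplitExtension

/-! ### The fibres over a transversal subspace and their frames -/

section Fibre

variable {T : I → X →L[ℝ] Y} {V : Submodule ℝ Y}

/-- The fibre as the kernel of `(x, y) ↦ T s x - y` on `X × V`. -/
noncomputable def fibreEquiv (T : I → X →L[ℝ] Y) (V : Submodule ℝ Y) (s : I) :
    fibre T V s ≃ₗ[ℝ] LinearMap.ker ((T s).coprod (-V.subtypeL)).toLinearMap where
  toFun x := ⟨(x.1, ⟨T s x.1, x.2⟩), by simp⟩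
  map_add' x y := by ext <;> simp
  map_smul' c x := by ext <;> simp
  invFun p := ⟨p.1.1, by
    obtain ⟨⟨x, y⟩, hp⟩ := p
    have h' : T s x = y := by simpa [add_neg_eq_zero] using hp
    change T s x ∈ V
    rw [h']; exact y.2⟩
  left_inv x := rfl
  right_inv p := by
    obtain ⟨⟨x, y⟩, hp⟩ := p
    have h' : T s x = y := by simpa [add_neg_eq_zero] using hp
    ext
    · rfl
    · exact h'

theorem IsTransversal.surjective (hV : IsTransversal T V) (s : I) :
    Function.Surjective ((T s).coprod (-V.subtypeL)) := by
  intro y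
  have : y ∈ (T s).range ⊔ V := by rw [hV.2 s]; trivial
  obtain ⟨_, ⟨x, rfl⟩, z, hz, rfl⟩ := Submodule.mem_sup.1 this
  exact ⟨(x, ⟨-z, V.neg_mem hz⟩), by simp⟩

theorem IsTransversal.finiteDimensional_ker (hV : IsTransversal T V)
    (hT : ∀ s, IsFredholmIndexZero (T s)) (s : I) :
    FiniteDimensional ℝ (LinearMap.ker ((T s).coprod (-V.subtypeL)).toLinearMap) := by
  have := hV.1
  have : FiniteDimensional ℝ (LinearMap.ker (T s).toLinearMap) := (hT s).1.finite_ker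
  exact finiteDimensional_ker_coprod (T s).toLinearMap (-V.subtypeL).toLinearMap

/-- The fibre is the kernel of a surjective extension of `T s` by `V`, so its dimension is `dim V`
plus the index, which is 0. -/
theorem IsTransversal.finrank_fibre (hV : IsTransversal T V) (hT : ∀ s, IsFredholmIndexZero (T s))
    (s : I) : Module.finrank ℝ (fibre T V s) = Module.finrank ℝ V := by
  have := hV.1
  have : FiniteDimensional ℝ (LinearMap.ker (T s).toLinearMap) := (hT s).1.finite_ker
  have h1 := finrank_ker_coprod (A := (T s).toLinearMap) (B := (-V.subtypeL).toLinearMap)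
    (hV.surjective s)
  have h2 : Module.finrank ℝ (LinearMap.ker (T s).toLinearMap) =
      Module.finrank ℝ (Y ⧸ LinearMap.range (T s).toLinearMap) := (hT s).2
  rw [(fibreEquiv T V s).finrank_eq]
  rw [h2] at h1
  exact Nat.add_right_cancel h1

variable [CompleteSpace X] [CompleteSpace Y]

theorem IsTransversal.exists_frame (hV : IsTransversal T V) (hc : Continuous T)
    (hT : ∀ s, IsFredholmIndexZero (T s)) :
    ∃ e : I → Fin (Module.finrank ℝ V) → X, Continuous e ∧ FrameOn univ (fibre T V) e := by
  have := hV.1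
  have hfd := hV.finiteDimensional_ker hT
  have hfd' : ∀ s, FiniteDimensional ℝ (fibre T V s) := fun s =>
    (fibreEquiv T V s).symm.finiteDimensional
  have hc' : Continuous fun s => (T s).coprod (-V.subtypeL) := by
    have : (fun s => (T s).coprod (-V.subtypeL)) = fun s => T s ∘L ContinuousLinearMap.fst ℝ X V +
        (-V.subtypeL) ∘L ContinuousLinearMap.snd ℝ X V := by
      ext1 s; ext x <;> simp
    rw [this]
    exact (hc.clm_comp continuous_const).add continuous_const
  obtain ⟨G, hG, hGy⟩ := exists_continuous_rightInverse hc' fun s =>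
    Z2Index.exists_rightInverse _ (hV.surjective s)
  refine exists_global_frame (exists_local_frame (hV.finrank_fibre hT) fun s₀ x hx => ?_)
  -- The constant pair `z` is corrected by the right inverse so that it stays in the kernel of `(x,
  -- y) ↦ T s x - y`; its first component is the section.
  let z : X × V := (x, ⟨T s₀ x, hx⟩)
  have hcz : Continuous fun s => G s (((T s).coprod (-V.subtypeL)) z) :=
    hG.clm_apply (hc'.clm_apply continuous_const)
  refine ⟨fun s => x - (G s (((T s).coprod (-V.subtypeL)) z)).1, continuous_const.sub hcz.fst,
    by simp [z], fun s => ?_⟩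
  have h1 : ((T s).coprod (-V.subtypeL)) (z - G s (((T s).coprod (-V.subtypeL)) z)) = 0 := by
    rw [map_sub, hGy, sub_self]
  have h2 : T s (x - (G s (((T s).coprod (-V.subtypeL)) z)).1) =
      (z - G s (((T s).coprod (-V.subtypeL)) z)).2 := by
    rw [ContinuousLinearMap.coprod_apply] at h1
    exact add_neg_eq_zero.1 h1
  change T s _ ∈ V
  rw [h2]
  exact Subtype.property _

end Fibre

variable {X Y : Type*} [NormedAddCommGroup X] [NormedSpace ℝ X] [NormedAddCommGroup Y]
  [NormedSpace ℝ Y] {n k m : ℕ}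

/-- An injective operator of the path maps the fibre onto the transversal subspace. -/
theorem exists_fibre_equiv {T : I → X →L[ℝ] Y} {V : Submodule ℝ Y} {s : I}
    (hi : Function.Bijective (T s)) :
    ∃ φ : fibre T V s ≃ₗ[ℝ] V, ∀ x, (φ x : Y) = T s x := by
  refine ⟨LinearEquiv.ofBijective ((T s).toLinearMap.restrict (p := fibre T V s) (q := V)
    fun x hx => hx) ⟨fun x y h => ?_, fun y => ?_⟩, fun x => rfl⟩
  · exact Subtype.ext (hi.1 (congrArg Subtype.val h))
  · obtain ⟨x, hx⟩ := hi.2 y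
    refine ⟨⟨x, ?_⟩, Subtype.ext hx⟩
    change T s x ∈ V
    rw [hx]; exact y.2

theorem coe_sum_repr {ι : Type*} [Fintype ι] {V : Submodule ℝ Y} (f : Module.Basis ι ℝ V) (d : V) :
    ∑ i, f.repr d i • (f i : Y) = d := by
  conv_rhs => rw [← f.sum_repr d]
  simp only [Submodule.coe_sum, Submodule.coe_smul]

/-! ### Equality of the parity and the index for a split extension -/

namespace SplitExtension

variable [CompleteSpace X] [CompleteSpace Y] {A : I → X →L[ℝ] Y} {B : I → Rn n →L[ℝ] Y}
  {ev : X →L[ℝ] Rn n} {Es Eu : I → Submodule ℝ (Rn n)}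

/-- Both signs are read off from one exact sequence: `[M D]` maps `ℝⁿ × ℝ^{dim V}` onto `ℝⁿ`, its
kernel has the frame `[K; C]`, and `det_mul_pos_iff` compares `M = [v | w]` with the matrix `C` of
`A : A⁻¹(V) → V`. -/
theorem orientable_iff_det_pos (h : SplitExtension A B ev Es Eu) (hkm : k + m = n)
    (hk : ∀ s, Module.finrank ℝ (Es s) = k) (hm : ∀ s, Module.finrank ℝ (Eu s) = m)
    (h0 : Es 0 ⊓ Eu 0 = ⊥) (h1 : Es 1 ⊓ Eu 1 = ⊥) {V : Submodule ℝ Y} (hV : IsTransversal A V)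
    {v : I → Fin k → Rn n} {w : I → Fin m → Rn n} (hv : IsFrame Es v) (hw : IsFrame Eu w) :
    ClutchedBundleOrientable A V ↔
      0 < (columns hkm (v 0) (w 0)).det * (columns hkm (v 1) (w 1)).det := by
  have hF := h.isFredholmIndexZero hkm hk hm
  obtain ⟨e, hec, he⟩ := hV.exists_frame h.continuous_left hF
  have hi0 := h.injective h0
  have hi1 := h.injective h1
  obtain ⟨φ₀, hφ₀⟩ := exists_fibre_equiv (V := V) ⟨hi0, (hF 0).surjective hi0⟩
  obtain ⟨φ₁, hφ₁⟩ := exists_fibre_equiv (V := V) ⟨hi1, (hF 1).surjective hi1⟩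
  rw [clutchedBundleOrientable_iff hec he φ₀ hφ₀ φ₁ hφ₁]
  set f := (frameBasis he 0).map φ₀ with hf
  obtain ⟨G, hGc, hG⟩ := h.exists_rightInverse
  have hemem : ∀ s j, A s (e s j) ∈ V := fun s j => by
    have : e s j ∈ fibre A V s := by rw [← frameBasis_apply he]; exact Subtype.property _
    exact this
  -- `f` is the image of the frame `e` at 0, so `C 0 = 1` and the sign of `det (C 1)` decides
  -- orientability.
  let C : I → Matrix (Fin (Module.finrank ℝ V)) (Fin (Module.finrank ℝ V)) ℝ := fun s =>
    Matrix.of fun i j => f.repr ⟨A s (e s j), hemem s j⟩ i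
  have hCsum : ∀ s j, ∑ i, C s i j • (f i : Y) = A s (e s j) := fun s j =>
    coe_sum_repr f ⟨A s (e s j), hemem s j⟩
  have hfli : LinearIndependent ℝ fun i => (f i : Y) :=
    f.linearIndependent.map' V.subtype (Submodule.ker_subtype _)
  have hej : ∀ j, Continuous fun s => e s j := fun j => (continuous_apply j).comp hec
  have hCj : ∀ j, Continuous fun s i => C s i j := fun j => by
    refine continuous_coordinates (v := fun _ : I => fun i => (f i : Y)) continuous_const
      (fun _ => hfli) ?_
    simp only [hCsum]
    exact h.continuous_left.clm_apply (hej j)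
  have hC : Continuous C := continuous_matrix fun i j => (continuous_apply i).comp (hCj j)
  have hCij : ∀ i j, Continuous fun s => C s i j := fun i j => (continuous_apply i).comp (hCj j)
  have hC0 : C 0 = 1 := by
    ext i j
    have : (⟨A 0 (e 0 j), hemem 0 j⟩ : V) = f j := by
      refine Subtype.ext ?_
      rw [hf, Module.Basis.map_apply, hφ₀, frameBasis_apply]
    simp [C, this, Matrix.one_apply, Finsupp.single_apply, eq_comm]
  have hC1 : (C 1).det = f.det ((frameBasis he 1).map φ₁) := by
    rw [Module.Basis.det_apply]
    congr 1
    ext i j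
    have : (⟨A 1 (e 1 j), hemem 1 j⟩ : V) = ((frameBasis he 1).map φ₁) j := by
      refine Subtype.ext ?_
      rw [Module.Basis.map_apply, hφ₁, frameBasis_apply]
    simp only [C, Matrix.of_apply, this, Module.Basis.toMatrix_apply]
  let g : I → Fin (Module.finrank ℝ V) → X × Rn n := fun s i => G s (f i)
  have hgc : ∀ i, Continuous fun s => g s i := fun i => hGc.clm_apply continuous_const
  have hg : ∀ s i, A s (g s i).1 + B s (g s i).2 = f i := fun s i => hG s (f i)
  -- The pair `(e_j, 0) - ∑ C_ij g_i` is in the kernel of the extension; `p` and `q` are its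
  -- boundary values in `Es` and `Eu`, and `p - q = -∑ C_ij (g_i).2`.
  let p : I → Fin (Module.finrank ℝ V) → Rn n := fun s j =>
    ev (e s j - ∑ i, C s i j • (g s i).1) + (0 - ∑ i, C s i j • (g s i).2)
  let q : I → Fin (Module.finrank ℝ V) → Rn n := fun s j =>
    ev (e s j - ∑ i, C s i j • (g s i).1)
  have hq : ∀ j, Continuous fun s => q s j := fun j => ev.continuous.comp ((hej j).sub
    (continuous_finsetSum _ fun i _ => (hCij i j).smul (hgc i).fst))
  have hp : ∀ j, Continuous fun s => p s j := fun j => (hq j).add (continuous_const.sub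
    (continuous_finsetSum _ fun i _ => (hCij i j).smul (hgc i).snd))
  have hpq : ∀ s j, p s j ∈ Es s ∧ q s j ∈ Eu s := fun s j => by
    refine h.mem_of_ker s _ _ ?_
    have h1 : A s (∑ i, C s i j • (g s i).1) + B s (∑ i, C s i j • (g s i).2) = A s (e s j) := by
      rw [map_sum, map_sum, ← Finset.sum_add_distrib, ← hCsum]
      refine Finset.sum_congr rfl fun i _ => ?_
      rw [map_smul, map_smul, ← smul_add, hg]
    rw [map_sub, map_sub, map_zero, ← h1]
    abel
  have hα : ∀ s j, ∃ c : Fin k → ℝ, ∑ i, c i • v s i = p s j := fun s j => by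
    rw [← Submodule.mem_span_range_iff_exists_fun, (hv.2 s).2]; exact (hpq s j).1
  have hβ : ∀ s j, ∃ c : Fin m → ℝ, ∑ i, c i • w s i = q s j := fun s j => by
    rw [← Submodule.mem_span_range_iff_exists_fun, (hw.2 s).2]; exact (hpq s j).2
  choose α hα using hα
  choose β hβ using hβ
  have hαc : ∀ j, Continuous fun s => α s j := fun j =>
    continuous_coordinates hv.1 (fun s => (hv.2 s).1) (by simpa only [hα] using hp j)
  have hβc : ∀ j, Continuous fun s => β s j := fun j =>
    continuous_coordinates hw.1 (fun s => (hw.2 s).1) (by simpa only [hβ] using hq j)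
  let M : I → Matrix (Fin n) (Fin n) ℝ := fun s => columns hkm (v s) (w s)
  let D : I → Matrix (Fin n) (Fin (Module.finrank ℝ V)) ℝ := fun s =>
    Matrix.of fun l i => (g s i).2 l
  -- The minus sign makes `M K` the difference `p - q`, which is what `M K + D C = 0` requires.
  let K : I → Matrix (Fin n) (Fin (Module.finrank ℝ V)) ℝ := fun s =>
    Matrix.of fun l j => Fin.append (α s j) (-β s j) (Fin.cast hkm.symm l)
  have hKapp : ∀ s j, (M s).mulVec (fun l => K s l j) = ((p s j - q s j : Rn n) : Fin n → ℝ) := by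
    intro s j
    have := columns_mulVec hkm (v s) (w s) (α s j) (-β s j)
    simp only [Pi.neg_apply, neg_smul, Finset.sum_neg_distrib, hα, hβ, ← sub_eq_add_neg] at this
    exact this
  have hDapp : ∀ s (c : Fin (Module.finrank ℝ V) → ℝ),
      (D s).mulVec c = ((∑ i, c i • (g s i).2 : Rn n) : Fin n → ℝ) := by
    intro s c
    ext l
    simp [D, Matrix.mulVec, dotProduct, mul_comm]
  have hfin : 0 < (M 0).det * (M 1).det ↔ 0 < (C 0).det * (C 1).det := by
    refine det_mul_pos_iff (D := D) (K := K) (continuous_columns hkm hv.1 hw.1) ?_ ?_ hC ?_ ?_ ?_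
    · refine continuous_matrix fun l i => ?_
      exact (EuclideanSpace.proj (𝕜 := ℝ) l).continuous.comp (hgc i).snd
    · refine continuous_matrix fun l j => ?_
      have : Continuous fun s => Fin.append (α s j) (-β s j) (Fin.cast hkm.symm l) := by
        refine Fin.addCases (fun i => ?_) (fun i => ?_) (Fin.cast hkm.symm l)
        · simp only [Fin.append_left]
          exact (continuous_apply i).comp (hαc j)
        · simp only [Fin.append_right]
          exact ((continuous_apply i).comp (hβc j)).neg
      exact this
    · intro s
      ext l j
      have h1 := congrFun (hKapp s j) l
      have h2 := congrFun (hDapp s fun i => C s i j) l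
      have h3 : (M s * K s) l j = (M s).mulVec (fun l => K s l j) l := rfl
      have h4 : (D s * C s) l j = (D s).mulVec (fun i => C s i j) l := rfl
      rw [Matrix.add_apply, h3, h4, h1, h2]
      simp [p, q]
    · intro s z
      -- Transversality gives `A x - d = B z` with `d ∈ V`. Then `(-x, z) + ∑ d_i g_i` is in the
      -- kernel, and the difference of its boundary values is `z + ∑ d_i (g_i).2`, so `z` is in the
      -- range of `[M D]`.
      obtain ⟨⟨x, d⟩, hxd⟩ := hV.surjective s (B s (WithLp.toLp 2 z))
      have hxd' : A s x - d = B s (WithLp.toLp 2 z) := by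
        simpa [sub_eq_add_neg] using hxd
      have hm := h.mem_of_ker s (-x - ∑ i, (-f.repr d i) • (g s i).1)
        (WithLp.toLp 2 z - ∑ i, (-f.repr d i) • (g s i).2) (by
          have h1 : A s (∑ i, (-f.repr d i) • (g s i).1) + B s (∑ i, (-f.repr d i) • (g s i).2) =
              -(d : Y) := by
            rw [map_sum, map_sum, ← Finset.sum_add_distrib, ← coe_sum_repr f d,
              ← Finset.sum_neg_distrib]
            refine Finset.sum_congr rfl fun i _ => ?_
            rw [map_smul, map_smul, ← smul_add, hg, neg_smul]
          rw [map_sub, map_sub, map_neg, ← hxd', sub_add_sub_comm, h1]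
          abel)
      obtain ⟨hma, hmb⟩ := hm
      rw [← (hv.2 s).2, Submodule.mem_span_range_iff_exists_fun] at hma
      rw [← (hw.2 s).2, Submodule.mem_span_range_iff_exists_fun] at hmb
      obtain ⟨a, ha⟩ := hma
      obtain ⟨b, hb⟩ := hmb
      refine ⟨fun l => Fin.append a (-b) (Fin.cast hkm.symm l), fun i => -f.repr d i, ?_⟩
      rw [hDapp]
      have h1 := columns_mulVec hkm (v s) (w s) a (-b)
      simp only [Pi.neg_apply, neg_smul, Finset.sum_neg_distrib, ha, hb] at h1
      rw [h1]
      ext l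
      simp
      ring
    · intro s c hKc hCc
      -- The combination `∑ c_j e_j` is annihilated by `A s` because `C c = 0`, and by `ev` because
      -- the `Eu`-part of `K c` vanishes; hence it is 0.
      have hCe : A s (∑ j, c j • e s j) = 0 := by
        rw [map_sum]
        have : ∀ j, A s (c j • e s j) = ∑ i, (c j * C s i j) • (f i : Y) := fun j => by
          rw [map_smul, ← hCsum, Finset.smul_sum]; simp only [smul_smul]
        simp only [this]
        rw [Finset.sum_comm]
        refine Finset.sum_eq_zero fun i _ => ?_
        rw [← Finset.sum_smul]
        have := congrFun hCc i
        simp only [Matrix.mulVec, dotProduct, Pi.zero_apply] at this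
        rw [← Finset.sum_congr rfl fun j _ => mul_comm (C s i j) (c j), this, zero_smul]
      have hβ0 : ∀ i, ∑ j, c j * β s j i = 0 := fun i => by
        have := congrFun hKc (Fin.cast hkm (Fin.natAdd k i))
        simp only [K, Matrix.mulVec, dotProduct, Matrix.of_apply, Fin.cast_cast, Fin.cast_eq_self,
          Fin.append_right, Pi.neg_apply, Pi.zero_apply, neg_mul, Finset.sum_neg_distrib,
          neg_eq_zero] at this
        simpa only [mul_comm] using this
      have hq0 : ∑ j, c j • q s j = 0 := by
        simp only [← hβ, Finset.smul_sum, smul_smul]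
        rw [Finset.sum_comm]
        refine Finset.sum_eq_zero fun i _ => ?_
        rw [← Finset.sum_smul, hβ0, zero_smul]
      have hCg : ∑ j, c j • ∑ i, C s i j • (g s i).1 = 0 := by
        simp only [Finset.smul_sum, smul_smul]
        rw [Finset.sum_comm]
        refine Finset.sum_eq_zero fun i _ => ?_
        rw [← Finset.sum_smul]
        have := congrFun hCc i
        simp only [Matrix.mulVec, dotProduct, Pi.zero_apply] at this
        rw [← Finset.sum_congr rfl fun j _ => mul_comm (C s i j) (c j), this, zero_smul]
      have hev : ev (∑ j, c j • e s j) = 0 := by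
        have : ∑ j, c j • q s j = ev (∑ j, c j • e s j) - ev (∑ j, c j • ∑ i, C s i j • (g s i).1) := by
          simp only [q, map_sub, map_sum, map_smul, smul_sub, Finset.sum_sub_distrib]
        rw [hq0, hCg, map_zero, sub_zero] at this
        exact this.symm
      exact funext (Fintype.linearIndependent_iff.1 (he s (mem_univ s)).1 c (h.eq_zero s _ hCe hev))
  rw [hfin, hC0, Matrix.det_one, one_mul, hC1]

/-- In `orientable_iff_det_pos` the left side does not depend on the frames and the right side does
not depend on `V`. Thus each invariant is independent of its choices, and the two agree. -/
theorem exists_hasParity_hasZ2Index (h : SplitExtension A B ev Es Eu) (hkm : k + m = n)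
    (hk : ∀ s, Module.finrank ℝ (Es s) = k) (hm : ∀ s, Module.finrank ℝ (Eu s) = m)
    (h0 : Es 0 ⊓ Eu 0 = ⊥) (h1 : Es 1 ⊓ Eu 1 = ⊥) :
    ∃ p, HasParity A p ∧ HasZ2Index Es Eu p := by
  obtain ⟨v, hvc, hvf⟩ := h.exists_frame_left hk
  obtain ⟨w, hwc, hwf⟩ := h.exists_frame_right hm
  have hv : IsFrame Es v := ⟨hvc, fun s => hvf s (mem_univ s)⟩
  have hw : IsFrame Eu w := ⟨hwc, fun s => hwf s (mem_univ s)⟩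
  obtain ⟨V₀, hV₀⟩ := exists_isTransversal h.continuous_left (B := B) fun s => by
    have := h.finiteDimensional_ker s
    exact Z2Index.exists_rightInverse _ (h.surjective s)
  have key := fun V (hV : IsTransversal A V) v w (hv : IsFrame Es v) (hw : IsFrame Eu w) =>
    h.orientable_iff_det_pos hkm hk hm h0 h1 hV hv hw
  have hsup : ∀ s, Es s ⊓ Eu s = ⊥ → Es s ⊔ Eu s = ⊤ := fun s hs => by
    refine Submodule.eq_top_of_disjoint _ _ ?_ (disjoint_iff.2 hs)
    rw [hk, hm, hkm, finrank_euclideanSpace_fin]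
  have hdet : ∀ (v : I → Fin k → Rn n) (w : I → Fin m → Rn n), IsFrame Es v → IsFrame Eu w →
      (columns hkm (v 0) (w 0)).det * (columns hkm (v 1) (w 1)).det ≠ 0 := by
    intro v w hv hw
    refine mul_ne_zero ?_ ?_
    · exact columns_det_ne_zero hkm (hv.2 0).1 (hw.2 0).1 (by rw [(hv.2 0).2, (hw.2 0).2, h0])
    · exact columns_det_ne_zero hkm (hv.2 1).1 (hw.2 1).1 (by rw [(hv.2 1).2, (hw.2 1).2, h1])
  refine ⟨w1 A V₀, ⟨⟨h.continuous_left, h.isFredholmIndexZero hkm hk hm,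
    h.isInvertible hkm hk hm h0, h.isInvertible hkm hk hm h1⟩, ⟨V₀, hV₀⟩, fun V hV => ?_⟩,
    k, m, hkm, ⟨hk, continuous_starProjection hvc hvf⟩, ⟨hm, continuous_starProjection hwc hwf⟩,
    hsup 0 h0, hsup 1 h1, ⟨v, hv⟩, ⟨w, hw⟩, fun v' w' hv' hw' => ?_⟩
  · have : ClutchedBundleOrientable A V ↔ ClutchedBundleOrientable A V₀ :=
      (key V hV v w hv hw).trans (key V₀ hV₀ v w hv hw).symm
    unfold w1
    by_cases h' : ClutchedBundleOrientable A V
    · rw [if_pos h', if_pos (this.1 h')]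
    · rw [if_neg h', if_neg fun h'' => h' (this.2 h'')]
  · rw [Matrix.det_mul]
    have := key V₀ hV₀ v' w' hv' hw'
    rcases lt_or_gt_of_ne (hdet v' w' hv' hw') with hlt | hgt
    · exact Or.inr ⟨if_neg fun hor => (this.1 hor).not_gt hlt, hlt⟩
    · exact Or.inl ⟨if_pos (this.2 hgt), hgt⟩

end SplitExtension

/-! ### A Lyapunov form for a hyperbolic matrix -/

section Lyapunov

open Module.End

variable {n : ℕ}

/-- The real part of the standard hermitian form on `ℂⁿ`. -/
noncomputable def reDot (n : ℕ) : (Fin n → ℂ) →ₗ[ℝ] (Fin n → ℂ) →ₗ[ℝ] ℝ :=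
  LinearMap.mk₂ ℝ (fun x y => ∑ i, ((x i).re * (y i).re + (x i).im * (y i).im))
    (fun x x' y => by simp only [Pi.add_apply, Complex.add_re, Complex.add_im,
      ← Finset.sum_add_distrib]; exact Finset.sum_congr rfl fun i _ => by ring)
    (fun c x y => by simp only [Pi.smul_apply, Complex.smul_re, Complex.smul_im, smul_eq_mul,
      Finset.mul_sum]; exact Finset.sum_congr rfl fun i _ => by ring)
    (fun x y y' => by simp only [Pi.add_apply, Complex.add_re, Complex.add_im,
      ← Finset.sum_add_distrib]; exact Finset.sum_congr rfl fun i _ => by ring)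
    (fun c x y => by simp only [Pi.smul_apply, Complex.smul_re, Complex.smul_im, smul_eq_mul,
      Finset.mul_sum]; exact Finset.sum_congr rfl fun i _ => by ring)

theorem reDot_apply (x y : Fin n → ℂ) :
    reDot n x y = ∑ i, ((x i).re * (y i).re + (x i).im * (y i).im) := rfl

theorem reDot_comm (x y : Fin n → ℂ) : reDot n x y = reDot n y x := by
  simp only [reDot_apply, mul_comm]

theorem reDot_nonneg (x : Fin n → ℂ) : 0 ≤ reDot n x x := by
  rw [reDot_apply]
  exact Finset.sum_nonneg fun i _ => add_nonneg (mul_self_nonneg _) (mul_self_nonneg _)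

theorem reDot_pos {x : Fin n → ℂ} (hx : x ≠ 0) : 0 < reDot n x x := by
  refine lt_of_le_of_ne (reDot_nonneg x) fun h => hx ?_
  rw [reDot_apply, eq_comm, Finset.sum_eq_zero_iff_of_nonneg
    fun i _ => add_nonneg (mul_self_nonneg _) (mul_self_nonneg _)] at h
  ext i
  have := h i (Finset.mem_univ i)
  exact Complex.ext (by simp only [Pi.zero_apply, Complex.zero_re]; nlinarith)
    (by simp only [Pi.zero_apply, Complex.zero_im]; nlinarith)

theorem reDot_smul (μ : ℂ) (x : Fin n → ℂ) : reDot n x (μ • x) = μ.re * reDot n x x := by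
  simp only [reDot_apply, Finset.mul_sum, Pi.smul_apply, smul_eq_mul, Complex.mul_re, Complex.mul_im]
  exact Finset.sum_congr rfl fun i _ => by ring

theorem abs_two_mul_reDot_le {ε : ℝ} (hε : 0 < ε) (x y : Fin n → ℂ) :
    |2 * reDot n x y| ≤ ε * reDot n x x + ε⁻¹ * reDot n y y := by
  have h1 := reDot_nonneg (ε • x + y)
  have h2 := reDot_nonneg (ε • x - y)
  simp only [map_add, map_sub, map_smul, LinearMap.add_apply, LinearMap.sub_apply,
    LinearMap.smul_apply, smul_eq_mul] at h1 h2
  rw [reDot_comm y x] at h1 h2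
  have e := mul_inv_cancel_left₀ hε.ne' (reDot n y y)
  rw [abs_le]
  constructor
  · refine le_of_mul_le_mul_left ?_ hε
    nlinarith
  · refine le_of_mul_le_mul_left ?_ hε
    nlinarith

/-- A positive definite form in which `f - μ` is small on the generalized eigenspace of `μ`. -/
theorem exists_form_of_genEigenspace (f : Module.End ℂ (Fin n → ℂ)) (μ : ℂ) {ε : ℝ} (hε : 0 < ε) :
    ∃ g : (Fin n → ℂ) →ₗ[ℝ] (Fin n → ℂ) →ₗ[ℝ] ℝ, (∀ x y, g x y = g y x) ∧
      (∀ x, x ≠ 0 → 0 < g x x) ∧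
      ∀ x ∈ maxGenEigenspace f μ, |g x (f x) - μ.re * g x x| ≤ ε * g x x := by
  let N : Module.End ℂ (Fin n → ℂ) := f - μ • (1 : Module.End ℂ (Fin n → ℂ))
  -- With this weight `ε⁻¹ c^j = ε c^{j+1}`: the two terms of the inequality `2|⟨x, y⟩| ≤ ε|x|² +
  -- ε⁻¹|y|²`, applied to `N^j x` and `N^{j+1} x`, become `ε` times consecutive terms of `g x x`.
  let c : ℝ := ε⁻¹ * ε⁻¹
  have hc : 0 < c := by positivity
  let L : ℕ → (Fin n → ℂ) →ₗ[ℝ] (Fin n → ℂ) := fun j => (N ^ j).restrictScalars ℝ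
  let g : (Fin n → ℂ) →ₗ[ℝ] (Fin n → ℂ) →ₗ[ℝ] ℝ :=
    ∑ j ∈ Finset.range (n + 1), c ^ j • (reDot n).compl₁₂ (L j) (L j)
  have hg : ∀ x y, g x y = ∑ j ∈ Finset.range (n + 1), c ^ j * reDot n ((N ^ j) x) ((N ^ j) y) := by
    intro x y
    simp [g, L, LinearMap.sum_apply]
  refine ⟨g, fun x y => by simp only [hg, reDot_comm], fun x hx => ?_, fun x hx => ?_⟩
  · rw [hg, Finset.sum_range_succ']
    refine add_pos_of_nonneg_of_pos (Finset.sum_nonneg fun j _ => ?_) ?_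
    · exact mul_nonneg (by positivity) (reDot_nonneg _)
    · simpa using reDot_pos hx
  · have hNx : (N ^ n) x = 0 := by
      rw [maxGenEigenspace_eq_genEigenspace_finrank, mem_genEigenspace_nat] at hx
      simpa [N] using hx
    have hNx' : (N ^ (n + 1)) x = 0 := by
      rw [pow_succ', Module.End.mul_apply, hNx, map_zero]
    have hfx : f x = μ • x + N x := by simp [N]
    have h1 : g x (f x) - μ.re * g x x =
        ∑ j ∈ Finset.range (n + 1), c ^ j * reDot n ((N ^ j) x) ((N ^ (j + 1)) x) := by
      rw [hfx, hg, hg, Finset.mul_sum, ← Finset.sum_sub_distrib]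
      refine Finset.sum_congr rfl fun j _ => ?_
      rw [map_add, map_smul, map_add, reDot_smul, pow_succ, Module.End.mul_apply]
      ring
    have h2 : ∀ j ∈ Finset.range (n + 1),
        |c ^ j * reDot n ((N ^ j) x) ((N ^ (j + 1)) x)| ≤
        2⁻¹ * (ε * (c ^ j * reDot n ((N ^ j) x) ((N ^ j) x)) +
          ε * (c ^ (j + 1) * reDot n ((N ^ (j + 1)) x) ((N ^ (j + 1)) x))) := by
      intro j _
      have h3 := abs_two_mul_reDot_le hε ((N ^ j) x) ((N ^ (j + 1)) x)
      rw [abs_mul, abs_of_pos two_pos] at h3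
      have hcj : 0 < c ^ j := by positivity
      rw [abs_mul, abs_of_pos hcj, pow_succ c]
      have e : ε * c = ε⁻¹ := by simp only [c]; field_simp
      calc c ^ j * |reDot n ((N ^ j) x) ((N ^ (j + 1)) x)|
          = 2⁻¹ * (c ^ j * (2 * |reDot n ((N ^ j) x) ((N ^ (j + 1)) x)|)) := by ring
        _ ≤ 2⁻¹ * (c ^ j * (ε * reDot n ((N ^ j) x) ((N ^ j) x) +
            ε⁻¹ * reDot n ((N ^ (j + 1)) x) ((N ^ (j + 1)) x))) := by gcongr
        _ = _ := by rw [← e]; ring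
    -- The shifted sum is bounded by `g x x`, since its last term vanishes by `N^{n+1} x = 0`.
    have h4 : ∑ j ∈ Finset.range (n + 1), c ^ (j + 1) * reDot n ((N ^ (j + 1)) x) ((N ^ (j + 1)) x) ≤
        g x x := by
      have h5 : ∑ j ∈ Finset.range (n + 1 + 1), c ^ j * reDot n ((N ^ j) x) ((N ^ j) x) = g x x := by
        rw [Finset.sum_range_succ, hNx', map_zero, mul_zero, add_zero, hg]
      rw [← h5, Finset.sum_range_succ' _ (n + 1)]
      exact le_add_of_nonneg_right (mul_nonneg (by positivity) (reDot_nonneg _))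
    rw [h1]
    refine (Finset.abs_sum_le_sum_abs _ _).trans ((Finset.sum_le_sum h2).trans ?_)
    rw [← Finset.mul_sum, Finset.sum_add_distrib, ← Finset.mul_sum, ← Finset.mul_sum, ← hg]
    nlinarith

theorem isCompl_maxGenEigenspace (f : Module.End ℂ (Fin n → ℂ)) (μ : ℂ) :
    IsCompl (maxGenEigenspace f μ) (⨆ (ν) (_ : ν ≠ μ), maxGenEigenspace f ν) := by
  refine ⟨independent_maxGenEigenspace f μ, codisjoint_iff.2 (eq_top_iff.2 ?_)⟩
  rw [← iSup_maxGenEigenspace_eq_top f]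
  refine iSup_le fun ν => ?_
  by_cases h : ν = μ
  · exact h ▸ le_sup_left
  · exact le_sup_of_le_right (le_iSup₂_of_le ν h le_rfl)

/-- The projection onto the generalized eigenspace of `μ` along the other ones. -/
noncomputable def eigenProj (f : Module.End ℂ (Fin n → ℂ)) (μ : ℂ) :
    (Fin n → ℂ) →ₗ[ℂ] (Fin n → ℂ) :=
  Submodule.projection _ _ (isCompl_maxGenEigenspace f μ)

theorem eigenProj_mem (f : Module.End ℂ (Fin n → ℂ)) (μ : ℂ) (x : Fin n → ℂ) :
    eigenProj f μ x ∈ maxGenEigenspace f μ :=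
  Submodule.projection_apply_mem _ x

theorem eigenProj_apply_self {f : Module.End ℂ (Fin n → ℂ)} {μ : ℂ} {x : Fin n → ℂ}
    (hx : x ∈ maxGenEigenspace f μ) : eigenProj f μ x = x :=
  Submodule.projection_apply_of_mem_left _ hx

theorem eigenProj_apply_of_ne {f : Module.End ℂ (Fin n → ℂ)} {μ ν : ℂ} (h : ν ≠ μ) {x : Fin n → ℂ}
    (hx : x ∈ maxGenEigenspace f ν) : eigenProj f μ x = 0 := by
  have : x ∈ ⨆ (ν) (_ : ν ≠ μ), maxGenEigenspace f ν :=
    (le_iSup₂_of_le ν h le_rfl : maxGenEigenspace f ν ≤ _) hx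
  exact (Submodule.projection_apply_eq_zero_iff _).2 this

theorem linearMap_eq_of_maxGenEigenspace (f : Module.End ℂ (Fin n → ℂ))
    {g h : (Fin n → ℂ) →ₗ[ℂ] (Fin n → ℂ)}
    (H : ∀ μ, ∀ x ∈ maxGenEigenspace f μ, g x = h x) : g = h := by
  have : (⊤ : Submodule ℂ (Fin n → ℂ)) ≤ LinearMap.eqLocus g h := by
    rw [← iSup_maxGenEigenspace_eq_top f]
    exact iSup_le fun μ x hx => H μ x hx
  exact LinearMap.ext fun x => this (Submodule.mem_top : x ∈ ⊤)

theorem eigenProj_comm (f : Module.End ℂ (Fin n → ℂ)) (μ : ℂ) (x : Fin n → ℂ) :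
    eigenProj f μ (f x) = f (eigenProj f μ x) := by
  refine LinearMap.congr_fun (f := eigenProj f μ ∘ₗ f) (g := f ∘ₗ eigenProj f μ) ?_ x
  refine linearMap_eq_of_maxGenEigenspace f fun ν y hy => ?_
  have hfy : f y ∈ maxGenEigenspace f ν := mapsTo_maxGenEigenspace_of_comm rfl ν hy
  rw [LinearMap.comp_apply, LinearMap.comp_apply]
  by_cases h : ν = μ
  · subst h
    rw [eigenProj_apply_self hy, eigenProj_apply_self hfy]
  · rw [eigenProj_apply_of_ne h hy, eigenProj_apply_of_ne h hfy, map_zero]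

theorem hasEigenvalue_of_mem_maxGenEigenspace {f : Module.End ℂ (Fin n → ℂ)} {μ : ℂ} {x : Fin n → ℂ}
    (hx : x ∈ maxGenEigenspace f μ) (h0 : x ≠ 0) : f.HasEigenvalue μ := by
  by_contra hne
  apply h0
  have h1 : LinearMap.ker (f - μ • (1 : Module.End ℂ (Fin n → ℂ))) = ⊥ := by
    rw [← eigenspace_def]
    exact not_not.1 hne
  obtain ⟨k, hk⟩ := (mem_maxGenEigenspace f μ x).1 hx
  have h2 : Function.Injective ((f - μ • (1 : Module.End ℂ (Fin n → ℂ))) ^ k) := by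
    rw [Module.End.coe_pow]
    exact (LinearMap.ker_eq_bot.1 h1).iterate k
  exact h2 (hk.trans (map_zero _).symm)

theorem sum_eigenProj (f : Module.End ℂ (Fin n → ℂ)) (x : Fin n → ℂ) :
    ∑ μ ∈ f.finite_hasEigenvalue.toFinset, eigenProj f μ x = x := by
  have h := linearMap_eq_of_maxGenEigenspace f
    (g := ∑ μ ∈ f.finite_hasEigenvalue.toFinset, eigenProj f μ) (h := LinearMap.id) ?_
  · simpa using LinearMap.congr_fun h x
  intro ν y hy
  rw [LinearMap.sum_apply, LinearMap.id_apply]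
  by_cases h0 : y = 0
  · simp [h0]
  rw [Finset.sum_eq_single ν, eigenProj_apply_self hy]
  · intro μ _ hμ
    exact eigenProj_apply_of_ne hμ.symm hy
  · intro hν
    exact absurd (by simpa using hasEigenvalue_of_mem_maxGenEigenspace hy h0) hν

/-- The sum of the generalized eigenspaces with eigenvalue in `Ω`. -/
noncomputable def genSpace (f : Module.End ℂ (Fin n → ℂ)) (Ω : Set ℂ) : Submodule ℂ (Fin n → ℂ) :=
  ⨆ z ∈ Ω, maxGenEigenspace f z

theorem eigenProj_eq_zero_of_mem_genSpace {f : Module.End ℂ (Fin n → ℂ)} {Ω : Set ℂ}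
    {x : Fin n → ℂ} (hx : x ∈ genSpace f Ω) {μ : ℂ} (hμ : μ ∉ Ω) : eigenProj f μ x = 0 := by
  have : genSpace f Ω ≤ LinearMap.ker (eigenProj f μ) :=
    iSup₂_le fun z hz y hy => eigenProj_apply_of_ne (ne_of_mem_of_not_mem hz hμ) hy
  exact this hx

/-- Take `b = ∑ sign(Re μ) g_μ(P_μ x, P_μ y)` over the eigenvalues, with `g_μ` adapted to the
generalized eigenspace of `μ`. Each summand of `b(x, f x)` is about `|Re μ| g_μ(P_μ x, P_μ x)`, and
the signs give definiteness on the two spectral spaces. -/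
theorem exists_complex_lyapunov {f : Module.End ℂ (Fin n → ℂ)}
    (hf : ∀ μ, f.HasEigenvalue μ → μ.re ≠ 0) :
    ∃ b : (Fin n → ℂ) →ₗ[ℝ] (Fin n → ℂ) →ₗ[ℝ] ℝ, (∀ x y, b x y = b y x) ∧
      (∀ x, x ≠ 0 → 0 < b x (f x)) ∧
      (∀ x ∈ genSpace f {z | z.re < 0}, x ≠ 0 → b x x < 0) ∧
      (∀ x ∈ genSpace f {z | 0 < z.re}, x ≠ 0 → 0 < b x x) := by
  -- The tolerance `|Re μ| / 2` costs half of the main term. The value 1 is a filler: forms are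
  -- chosen for every complex `μ`, but only those of eigenvalues enter `b`.
  have hε : ∀ μ : ℂ, 0 < if μ.re = 0 then (1 : ℝ) else |μ.re| / 2 := fun μ => by
    split_ifs with h
    · exact one_pos
    · positivity
  choose g hgs hgp hgf using fun μ => exists_form_of_genEigenspace f μ (hε μ)
  let s := f.finite_hasEigenvalue.toFinset
  let P : ℂ → (Fin n → ℂ) →ₗ[ℝ] (Fin n → ℂ) := fun μ => (eigenProj f μ).restrictScalars ℝ
  let b : (Fin n → ℂ) →ₗ[ℝ] (Fin n → ℂ) →ₗ[ℝ] ℝ :=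
    ∑ μ ∈ s, Real.sign μ.re • (g μ).compl₁₂ (P μ) (P μ)
  have hb : ∀ x y, b x y = ∑ μ ∈ s, Real.sign μ.re * g μ (eigenProj f μ x) (eigenProj f μ y) := by
    intro x y
    simp [b, P, LinearMap.sum_apply]
  have hs : ∀ μ ∈ s, μ.re ≠ 0 := fun μ hμ => hf μ (by simpa [s] using hμ)
  have hnn : ∀ μ x, 0 ≤ g μ x x := fun μ x => by
    by_cases h : x = 0
    · simp [h]
    · exact (hgp μ x h).le
  have hex : ∀ x, x ≠ 0 → ∃ μ ∈ s, eigenProj f μ x ≠ 0 := by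
    intro x hx
    by_contra! h
    exact hx ((sum_eigenProj f x).symm.trans (Finset.sum_eq_zero h))
  refine ⟨b, fun x y => by simp only [hb, hgs], fun x hx => ?_, fun x hx h0 => ?_,
    fun x hx h0 => ?_⟩
  · have hle : ∀ μ ∈ s, |μ.re| / 2 * g μ (eigenProj f μ x) (eigenProj f μ x) ≤
        Real.sign μ.re * g μ (eigenProj f μ x) (eigenProj f μ (f x)) := by
      intro μ hμ
      have h1 := hgf μ _ (eigenProj_mem f μ x)
      rw [if_neg (hs μ hμ), abs_le] at h1
      rw [eigenProj_comm]
      rcases lt_or_gt_of_ne (hs μ hμ) with h | h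
      · rw [Real.sign_of_neg h, abs_of_neg h] at *
        linarith
      · rw [Real.sign_of_pos h, abs_of_pos h] at *
        linarith
    rw [hb]
    obtain ⟨μ, hμ, hμx⟩ := hex x hx
    refine lt_of_lt_of_le ?_ (Finset.sum_le_sum hle)
    refine Finset.sum_pos' (fun ν _ => mul_nonneg (by positivity) (hnn _ _)) ⟨μ, hμ, ?_⟩
    exact mul_pos (half_pos (abs_pos.2 (hs μ hμ))) (hgp _ _ hμx)
  · rw [hb]
    obtain ⟨μ, hμ, hμx⟩ := hex x h0
    refine Finset.sum_neg' (fun ν hν => ?_) ⟨μ, hμ, ?_⟩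
    · rcases lt_or_gt_of_ne (hs ν hν) with h | h
      · rw [Real.sign_of_neg h]
        linarith [hnn ν (eigenProj f ν x)]
      · rw [eigenProj_eq_zero_of_mem_genSpace hx (show ν ∉ {z : ℂ | z.re < 0} from h.not_gt)]
        simp
    · rcases lt_or_gt_of_ne (hs μ hμ) with h | h
      · rw [Real.sign_of_neg h]
        linarith [hgp μ _ hμx]
      · exact absurd (eigenProj_eq_zero_of_mem_genSpace hx
          (show μ ∉ {z : ℂ | z.re < 0} from h.not_gt)) hμx
  · rw [hb]
    obtain ⟨μ, hμ, hμx⟩ := hex x h0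
    refine Finset.sum_pos' (fun ν hν => ?_) ⟨μ, hμ, ?_⟩
    · rcases lt_or_gt_of_ne (hs ν hν) with h | h
      · rw [eigenProj_eq_zero_of_mem_genSpace hx (show ν ∉ {z : ℂ | 0 < z.re} from h.not_gt)]
        simp
      · rw [Real.sign_of_pos h]
        linarith [hnn ν (eigenProj f ν x)]
    · rcases lt_or_gt_of_ne (hs μ hμ) with h | h
      · exact absurd (eigenProj_eq_zero_of_mem_genSpace hx
          (show μ ∉ {z : ℂ | 0 < z.re} from h.not_gt)) hμx
      · rw [Real.sign_of_pos h]
        linarith [hgp μ _ hμx]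

/-- A positive continuous function that is homogeneous of degree two dominates the squared norm. -/
theorem exists_pos_mul_sq_le {E : Type*} [NormedAddCommGroup E] [NormedSpace ℝ E]
    [FiniteDimensional ℝ E] {φ : E → ℝ} (hc : Continuous φ)
    (hh : ∀ (c : ℝ) x, φ (c • x) = c ^ 2 * φ x) (hp : ∀ x, x ≠ 0 → 0 < φ x) :
    ∃ δ > 0, ∀ x, δ * ‖x‖ ^ 2 ≤ φ x := by
  have hK : IsCompact (Metric.sphere (0 : E) 1) :=
    have := FiniteDimensional.proper_real E
    isCompact_sphere 0 1
  have h0 : φ 0 = 0 := by simpa using hh 0 0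
  rcases (Metric.sphere (0 : E) 1).eq_empty_or_nonempty with he | hne
  · refine ⟨1, one_pos, fun x => ?_⟩
    by_cases hx : x = 0
    · simp [hx, h0]
    · have : ‖x‖⁻¹ • x ∈ Metric.sphere (0 : E) 1 := by
        simp [norm_smul, hx]
      rw [he] at this
      exact this.elim
  · obtain ⟨y, hy, hmin⟩ := hK.exists_isMinOn hne hc.continuousOn
    have hy0 : y ≠ 0 := by
      rintro rfl
      simp at hy
    refine ⟨φ y, hp y hy0, fun x => ?_⟩
    by_cases hx : x = 0
    · simp [hx, h0]
    · have h1 : ‖x‖⁻¹ • x ∈ Metric.sphere (0 : E) 1 := by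
        simp [norm_smul, hx]
      have h2 : φ y ≤ φ (‖x‖⁻¹ • x) := hmin h1
      rw [hh] at h2
      have hx' : 0 < ‖x‖ ^ 2 := by positivity
      calc φ y * ‖x‖ ^ 2 ≤ ‖x‖⁻¹ ^ 2 * φ x * ‖x‖ ^ 2 := by gcongr
        _ = φ x := by field_simp

theorem complexInclusion_injective : Function.Injective (complexInclusion n) := by
  intro x y h
  ext i
  have := congrFun h i
  exact Complex.ofReal_injective this

theorem complexInclusion_act (M : Matrix (Fin n) (Fin n) ℝ) (x : Rn n) :
    complexInclusion n (act M x) = Matrix.toLin' (complexMatrix M) (complexInclusion n x) := by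
  ext i
  simp [complexInclusion, Matrix.mulVec, dotProduct]

theorem mem_spectralSpace {M : Matrix (Fin n) (Fin n) ℝ} {Ω : Set ℂ} {x : Rn n} :
    x ∈ spectralSpace M Ω ↔
      complexInclusion n x ∈ genSpace (Matrix.toLin' (complexMatrix M)) Ω := Iff.rfl

theorem IsHyperbolic.re_ne_zero {M : Matrix (Fin n) (Fin n) ℝ} (hM : IsHyperbolic M) {μ : ℂ}
    (h : HasEigenvalue (Matrix.toLin' (complexMatrix M)) μ) : μ.re ≠ 0 := by
  refine hM μ ?_
  have := h.mem_spectrum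
  rwa [Matrix.spectrum_toLin'] at this

/-- Every hyperbolic matrix has an indefinite Lyapunov form. -/
theorem exists_lyapunov {M : Matrix (Fin n) (Fin n) ℝ} (hM : IsHyperbolic M) :
    ∃ b : Rn n →L[ℝ] Rn n →L[ℝ] ℝ, ∃ δ > 0, (∀ x y, b x y = b y x) ∧
      (∀ x, δ * ‖x‖ ^ 2 ≤ b x (act M x)) ∧ (∀ x ∈ negSpace M, x ≠ 0 → b x x < 0) ∧
      (∀ x ∈ posSpace M, x ≠ 0 → 0 < b x x) := by
  obtain ⟨b, hs, hpos, hneg, hpos'⟩ := exists_complex_lyapunov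
    (f := Matrix.toLin' (complexMatrix M)) fun μ hμ => hM.re_ne_zero hμ
  let b₀ : Rn n →ₗ[ℝ] Rn n →ₗ[ℝ] ℝ := b.compl₁₂ (complexInclusion n) (complexInclusion n)
  let b₁ : Rn n →L[ℝ] Rn n →L[ℝ] ℝ := LinearMap.toContinuousLinearMap
    ((LinearMap.toContinuousLinearMap : (Rn n →ₗ[ℝ] ℝ) ≃ₗ[ℝ] (Rn n →L[ℝ] ℝ)).toLinearMap ∘ₗ b₀)
  have hb : ∀ x y, b₁ x y = b (complexInclusion n x) (complexInclusion n y) := fun x y => rfl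
  have hinc : ∀ x : Rn n, x ≠ 0 → complexInclusion n x ≠ 0 := fun x hx h =>
    hx (complexInclusion_injective (h.trans (map_zero _).symm))
  obtain ⟨δ, hδ, hle⟩ := exists_pos_mul_sq_le (φ := fun x : Rn n => b₁ x (act M x))
    (by fun_prop) (fun c x => by simp only [map_smul, smul_apply, smul_eq_mul]; ring)
    (fun x hx => by rw [hb, complexInclusion_act]; exact hpos _ (hinc x hx))
  exact ⟨b₁, δ, hδ, fun x y => by rw [hb, hb, hs], hle,
    fun x hx h0 => hneg _ (mem_spectralSpace.1 hx) (hinc x h0),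
    fun x hx h0 => hpos' _ (mem_spectralSpace.1 hx) (hinc x h0)⟩

/-- Complex conjugation on `ℂⁿ`. -/
noncomputable def conjMap (n : ℕ) : (Fin n → ℂ) →ₛₗ[starRingEnd ℂ] (Fin n → ℂ) where
  toFun x := fun i => starRingEnd ℂ (x i)
  map_add' x y := by ext i; simp
  map_smul' c x := by ext i; simp

theorem conjMap_toLin' (M : Matrix (Fin n) (Fin n) ℝ) (x : Fin n → ℂ) :
    conjMap n (Matrix.toLin' (complexMatrix M) x) =
      Matrix.toLin' (complexMatrix M) (conjMap n x) := by
  ext i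
  simp [conjMap, Matrix.mulVec, dotProduct]

/-- Since `M` is real, conjugation carries the kernel of `(M - z)^k` into that of `(M - z̄)^k`. -/
theorem conjMap_mem_genSpace {M : Matrix (Fin n) (Fin n) ℝ} {Ω : Set ℂ}
    (hΩ : ∀ z ∈ Ω, starRingEnd ℂ z ∈ Ω) {x : Fin n → ℂ}
    (hx : x ∈ genSpace (Matrix.toLin' (complexMatrix M)) Ω) :
    conjMap n x ∈ genSpace (Matrix.toLin' (complexMatrix M)) Ω := by
  have : genSpace (Matrix.toLin' (complexMatrix M)) Ω ≤
      (genSpace (Matrix.toLin' (complexMatrix M)) Ω).comap (conjMap n) := by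
    refine iSup₂_le fun z hz y hy => ?_
    obtain ⟨k, hk⟩ := (mem_maxGenEigenspace _ _ _).1 hy
    have hpow : ∀ (k : ℕ) (y : Fin n → ℂ), conjMap n (((Matrix.toLin' (complexMatrix M) -
        z • (1 : Module.End ℂ (Fin n → ℂ))) ^ k) y) = ((Matrix.toLin' (complexMatrix M) -
        starRingEnd ℂ z • (1 : Module.End ℂ (Fin n → ℂ))) ^ k) (conjMap n y) := by
      intro k
      induction k with
      | zero => intro y; rfl
      | succ k ih =>
        intro y
        rw [pow_succ, pow_succ, Module.End.mul_apply, Module.End.mul_apply, ih]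
        congr 1
        rw [LinearMap.sub_apply, LinearMap.sub_apply, map_sub, conjMap_toLin',
          LinearMap.smul_apply, LinearMap.smul_apply, Module.End.one_apply, Module.End.one_apply,
          map_smulₛₗ]
    refine (le_iSup₂_of_le (starRingEnd ℂ z) (hΩ z hz) le_rfl :
      maxGenEigenspace (Matrix.toLin' (complexMatrix M)) (starRingEnd ℂ z) ≤ _) ?_
    refine (mem_maxGenEigenspace _ _ _).2 ⟨k, ?_⟩
    rw [← hpow, hk, map_zero]
  exact this hx

theorem exists_complexInclusion_of_conjMap {x : Fin n → ℂ} (hx : conjMap n x = x) :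
    ∃ y : Rn n, complexInclusion n y = x := by
  refine ⟨WithLp.toLp 2 fun i => (x i).re, ?_⟩
  ext i
  have : starRingEnd ℂ (x i) = x i := congrFun hx i
  exact Complex.conj_eq_iff_re.1 this

/-- The Lyapunov form has opposite signs on the two complex spectral spaces, so these meet in 0
only, and together they contain every generalized eigenspace. Conjugation invariance carries the
splitting over to real vectors. -/
theorem IsHyperbolic.isCompl {M : Matrix (Fin n) (Fin n) ℝ} (hM : IsHyperbolic M) :
    IsCompl (negSpace M) (posSpace M) := by
  obtain ⟨b, hs, hpos, hneg, hpos'⟩ := exists_complex_lyapunov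
    (f := Matrix.toLin' (complexMatrix M)) fun μ hμ => hM.re_ne_zero hμ
  set f := Matrix.toLin' (complexMatrix M)
  have hdisj : ∀ x, x ∈ genSpace f {z | z.re < 0} → x ∈ genSpace f {z | 0 < z.re} → x = 0 := by
    intro x h1 h2
    by_contra h0
    exact (hneg x h1 h0).not_gt (hpos' x h2 h0)
  have htop : genSpace f {z | z.re < 0} ⊔ genSpace f {z | 0 < z.re} = ⊤ := by
    rw [eq_top_iff, ← iSup_maxGenEigenspace_eq_top f]
    refine iSup_le fun z => ?_
    rcases lt_trichotomy z.re 0 with h | h | h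
    · exact le_sup_of_le_left (le_iSup₂_of_le z h le_rfl)
    · intro x hx
      have : x = 0 := by
        by_contra h0
        exact hM.re_ne_zero (hasEigenvalue_of_mem_maxGenEigenspace hx h0) h
      rw [this]; exact Submodule.zero_mem _
    · exact le_sup_of_le_right (le_iSup₂_of_le z h le_rfl)
  constructor
  · rw [Submodule.disjoint_def]
    intro x h1 h2
    have := hdisj _ (mem_spectralSpace.1 h1) (mem_spectralSpace.1 h2)
    exact complexInclusion_injective (this.trans (map_zero _).symm)
  · rw [codisjoint_iff, eq_top_iff]
    intro x _
    have hx : complexInclusion n x ∈ genSpace f {z | z.re < 0} ⊔ genSpace f {z | 0 < z.re} := by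
      rw [htop]; trivial
    obtain ⟨y, hy, z, hz, hyz⟩ := Submodule.mem_sup.1 hx
    have hy' := conjMap_mem_genSpace (M := M) (fun z hz => by simpa using hz) hy
    have hz' := conjMap_mem_genSpace (M := M) (fun z hz => by simpa using hz) hz
    have hx' : conjMap n (complexInclusion n x) = complexInclusion n x := by
      ext i; simp [conjMap, complexInclusion]
    rw [← hyz, map_add] at hx'
    -- For a real sum `y + z` this vector lies in both spectral spaces, hence vanishes: the two
    -- components are real.
    have h1 : conjMap n y - y = z - conjMap n z := by
      rw [sub_eq_sub_iff_add_eq_add, hx', add_comm]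
    have h2 : conjMap n y - y = 0 := hdisj _ (Submodule.sub_mem _ hy' hy)
      (h1 ▸ Submodule.sub_mem _ hz hz')
    have h3 : conjMap n z = z := by rw [h2] at h1; exact (sub_eq_zero.1 h1.symm).symm
    obtain ⟨a, ha⟩ := exists_complexInclusion_of_conjMap (sub_eq_zero.1 h2)
    obtain ⟨c, hc⟩ := exists_complexInclusion_of_conjMap h3
    have : x = a + c := complexInclusion_injective (by rw [map_add, ha, hc, hyz])
    rw [this]
    exact Submodule.add_mem_sup (mem_spectralSpace.2 (ha ▸ hy)) (mem_spectralSpace.2 (hc ▸ hz))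

end Lyapunov

/-! ### Linear differential equations on the line -/

section LinearODE

variable {E : Type*} [NormedAddCommGroup E] [NormedSpace ℝ E]

/-- The Picard iterates of the equation `u' = a u`, `u(0) = x`. -/
noncomputable def picardTerm (a : ℝ → E →L[ℝ] E) (x : E) : ℕ → ℝ → E
  | 0 => fun _ => x
  | k + 1 => fun t => ∫ s in (0 : ℝ)..t, a s (picardTerm a x k s)

theorem continuous_picardTerm {a : ℝ → E →L[ℝ] E} (ha : Continuous a) (x : E) (k : ℕ) :
    Continuous (picardTerm a x k) := by
  induction k with
  | zero => exact continuous_const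
  | succ k ih =>
    exact intervalIntegral.continuous_primitive
      (fun s t => (ha.clm_apply ih).intervalIntegrable s t) 0

theorem norm_picardTerm_le {a : ℝ → E →L[ℝ] E} (ha : Continuous a) {K : ℝ} (hK : ∀ t, ‖a t‖ ≤ K)
    (x : E) (k : ℕ) (t : ℝ) :
    ‖picardTerm a x k t‖ ≤ ‖x‖ * ((K * |t|) ^ k / k.factorial) := by
  have hK0 : 0 ≤ K := (norm_nonneg _).trans (hK 0)
  induction k generalizing t with
  | zero => simp [picardTerm]
  | succ k ih =>
    have hint : ∀ f : ℝ → ℝ, Continuous f → IntegrableOn f (uIoc 0 t) := fun f hf =>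
      (hf.intervalIntegrable 0 t).def'
    calc ‖picardTerm a x (k + 1) t‖ ≤ ∫ s in uIoc 0 t, ‖a s (picardTerm a x k s)‖ :=
          intervalIntegral.norm_integral_le_integral_norm_uIoc
      _ ≤ ∫ s in uIoc 0 t, K * ‖x‖ * (K ^ k / k.factorial) * |s - 0| ^ k := by
          refine setIntegral_mono_on (hint _ (ha.clm_apply (continuous_picardTerm ha x k)).norm)
            (hint _ (by fun_prop)) measurableSet_uIoc fun s _ => ?_
          calc ‖a s (picardTerm a x k s)‖ ≤ ‖a s‖ * ‖picardTerm a x k s‖ :=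
                (a s).le_opNorm _
            _ ≤ K * (‖x‖ * ((K * |s|) ^ k / k.factorial)) :=
                mul_le_mul (hK s) (ih s) (norm_nonneg _) hK0
            _ = _ := by rw [mul_pow, sub_zero]; ring
      _ = ‖x‖ * ((K * |t|) ^ (k + 1) / (k + 1).factorial) := by
          rw [integral_const_mul, integral_pow_abs_sub_uIoc, sub_zero, Nat.factorial_succ, mul_pow]
          push_cast
          field_simp
          ring

/-- The Picard series is dominated by an exponential series. On bounded intervals the differentiated
series is dominated as well, and it is the same series shifted by one term with `a t` applied. -/
theorem exists_linear_solution [CompleteSpace E] {a : ℝ → E →L[ℝ] E} (ha : Continuous a) {K : ℝ}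
    (hK : ∀ t, ‖a t‖ ≤ K) (x : E) :
    ∃ u : ℝ → E, u 0 = x ∧ ∀ t, HasDerivAt u (a t (u t)) t := by
  have hK0 : 0 ≤ K := (norm_nonneg _).trans (hK 0)
  have hsum : ∀ t, Summable fun k => picardTerm a x k t := fun t =>
    Summable.of_norm_bounded ((Real.summable_pow_div_factorial (K * |t|)).mul_left ‖x‖)
      fun k => norm_picardTerm_le ha hK x k t
  refine ⟨fun t => ∑' k, picardTerm a x k t, ?_, fun t => ?_⟩
  · change ∑' k, picardTerm a x k 0 = x
    rw [tsum_eq_single 0]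
    · rfl
    · intro k hk
      obtain ⟨k, rfl⟩ := Nat.exists_eq_succ_of_ne_zero hk
      simp [picardTerm]
  · let g' : ℕ → ℝ → E := fun k t => match k with
      | 0 => 0
      | k + 1 => a t (picardTerm a x k t)
    -- A majorant valid on the whole interval `|y| < |t| + 1` around `t`; index 0 belongs to the
    -- constant term, whose derivative is 0.
    let B : ℕ → ℝ := fun k => match k with
      | 0 => 0
      | k + 1 => K * (‖x‖ * ((K * (|t| + 1)) ^ k / k.factorial))
    have hB : Summable B := by
      rw [← summable_nat_add_iff 1]
      exact ((Real.summable_pow_div_factorial (K * (|t| + 1))).mul_left ‖x‖).mul_left K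
    have h := hasDerivAt_tsum_of_isPreconnected (g := picardTerm a x) (g' := g') (u := B)
      (t := Ioo (-(|t| + 1)) (|t| + 1)) (y₀ := 0) (y := t) hB isOpen_Ioo isPreconnected_Ioo ?_ ?_ ?_
      (hsum 0) ?_
    · have h2 : ∑' k, g' k t = a t (∑' k, picardTerm a x k t) := by
        have hg : Summable fun k => g' k t := by
          rw [← summable_nat_add_iff 1]
          exact (hsum t).mapL (a t)
        rw [hg.tsum_eq_zero_add, (a t).map_tsum (hsum t)]
        exact zero_add _
      rwa [h2] at h
    · intro k y _
      cases k with
      | zero => exact hasDerivAt_const _ _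
      | succ k =>
        have hc : Continuous fun s => a s (picardTerm a x k s) :=
          ha.clm_apply (continuous_picardTerm ha x k)
        exact intervalIntegral.integral_hasDerivAt_right (hc.intervalIntegrable _ _)
          hc.stronglyMeasurable.stronglyMeasurableAtFilter hc.continuousAt
    · intro k y hy
      cases k with
      | zero => simp [g', B]
      | succ k =>
        refine ((a y).le_opNorm _).trans (mul_le_mul (hK y)
          ((norm_picardTerm_le ha hK x k y).trans ?_) (norm_nonneg _) hK0)
        have : |y| ≤ |t| + 1 := (abs_lt.2 hy).le
        gcongr
    · have := abs_nonneg t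
      constructor <;> linarith
    · have h1 := neg_abs_le t
      have h2 := le_abs_self t
      constructor <;> linarith

theorem linear_solution_unique {a : ℝ → E →L[ℝ] E} {K : ℝ} (hK : ∀ t, ‖a t‖ ≤ K) {u v : ℝ → E}
    (hu : ∀ t, HasDerivAt u (a t (u t)) t) (hv : ∀ t, HasDerivAt v (a t (v t)) t) {t₀ : ℝ}
    (h : u t₀ = v t₀) : u = v := by
  have hK0 : 0 ≤ K := (norm_nonneg _).trans (hK 0)
  refine ODE_solution_unique_univ (v := fun t x => a t x) (s := fun _ => univ) (K := ⟨K, hK0⟩)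
    (fun t => ?_) (fun t => ⟨hu t, mem_univ _⟩) (fun t => ⟨hv t, mem_univ _⟩) h
  refine LipschitzWith.lipschitzOnWith ((a t).lipschitz.weaken ?_)
  exact hK t

/-- The solution operators of a linear equation with bounded continuous coefficients. -/
theorem exists_flow [CompleteSpace E] {a : ℝ → E →L[ℝ] E} (ha : Continuous a) {K : ℝ}
    (hK : ∀ t, ‖a t‖ ≤ K) : ∃ Φ : ℝ → E →ₗ[ℝ] E, (∀ x, Φ 0 x = x) ∧
      (∀ x t, HasDerivAt (fun t => Φ t x) (a t (Φ t x)) t) ∧ ∀ t, Function.Injective (Φ t) := by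
  choose U hU0 hU using exists_linear_solution ha hK
  have hadd : ∀ x y, U (x + y) = fun t => U x t + U y t := fun x y => by
    refine linear_solution_unique hK (hU _) (fun t => ?_) (t₀ := 0) (by simp [hU0])
    rw [map_add]
    exact (hU x t).add (hU y t)
  have hsmul : ∀ (c : ℝ) x, U (c • x) = fun t => c • U x t := fun c x => by
    refine linear_solution_unique hK (hU _) (fun t => ?_) (t₀ := 0) (by simp [hU0])
    rw [map_smul]
    exact (hU x t).const_smul c
  refine ⟨fun t => ⟨⟨fun x => U x t, fun x y => by rw [hadd]⟩, fun c x => congrFun (hsmul c x) t⟩,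
    hU0, hU, fun t x y h => ?_⟩
  have := linear_solution_unique hK (hU x) (hU y) (t₀ := t) h
  rw [← hU0 x, this, hU0]

end LinearODE

/-! ### Lyapunov forms along solutions on a half-line -/

section HalfLine

variable {E : Type*} [NormedAddCommGroup E] [InnerProductSpace ℝ E]

/-- Both `‖u‖²` and its derivative, which is at most `2K‖u‖²` in absolute value, are integrable; a
function with this property tends to 0. -/
theorem tendsto_zero_of_solution_of_integrable {a : ℝ → E →L[ℝ] E} (ha : Continuous a) {K : ℝ}
    (hK : ∀ t, ‖a t‖ ≤ K) {u : ℝ → E} (hu : ∀ t, 0 < t → HasDerivAt u (a t (u t)) t)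
    (hi : IntegrableOn (fun t => ‖u t‖ ^ 2) (Ioi 0)) : Tendsto u atTop (𝓝 0) := by
  have hcont : ContinuousOn u (Ioi 0) := fun t ht => (hu t ht).continuousAt.continuousWithinAt
  have hd : ∀ t ∈ Ioi (0 : ℝ), HasDerivAt (fun t => ‖u t‖ ^ 2) (2 * inner ℝ (u t) (a t (u t))) t :=
    fun t ht => (hu t ht).norm_sq
  have hi' : IntegrableOn (fun t => 2 * inner ℝ (u t) (a t (u t))) (Ioi 0) := by
    refine Integrable.mono' (hi.const_mul (2 * K)) ?_ (Eventually.of_forall fun t => ?_)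
    · refine ContinuousOn.aestronglyMeasurable ?_ measurableSet_Ioi
      exact continuousOn_const.mul (hcont.inner (𝕜 := ℝ) (ha.continuousOn.clm_apply hcont))
    · rw [norm_mul, Real.norm_two, mul_assoc]
      refine mul_le_mul_of_nonneg_left ?_ two_pos.le
      calc ‖inner ℝ (u t) (a t (u t))‖ ≤ ‖u t‖ * ‖a t (u t)‖ := norm_inner_le_norm _ _
        _ ≤ ‖u t‖ * (K * ‖u t‖) := by
          gcongr
          exact (a t).le_of_opNorm_le (hK t) _
        _ = K * ‖u t‖ ^ 2 := by ring
  have h := tendsto_zero_of_hasDerivAt_of_integrableOn_Ioi hd hi' hi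
  rw [tendsto_zero_iff_norm_tendsto_zero]
  have h2 := (Real.continuous_sqrt.tendsto 0).comp h
  rw [Real.sqrt_zero] at h2
  refine h2.congr fun t => ?_
  simp [Real.sqrt_sq]

/-- A form `b` that increases along the solutions of `u' = a u` after time `T`. -/
structure IsLyapunov (a : ℝ → E →L[ℝ] E) (b : E →L[ℝ] E →L[ℝ] ℝ) (δ T : ℝ) : Prop where
  symm : ∀ x y, b x y = b y x
  pos : 0 < δ
  nonneg : 0 ≤ T
  le : ∀ t, T ≤ t → ∀ x, δ * ‖x‖ ^ 2 ≤ b x (a t x)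

/-- The inequality is open: once `‖b‖ ‖a t - A‖ < δ / 2`, replacing `A` by `a t` costs at most half
of the constant. -/
theorem exists_isLyapunov {a : ℝ → E →L[ℝ] E} {A : E →L[ℝ] E} (hlim : Tendsto a atTop (𝓝 A))
    {b : E →L[ℝ] E →L[ℝ] ℝ} (hb : ∀ x y, b x y = b y x) {δ : ℝ} (hδ : 0 < δ)
    (hA : ∀ x, δ * ‖x‖ ^ 2 ≤ b x (A x)) : ∃ T, IsLyapunov a b (δ / 2) T := by
  have h1 : ∀ᶠ t in atTop, ‖b‖ * ‖a t - A‖ < δ / 2 := by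
    have : Tendsto (fun t => ‖b‖ * ‖a t - A‖) atTop (𝓝 (‖b‖ * ‖A - A‖)) :=
      ((hlim.sub_const A).norm).const_mul _
    rw [sub_self, norm_zero, mul_zero] at this
    exact this.eventually_lt_const (half_pos hδ)
  obtain ⟨T, hT⟩ := eventually_atTop.1 h1
  refine ⟨max T 0, hb, half_pos hδ, le_max_right _ _, fun t ht x => ?_⟩
  have h2 := hT t ((le_max_left _ _).trans ht)
  have h3 : |b x ((a t - A) x)| ≤ δ / 2 * ‖x‖ ^ 2 := by
    calc |b x ((a t - A) x)| ≤ ‖b‖ * ‖x‖ * ‖(a t - A) x‖ := b.le_opNorm₂ _ _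
      _ ≤ ‖b‖ * ‖x‖ * (‖a t - A‖ * ‖x‖) := by gcongr; exact (a t - A).le_opNorm x
      _ = ‖b‖ * ‖a t - A‖ * ‖x‖ ^ 2 := by ring
      _ ≤ _ := by gcongr
  have h4 : b x (a t x) = b x (A x) + b x ((a t - A) x) := by
    rw [sub_apply, map_sub]; ring
  have := neg_abs_le (b x ((a t - A) x))
  linarith [hA x]

variable {a : ℝ → E →L[ℝ] E} {b : E →L[ℝ] E →L[ℝ] ℝ} {δ T : ℝ}

theorem IsLyapunov.add_integral_le (h : IsLyapunov a b δ T) (ha : Continuous a) {u : ℝ → E}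
    (hu : ∀ t, HasDerivAt u (a t (u t)) t) {s t : ℝ} (hs : T ≤ s) (hst : s ≤ t) :
    b (u s) (u s) + 2 * δ * ∫ r in s..t, ‖u r‖ ^ 2 ≤ b (u t) (u t) := by
  have hc : Continuous u := continuous_iff_continuousAt.2 fun t => (hu t).continuousAt
  have hd : ∀ r, HasDerivAt (fun r => b (u r) (u r)) (2 * b (u r) (a r (u r))) r := fun r => by
    have h1 := (b.hasFDerivAt.comp_hasDerivAt r (hu r)).clm_apply (hu r)
    have h2 : b (a r (u r)) (u r) + b (u r) (a r (u r)) = 2 * b (u r) (a r (u r)) := by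
      rw [h.symm (a r (u r)) (u r)]; ring
    exact h2 ▸ h1
  have hd' : Continuous fun r => 2 * b (u r) (a r (u r)) :=
    continuous_const.mul ((b.continuous.comp hc).clm_apply (ha.clm_apply hc))
  have h2 := intervalIntegral.integral_eq_sub_of_hasDerivAt (a := s) (b := t) (fun r _ => hd r)
    (hd'.intervalIntegrable _ _)
  have h3 : ∫ r in s..t, 2 * δ * ‖u r‖ ^ 2 ≤ ∫ r in s..t, 2 * b (u r) (a r (u r)) := by
    refine intervalIntegral.integral_mono_on hst ((by fun_prop : Continuous _).intervalIntegrable _ _)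
      (hd'.intervalIntegrable _ _) fun r hr => ?_
    have := h.le r (hs.trans hr.1) (u r)
    linarith
  rw [h2, intervalIntegral.integral_const_mul] at h3
  linarith

/-- `∫ ‖u‖²` is paid for by the growth of `b(u, u)`, so an upper bound on the form bounds the
integral. -/
theorem IsLyapunov.integrable_of_eventually_le (h : IsLyapunov a b δ T) (ha : Continuous a)
    {u : ℝ → E} (hu : ∀ t, HasDerivAt u (a t (u t)) t) {M : ℝ}
    (hM : ∀ᶠ t in atTop, b (u t) (u t) ≤ M) : IntegrableOn (fun t => ‖u t‖ ^ 2) (Ioi 0) := by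
  have hc : Continuous u := continuous_iff_continuousAt.2 fun t => (hu t).continuousAt
  have hc2 : Continuous fun t => ‖u t‖ ^ 2 := by fun_prop
  have h1 : IntegrableOn (fun t => ‖u t‖ ^ 2) (Ioi T) := by
    refine integrableOn_Ioi_of_intervalIntegral_norm_bounded ((M - b (u T) (u T)) / (2 * δ)) T
      (fun i : ℝ => (hc2.integrableOn_Icc.mono_set Ioc_subset_Icc_self)) tendsto_id ?_
    filter_upwards [hM, eventually_ge_atTop T] with t ht hTt
    have h2 := h.add_integral_le ha hu le_rfl hTt
    have h3 : ∫ r in T..t, ‖‖u r‖ ^ 2‖ = ∫ r in T..t, ‖u r‖ ^ 2 := by simp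
    have := h.pos
    rw [id, h3, le_div_iff₀ (by positivity)]
    linarith
  rw [← Ioc_union_Ioi_eq_Ioi h.nonneg]
  exact (hc2.integrableOn_Icc.mono_set Ioc_subset_Icc_self).union h1

theorem IsLyapunov.integrable_of_tendsto (h : IsLyapunov a b δ T) (ha : Continuous a)
    {u : ℝ → E} (hu : ∀ t, HasDerivAt u (a t (u t)) t) (h0 : Tendsto u atTop (𝓝 0)) :
    IntegrableOn (fun t => ‖u t‖ ^ 2) (Ioi 0) := by
  refine h.integrable_of_eventually_le ha hu (M := 1) ?_
  have : Tendsto (fun t => b (u t) (u t)) atTop (𝓝 (b 0 0)) :=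
    ((by fun_prop : Continuous fun z => b z z).tendsto 0).comp h0
  exact this.eventually_le_const (by simp)

/-- Along a nonzero solution `b(u, u)` increases strictly from time `T` on, and it tends to 0; so it
is negative at `T`. -/
theorem IsLyapunov.neg_of_tendsto (h : IsLyapunov a b δ T) (ha : Continuous a) {K : ℝ}
    (hK : ∀ t, ‖a t‖ ≤ K) {u : ℝ → E} (hu : ∀ t, HasDerivAt u (a t (u t)) t)
    (h0 : Tendsto u atTop (𝓝 0)) (hne : u T ≠ 0) : b (u T) (u T) < 0 := by
  have hc : Continuous u := continuous_iff_continuousAt.2 fun t => (hu t).continuousAt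
  have hpos : 0 < ∫ r in T..(T + 1), ‖u r‖ ^ 2 := by
    refine intervalIntegral.intervalIntegral_pos_of_pos ?_ (fun r => ?_) (by linarith)
    · exact (by fun_prop : Continuous fun r => ‖u r‖ ^ 2).intervalIntegrable _ _
    · have : u r ≠ 0 := fun hr => hne (by
        have := linear_solution_unique hK hu (v := fun _ => 0)
          (fun t => by simpa using hasDerivAt_const t (0 : E)) (t₀ := r) hr
        rw [this])
      positivity
  have h1 := h.add_integral_le ha hu le_rfl (by linarith : T ≤ T + 1)
  have h2 : b (u (T + 1)) (u (T + 1)) ≤ 0 := by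
    have : Tendsto (fun t => b (u t) (u t)) atTop (𝓝 (b 0 0)) :=
      ((by fun_prop : Continuous fun z => b z z).tendsto 0).comp h0
    rw [map_zero] at this
    refine ge_of_tendsto this ?_
    filter_upwards [eventually_ge_atTop (T + 1)] with t ht
    have h3 := h.add_integral_le ha hu (by linarith : T ≤ T + 1) ht
    have h4 : 0 ≤ ∫ r in (T + 1)..t, ‖u r‖ ^ 2 :=
      intervalIntegral.integral_nonneg ht fun r _ => by positivity
    have := mul_nonneg (mul_nonneg two_pos.le h.pos.le) h4
    linarith
  have := mul_pos (mul_pos two_pos h.pos) hpos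
  linarith

end HalfLine

/-- For `≤`: at time `T` the stable space is negative for `b`, so it meets the positive space `P` in
0 only. For `≥`: if `dim N` were larger, pulling `N` back from later and later times would produce
in the limit a solution with `b ≤ 0` for all large times, hence decaying, whose initial value is a
unit vector orthogonal to the stable space. -/
theorem finrank_stableSpace {n : ℕ} {S : ℝ → Matrix (Fin n) (Fin n) ℝ}
    (hS : Continuous fun t => act (S t)) {K : ℝ} (hK : ∀ t, ‖act (S t)‖ ≤ K)
    {b : Rn n →L[ℝ] Rn n →L[ℝ] ℝ} {δ T : ℝ} (h : IsLyapunov (fun t => act (S t)) b δ T)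
    {N P : Submodule ℝ (Rn n)} (hNP : IsCompl N P) (hN : ∀ x ∈ N, x ≠ 0 → b x x < 0)
    (hP : ∀ x ∈ P, x ≠ 0 → 0 < b x x) :
    Module.finrank ℝ (stableSpace S 0) = Module.finrank ℝ N := by
  obtain ⟨Φ, hΦ0, hΦ, hΦi⟩ := exists_flow hS hK
  have hmem : ∀ x, x ∈ stableSpace S 0 ↔ Tendsto (fun t => Φ t x) atTop (𝓝 0) := by
    intro x
    constructor
    · rintro ⟨u, hu, rfl, hu0⟩
      have := linear_solution_unique hK hu (hΦ (u 0)) (t₀ := 0) (hΦ0 _).symm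
      rwa [this] at hu0
    · exact fun hx => ⟨_, hΦ x, hΦ0 x, hx⟩
  have hdim := Submodule.finrank_add_eq_of_isCompl hNP
  have hfm : ∀ (t : ℝ) (F : Submodule ℝ (Rn n)), Module.finrank ℝ (F.map (Φ t)) = Module.finrank ℝ F :=
    fun t F => (Submodule.equivMapOfInjective (Φ t) (hΦi t) F).finrank_eq.symm
  apply le_antisymm
  · have hdisj : Disjoint ((stableSpace S 0).map (Φ T)) P := by
      rw [Submodule.disjoint_def]
      rintro _ ⟨x, hx, rfl⟩ hxP
      by_contra h0
      exact (h.neg_of_tendsto hS hK (hΦ x) ((hmem x).1 hx) h0).not_gt (hP _ hxP h0)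
    have := Submodule.finrank_add_finrank_le_of_disjoint hdisj
    rw [hfm] at this
    omega
  · by_contra! hlt
    -- The preimage of `N` under `Φ j` has dimension `dim N`, more than the codimension of the
    -- orthogonal complement of the stable space, so the two intersect.
    have hex : ∀ j : ℕ, ∃ x : Rn n, ‖x‖ = 1 ∧ x ∈ (stableSpace S 0)ᗮ ∧ Φ j x ∈ N := by
      intro j
      have h1 : Module.finrank ℝ (N.comap (Φ j)) = Module.finrank ℝ N := by
        have hs : Function.Surjective (Φ j) := LinearMap.injective_iff_surjective.1 (hΦi j)
        rw [← hfm j, Submodule.map_comap_eq_of_surjective hs]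
      have h2 := Submodule.finrank_add_finrank_orthogonal (stableSpace S 0)
      have h3 : ¬ Disjoint (N.comap (Φ j)) (stableSpace S 0)ᗮ := by
        intro hd
        have := Submodule.finrank_add_finrank_le_of_disjoint hd
        omega
      rw [Submodule.disjoint_def] at h3
      push Not at h3
      obtain ⟨x, hx1, hx2, hx0⟩ := h3
      refine ⟨‖x‖⁻¹ • x, by simp [norm_smul, hx0], Submodule.smul_mem _ _ hx2, ?_⟩
      rw [map_smul]
      exact Submodule.smul_mem _ _ hx1
    choose x hx1 hx2 hx3 using hex
    obtain ⟨y, hy, φ, hφ, hlim⟩ := (isCompact_sphere (0 : Rn n) 1).tendsto_subseq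
      (x := x) fun j => by simpa using hx1 j
    have hy2 : y ∈ (stableSpace S 0)ᗮ :=
      (Submodule.isClosed_orthogonal _).mem_of_tendsto hlim (Eventually.of_forall fun j => hx2 _)
    -- The form is nonpositive at the time `φ j` and increasing before it from `T` on, hence
    -- nonpositive at every fixed `t ≥ T` once `φ j ≥ t`; this passes to the limit.
    have hle : ∀ t, T ≤ t → b (Φ t y) (Φ t y) ≤ 0 := by
      intro t ht
      have hc : Continuous fun z => b (Φ t z) (Φ t z) := by
        have := (Φ t).continuous_of_finiteDimensional
        fun_prop
      refine le_of_tendsto ((hc.tendsto y).comp hlim) ?_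
      filter_upwards [eventually_ge_atTop ⌈t⌉₊] with j hj
      have htj : t ≤ (φ j : ℝ) :=
        (Nat.le_ceil t).trans (Nat.cast_le.2 (hj.trans (hφ.id_le j)))
      have h1 := h.add_integral_le hS (hΦ (x (φ j))) ht htj
      have h2 : 0 ≤ ∫ r in t..(φ j : ℝ), ‖Φ r (x (φ j))‖ ^ 2 :=
        intervalIntegral.integral_nonneg htj fun r _ => by positivity
      have h3 := mul_nonneg (mul_nonneg two_pos.le h.pos.le) h2
      have h4 : b (Φ (φ j) (x (φ j))) (Φ (φ j) (x (φ j))) ≤ 0 := by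
        by_cases h0 : Φ (φ j) (x (φ j)) = 0
        · simp [h0]
        · exact (hN _ (hx3 (φ j)) h0).le
      simp only [Function.comp]
      linarith
    have hi := h.integrable_of_eventually_le hS (hΦ y)
      (by filter_upwards [eventually_ge_atTop T] with t ht using hle t ht)
    have hy1 : y ∈ stableSpace S 0 :=
      (hmem y).2 (tendsto_zero_of_solution_of_integrable hS hK (fun t _ => hΦ y t) hi)
    have hy0 : y = 0 := (Submodule.disjoint_def.1 (Submodule.orthogonal_disjoint _)) y hy1 hy2
    rw [hy0] at hy
    simp at hy

/-! ### Primitives of locally integrable functions -/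

section Primitive

/-- Transfers absolute continuity from a primitive of `‖v‖` to one of `v`, and from `w` to quadratic
expressions in `w`. -/
theorem absolutelyContinuousOnInterval_of_dist_le {X Y : Type*} [PseudoMetricSpace X]
    [PseudoMetricSpace Y] {f : ℝ → X} {g : ℝ → Y} {a b C : ℝ}
    (hg : AbsolutelyContinuousOnInterval g a b)
    (h : ∀ s ∈ uIcc a b, ∀ t ∈ uIcc a b, dist (f s) (f t) ≤ C * dist (g s) (g t)) :
    AbsolutelyContinuousOnInterval f a b := by
  unfold AbsolutelyContinuousOnInterval at hg ⊢
  refine squeeze_zero' (Eventually.of_forall fun _ => Finset.sum_nonneg fun _ _ => dist_nonneg) ?_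
    (by simpa using hg.const_mul C)
  rw [eventually_inf_principal]
  filter_upwards with J hJ
  rw [Finset.mul_sum]
  exact Finset.sum_le_sum fun i hi => h _ (hJ.1 i hi).1 _ (hJ.1 i hi).2

theorem intervalIntegrable_of_locallyIntegrable {E : Type*} [NormedAddCommGroup E] {v : ℝ → E}
    (hv : LocallyIntegrable v volume)
    (a b : ℝ) : IntervalIntegrable v volume a b :=
  (hv.integrableOn_isCompact isCompact_uIcc).intervalIntegrable

variable {E : Type*} [NormedAddCommGroup E] [NormedSpace ℝ E]

/-- `w` is a primitive of the locally integrable function `v`. -/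
structure IsPrimitive (w v : ℝ → E) : Prop where
  locallyIntegrable : LocallyIntegrable v volume
  eq_add : ∀ t, w t = w 0 + ∫ r in (0 : ℝ)..t, v r

theorem IsPrimitive.sub_eq {w v : ℝ → E} (h : IsPrimitive w v) (s t : ℝ) :
    w t - w s = ∫ r in s..t, v r := by
  have hi := intervalIntegrable_of_locallyIntegrable h.locallyIntegrable
  rw [h.eq_add t, h.eq_add s, ← intervalIntegral.integral_interval_sub_left (hi 0 t) (hi 0 s)]
  abel

theorem IsPrimitive.absolutelyContinuousOnInterval {w v : ℝ → E} (h : IsPrimitive w v) (a b : ℝ) :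
    AbsolutelyContinuousOnInterval w a b := by
  have hi := intervalIntegrable_of_locallyIntegrable h.locallyIntegrable
  have h1 := ((hi a b).norm).absolutelyContinuousOnInterval_intervalIntegral (c := a) (by simp)
  refine absolutelyContinuousOnInterval_of_dist_le (C := 1) h1 fun s _ t _ => ?_
  rw [one_mul, dist_eq_norm, dist_eq_norm, h.sub_eq,
    intervalIntegral.integral_interval_sub_left (hi a s).norm (hi a t).norm]
  exact intervalIntegral.norm_integral_le_abs_integral_norm

theorem IsPrimitive.continuous {w v : ℝ → E} (h : IsPrimitive w v) : Continuous w := by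
  refine continuous_iff_continuousAt.2 fun t => ?_
  refine (h.absolutelyContinuousOnInterval (t - 1) (t + 1)).continuousOn.continuousAt ?_
  rw [uIcc_of_le (by linarith)]
  exact Icc_mem_nhds (by linarith) (by linarith)

theorem IsPrimitive.ae_hasDerivAt [CompleteSpace E] {w v : ℝ → E} (h : IsPrimitive w v) :
    ∀ᵐ t, HasDerivAt w (v t) t := by
  filter_upwards [LocallyIntegrable.ae_hasDerivAt_integral h.locallyIntegrable] with t ht
  rw [show w = fun t => w 0 + ∫ r in (0 : ℝ)..t, v r from funext h.eq_add]
  exact (ht 0).const_add _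

theorem IsPrimitive.comp_neg {w v : ℝ → E} (h : IsPrimitive w v) :
    IsPrimitive (fun t => w (-t)) (fun t => -v (-t)) := by
  refine ⟨?_, fun t => ?_⟩
  · have h1 : LocallyIntegrable (fun t : ℝ => v (-t)) volume := by
      refine (locallyIntegrable_iff).2 fun k hk => ?_
      have h2 := h.locallyIntegrable.integrableOn_isCompact hk.neg
      rw [← (Measure.measurePreserving_neg (volume : Measure ℝ)).integrableOn_comp_preimage
        (Homeomorph.neg ℝ).measurableEmbedding] at h2
      simpa [Function.comp_def] using h2
    exact h1.neg
  · rw [h.eq_add (-t), intervalIntegral.integral_neg, intervalIntegral.integral_comp_neg,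
      neg_zero, intervalIntegral.integral_symm]

/-- The difference between `f` and a primitive of `f'` is absolutely continuous with derivative 0
almost everywhere, hence constant. -/
theorem integral_eq_sub_of_absolutelyContinuousOnInterval [CompleteSpace E] {f f' : ℝ → E} {a b : ℝ}
    (hf : AbsolutelyContinuousOnInterval f a b)
    (hd : ∀ᵐ t, HasDerivAt f (f' t) t) (hi : LocallyIntegrable f' volume) :
    ∫ t in a..b, f' t = f b - f a := by
  have hp : IsPrimitive (fun t => ∫ r in (0 : ℝ)..t, f' r) f' := ⟨hi, fun t => by simp⟩
  have hac := hf.sub (hp.absolutelyContinuousOnInterval a b)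
  obtain ⟨C, hC⟩ := hac.const_of_ae_hasDerivAt_zero (by
    filter_upwards [hd, hp.ae_hasDerivAt] with t h1 h2 _
    simpa using h1.sub h2)
  have h1 := hC a left_mem_uIcc
  have h2 := hC b right_mem_uIcc
  rw [← hp.sub_eq a b]
  simp only [Pi.sub_apply] at h1 h2
  have h3 := h1.trans h2.symm
  rw [sub_eq_sub_iff_sub_eq_sub] at h3
  rw [← neg_sub (f a) (f b), h3, neg_sub]

end Primitive

/-! ### A priori estimate on a half-line -/

section Estimate

variable {E : Type*} [NormedAddCommGroup E] [InnerProductSpace ℝ E]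

/-- The derivative of `b(w, w) - κ e^{-Lt} ‖w‖²` along `w' = a w + f`, estimated from below. -/
theorem IsLyapunov.weighted_le {a : ℝ → E →L[ℝ] E} {b : E →L[ℝ] E →L[ℝ] ℝ} {δ T K : ℝ}
    (h : IsLyapunov a b δ T) (hK : ∀ t, ‖a t‖ ≤ K) {κ : ℝ}
    (hκ : κ = Real.exp ((2 * K + 1) * T) * (2 * ‖b‖ * K + 2 * δ)) {t : ℝ} (ht : 0 ≤ t) (w v : E) :
    δ * ‖w‖ ^ 2 - (‖b‖ + κ) ^ 2 / δ * ‖v - a t w‖ ^ 2 ≤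
      2 * b w v - κ * Real.exp (-((2 * K + 1) * t)) * (2 * inner ℝ w v - (2 * K + 1) * ‖w‖ ^ 2) := by
  have hK0 : 0 ≤ K := (norm_nonneg _).trans (hK 0)
  have hδ := h.pos
  have hκ0 : 0 ≤ κ := by rw [hκ]; positivity
  obtain ⟨f, rfl⟩ : ∃ f, v = a t w + f := ⟨v - a t w, by abel⟩
  rw [add_sub_cancel_left, map_add, inner_add_right]
  set e := Real.exp (-((2 * K + 1) * t)) with he
  have he0 : 0 < e := Real.exp_pos _
  have he1 : e ≤ 1 := Real.exp_le_one_iff.2 (by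
    have : 0 ≤ (2 * K + 1) * t := by positivity
    linarith)
  have haw : ‖a t w‖ ≤ K * ‖w‖ := (a t).le_of_opNorm_le (hK t) w
  have hin : inner ℝ w (a t w) ≤ K * ‖w‖ ^ 2 := by
    calc inner ℝ w (a t w) ≤ ‖w‖ * ‖a t w‖ := real_inner_le_norm _ _
      _ ≤ ‖w‖ * (K * ‖w‖) := by gcongr
      _ = _ := by ring
  have hba : -(‖b‖ * K * ‖w‖ ^ 2) ≤ b w (a t w) := by
    have h1 : |b w (a t w)| ≤ ‖b‖ * K * ‖w‖ ^ 2 := by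
      calc |b w (a t w)| ≤ ‖b‖ * ‖w‖ * ‖a t w‖ := b.le_opNorm₂ _ _
        _ ≤ ‖b‖ * ‖w‖ * (K * ‖w‖) := by gcongr
        _ = _ := by ring
    linarith [neg_abs_le (b w (a t w))]
  -- The unforced part. The rate `2K + 1` exceeds the largest growth rate `2K` of `‖w‖²`, so the
  -- weight term always contributes at least `κ e ‖w‖²`; after `T` the form suffices, before `T` the
  -- weight must make up for it.
  have hmain : 2 * δ * ‖w‖ ^ 2 ≤
      2 * b w (a t w) - κ * e * (2 * inner ℝ w (a t w) - (2 * K + 1) * ‖w‖ ^ 2) := by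
    have h1 : κ * e * ‖w‖ ^ 2 ≤ -(κ * e * (2 * inner ℝ w (a t w) - (2 * K + 1) * ‖w‖ ^ 2)) := by
      rw [← mul_neg]
      exact mul_le_mul_of_nonneg_left (by linarith) (by positivity)
    rcases le_total T t with htT | htT
    · have h2 := h.le t htT w
      have h3 : 0 ≤ κ * e * ‖w‖ ^ 2 := by positivity
      linarith
    -- This fixes `κ`: its exponential factor cancels the decay of the weight up to time `T`, and
    -- the other factor outweighs the worst value of the form and leaves `2δ`.
    · have h2 : 2 * ‖b‖ * K + 2 * δ ≤ κ * e := by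
        rw [hκ, mul_right_comm _ _ e, he, ← Real.exp_add]
        refine le_mul_of_one_le_left (by positivity) (Real.one_le_exp ?_)
        nlinarith
      have h3 := mul_le_mul_of_nonneg_right h2 (sq_nonneg ‖w‖)
      linarith
  have hf : -(‖b‖ + κ) * (‖w‖ * ‖f‖) ≤ b w f - κ * e * inner ℝ w f := by
    have h1 : |b w f| ≤ ‖b‖ * ‖w‖ * ‖f‖ := b.le_opNorm₂ _ _
    have h2 : κ * e * inner ℝ w f ≤ κ * (‖w‖ * ‖f‖) := by
      calc κ * e * inner ℝ w f ≤ κ * e * (‖w‖ * ‖f‖) :=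
            mul_le_mul_of_nonneg_left (real_inner_le_norm _ _) (by positivity)
        _ ≤ κ * 1 * (‖w‖ * ‖f‖) := by gcongr
        _ = _ := by ring
    linarith [neg_abs_le (b w f)]
  have hyoung : 2 * ((‖b‖ + κ) * (‖w‖ * ‖f‖)) ≤ δ * ‖w‖ ^ 2 + (‖b‖ + κ) ^ 2 / δ * ‖f‖ ^ 2 := by
    have h1 : 0 ≤ (δ * ‖w‖ - (‖b‖ + κ) * ‖f‖) ^ 2 / δ := by positivity
    have h2 : (δ * ‖w‖ - (‖b‖ + κ) * ‖f‖) ^ 2 / δ =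
        δ * ‖w‖ ^ 2 + (‖b‖ + κ) ^ 2 / δ * ‖f‖ ^ 2 - 2 * ((‖b‖ + κ) * (‖w‖ * ‖f‖)) := by
      field_simp
      ring
    linarith
  linarith

/-- The values of an integrable function are small somewhere far out. -/
theorem frequently_lt_of_integrableOn_Ioi {g : ℝ → ℝ} (hg : IntegrableOn g (Ioi 0))
    {ε : ℝ} (hε : 0 < ε) : ∃ᶠ t in atTop, g t < ε := by
  intro hn
  obtain ⟨R, hR⟩ := eventually_atTop.1 hn
  have h1 : IntegrableOn (fun _ : ℝ => ε) (Ioi (max R 0)) := by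
    refine Integrable.mono' (hg.mono_set (Ioi_subset_Ioi (le_max_right _ _)))
      aestronglyMeasurable_const ?_
    filter_upwards [ae_restrict_mem measurableSet_Ioi] with t ht
    rw [Real.norm_of_nonneg hε.le]
    exact not_lt.1 (hR t ((le_max_left _ _).trans (le_of_lt ht)))
  rw [integrableOn_const_iff] at h1
  simp [hε.ne'] at h1

/-- Integrate `weighted_le` over `[0, R]`. The boundary term at 0 gives `‖w 0‖²`; the one at `R` is
at most `‖b‖ ‖w R‖²`, which is arbitrarily small for suitable large `R` because `‖w‖²` is
integrable. -/
theorem IsLyapunov.exists_integral_le [CompleteSpace E] {a : ℝ → E →L[ℝ] E} {b : E →L[ℝ] E →L[ℝ] ℝ} {δ T K : ℝ}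
    (h : IsLyapunov a b δ T) (hK : ∀ t, ‖a t‖ ≤ K) :
    ∃ C, 0 ≤ C ∧ ∀ w v : ℝ → E, IsPrimitive w v → IntegrableOn (fun t => ‖w t‖ ^ 2) (Ioi 0) →
      IntegrableOn (fun t => ‖v t - a t (w t)‖ ^ 2) (Ioi 0) →
      ∫ t in Ioi (0 : ℝ), ‖w t‖ ^ 2 ≤
        C * (‖w 0‖ ^ 2 + ∫ t in Ioi (0 : ℝ), ‖v t - a t (w t)‖ ^ 2) := by
  have hK0 : 0 ≤ K := (norm_nonneg _).trans (hK 0)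
  have hδ := h.pos
  obtain ⟨κ, hκ⟩ : ∃ κ, κ = Real.exp ((2 * K + 1) * T) * (2 * ‖b‖ * K + 2 * δ) := ⟨_, rfl⟩
  have hκ0 : 0 ≤ κ := by rw [hκ]; positivity
  set D := (‖b‖ + κ) ^ 2 / δ with hD
  have hD0 : 0 ≤ D := by positivity
  refine ⟨(D + (‖b‖ + κ)) / δ, by positivity, fun w v hw hiw hif => ?_⟩
  set e : ℝ → ℝ := fun t => Real.exp (-((2 * K + 1) * t)) with he
  have hed : ∀ t, HasDerivAt e (-(2 * K + 1) * e t) t := fun t => by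
    have h1 : HasDerivAt (fun t : ℝ => -((2 * K + 1) * t)) (-((2 * K + 1) * 1)) t :=
      ((hasDerivAt_id t).const_mul (2 * K + 1)).neg
    have h2 := h1.exp
    rwa [mul_one, mul_comm (Real.exp _)] at h2
  set F : ℝ → ℝ := fun t => b (w t) (w t) - κ * (e t * ‖w t‖ ^ 2) with hF
  have hwc := hw.continuous
  have hFac : ∀ R, AbsolutelyContinuousOnInterval F 0 R := by
    intro R
    have hac := hw.absolutelyContinuousOnInterval 0 R
    obtain ⟨M, hM⟩ := hac.exists_bound
    have hquad : ∀ β : E →L[ℝ] E →L[ℝ] ℝ,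
        AbsolutelyContinuousOnInterval (fun t => β (w t) (w t)) 0 R := by
      intro β
      refine absolutelyContinuousOnInterval_of_dist_le (C := 2 * ‖β‖ * M) hac fun s hs t ht => ?_
      have h1 : β (w s) (w s) - β (w t) (w t) = β (w s - w t) (w s) + β (w t) (w s - w t) := by
        simp
      rw [Real.dist_eq, h1, dist_eq_norm]
      calc |β (w s - w t) (w s) + β (w t) (w s - w t)|
          ≤ |β (w s - w t) (w s)| + |β (w t) (w s - w t)| := abs_add_le _ _
        _ ≤ ‖β‖ * ‖w s - w t‖ * ‖w s‖ + ‖β‖ * ‖w t‖ * ‖w s - w t‖ :=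
            add_le_add (β.le_opNorm₂ _ _) (β.le_opNorm₂ _ _)
        _ ≤ ‖β‖ * ‖w s - w t‖ * M + ‖β‖ * M * ‖w s - w t‖ := by
            gcongr
            · exact hM s hs
            · exact hM t ht
        _ = _ := by ring
    have hsq : AbsolutelyContinuousOnInterval (fun t => ‖w t‖ ^ 2) 0 R := by
      have h1 : (fun t => ‖w t‖ ^ 2) = fun t => inner ℝ (w t) (w t) :=
        funext fun t => (real_inner_self_eq_norm_sq (w t)).symm
      rw [h1]
      exact hquad (innerSL ℝ)
    have heac : AbsolutelyContinuousOnInterval e 0 R := by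
      refine ContDiffOn.absolutelyContinuousOnInterval (ContDiff.contDiffOn ?_)
      fun_prop
    exact (hquad b).fun_sub ((heac.fun_mul hsq).const_mul κ)
  have hFd : ∀ᵐ t, t ∈ Ioi (0 : ℝ) → δ * ‖w t‖ ^ 2 - D * ‖v t - a t (w t)‖ ^ 2 ≤ deriv F t := by
    filter_upwards [hw.ae_hasDerivAt] with t ht ht0
    have h1 : HasDerivAt (fun t => b (w t) (w t)) (2 * b (w t) (v t)) t := by
      have h2 := (b.hasFDerivAt.comp_hasDerivAt t ht).clm_apply ht
      have h3 : b (v t) (w t) + b (w t) (v t) = 2 * b (w t) (v t) := by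
        rw [h.symm (v t) (w t)]; ring
      exact h3 ▸ h2
    have h4 : HasDerivAt F _ t := h1.sub (((hed t).mul ht.norm_sq).const_mul κ)
    rw [h4.deriv]
    refine (h.weighted_le hK hκ (le_of_lt ht0) (w t) (v t)).trans (le_of_eq ?_)
    ring
  have hkey : ∀ R, 0 ≤ R → δ * ∫ t in (0 : ℝ)..R, ‖w t‖ ^ 2 ≤
      D * (∫ t in Ioi (0 : ℝ), ‖v t - a t (w t)‖ ^ 2) + ‖b‖ * ‖w R‖ ^ 2 + (‖b‖ + κ) * ‖w 0‖ ^ 2 := by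
    intro R hR
    have hi1 : IntervalIntegrable (fun t => δ * ‖w t‖ ^ 2) volume 0 R :=
      (by fun_prop : Continuous _).intervalIntegrable _ _
    have hi2 : IntervalIntegrable (fun t => D * ‖v t - a t (w t)‖ ^ 2) volume 0 R := by
      rw [intervalIntegrable_iff_integrableOn_Ioc_of_le hR]
      exact (hif.mono_set Ioc_subset_Ioi_self).const_mul D
    have h1 : ∫ t in (0 : ℝ)..R, (δ * ‖w t‖ ^ 2 - D * ‖v t - a t (w t)‖ ^ 2) ≤
        ∫ t in (0 : ℝ)..R, deriv F t := by
      refine intervalIntegral.integral_mono_ae_restrict hR (hi1.sub hi2)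
        (hFac R).intervalIntegrable_deriv ?_
      have : ∀ᵐ t, t ≠ (0 : ℝ) := by simp [ae_iff]
      filter_upwards [ae_restrict_of_ae hFd, ae_restrict_of_ae this,
        ae_restrict_mem measurableSet_Icc] with t ht hne hmem
      exact ht (lt_of_le_of_ne hmem.1 hne.symm)
    rw [(hFac R).integral_deriv_eq_sub, intervalIntegral.integral_sub hi1 hi2,
      intervalIntegral.integral_const_mul, intervalIntegral.integral_const_mul] at h1
    have h2 : ∫ t in (0 : ℝ)..R, ‖v t - a t (w t)‖ ^ 2 ≤
        ∫ t in Ioi (0 : ℝ), ‖v t - a t (w t)‖ ^ 2 := by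
      rw [intervalIntegral.integral_of_le hR]
      exact setIntegral_mono_set hif (Eventually.of_forall fun t => by positivity)
        (Eventually.of_forall Ioc_subset_Ioi_self)
    have hb : ∀ x, |b x x| ≤ ‖b‖ * ‖x‖ ^ 2 := fun x =>
      (b.le_opNorm₂ x x).trans (le_of_eq (by ring))
    have h3 : F R ≤ ‖b‖ * ‖w R‖ ^ 2 := by
      have h4 : 0 ≤ κ * (e R * ‖w R‖ ^ 2) := by positivity
      simp only [hF]
      linarith [hb (w R), le_abs_self (b (w R) (w R))]
    have h4 : -((‖b‖ + κ) * ‖w 0‖ ^ 2) ≤ F 0 := by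
      simp only [hF, he, mul_zero, neg_zero, Real.exp_zero, one_mul]
      linarith [hb (w 0), neg_abs_le (b (w 0) (w 0))]
    have h5 := mul_le_mul_of_nonneg_left h2 hD0
    linarith
  set I₂ := ∫ t in Ioi (0 : ℝ), ‖v t - a t (w t)‖ ^ 2 with hI₂
  have hI₂0 : 0 ≤ I₂ := integral_nonneg fun t => by positivity
  have hlim : Tendsto (fun R => δ * ∫ t in (0 : ℝ)..R, ‖w t‖ ^ 2) atTop
      (𝓝 (δ * ∫ t in Ioi (0 : ℝ), ‖w t‖ ^ 2)) :=
    (intervalIntegral_tendsto_integral_Ioi 0 hiw tendsto_id).const_mul δ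
  have hfin : δ * ∫ t in Ioi (0 : ℝ), ‖w t‖ ^ 2 ≤ D * I₂ + (‖b‖ + κ) * ‖w 0‖ ^ 2 := by
    refine le_of_forall_pos_le_add fun ε hε => ?_
    have hε' : 0 < ε / (‖b‖ + 1) := by positivity
    -- Smallness of `‖w R‖²` is available only for arbitrarily large `R`, not for all of them, which
    -- is enough since the left side converges.
    refine le_of_tendsto_of_frequently hlim ?_
    refine ((frequently_lt_of_integrableOn_Ioi hiw hε').and_eventually
      (eventually_ge_atTop 0)).mono fun R ⟨h1, h2⟩ => (hkey R h2).trans ?_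
    have h3 : ‖b‖ * ‖w R‖ ^ 2 ≤ ε := by
      calc ‖b‖ * ‖w R‖ ^ 2 ≤ (‖b‖ + 1) * (ε / (‖b‖ + 1)) := by gcongr; linarith
        _ = ε := by field_simp
    linarith
  rw [div_mul_eq_mul_div, le_div_iff₀ hδ]
  have hA : 0 ≤ D * ‖w 0‖ ^ 2 := by positivity
  have hB : 0 ≤ (‖b‖ + κ) * I₂ := by positivity
  linarith

end Estimate

/-! ### Weak derivatives on the line -/

section WeakDerivative

theorem exists_support_subset_Ioc {φ : ℝ → ℝ} (hc : HasCompactSupport φ) :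
    ∃ R, 0 < R ∧ tsupport φ ⊆ Ioo (-R) R := by
  obtain ⟨R, hR, h⟩ := hc.isCompact.isBounded.subset_ball_lt 0 0
  exact ⟨R, hR, by simpa [Real.ball_eq_Ioo] using h⟩

variable {E : Type*} [NormedAddCommGroup E] [NormedSpace ℝ E]

theorem integral_eq_intervalIntegral_of_tsupport {φ : ℝ → ℝ} {R : ℝ}
    (hR : tsupport φ ⊆ Ioo (-R) R) {g : ℝ → E} (hg : ∀ t, φ t = 0 → g t = 0 ∨ t ∈ tsupport φ) :
    ∫ t, g t = ∫ t in (-R)..R, g t := by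
  refine (intervalIntegral.integral_eq_integral_of_support_subset fun t ht => ?_).symm
  by_cases h : t ∈ tsupport φ
  · exact Ioo_subset_Ioc_self (hR h)
  · exact absurd ((hg t (image_eq_zero_of_notMem_tsupport h)).resolve_right h) ht

variable [CompleteSpace E]

/-- Integration by parts: `φ w` is absolutely continuous and vanishes at both ends of an interval
around the support. -/
theorem IsPrimitive.integral_deriv_smul {w v : ℝ → E} (hw : IsPrimitive w v) {φ : ℝ → ℝ}
    (hφ : ContDiff ℝ ∞ φ) (hc : HasCompactSupport φ) :
    ∫ t, deriv φ t • w t = -∫ t, φ t • v t := by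
  obtain ⟨R, hR0, hR⟩ := exists_support_subset_Ioc hc
  have hdc : Continuous (deriv φ) := hφ.continuous_deriv (by simp)
  have hd : ∀ t, HasDerivAt φ (deriv φ t) t := fun t =>
    (hφ.differentiable (by simp) t).hasDerivAt
  have h1 : LocallyIntegrable (fun t => deriv φ t • w t) volume :=
    (hdc.smul hw.continuous).locallyIntegrable
  have h2 : LocallyIntegrable (fun t => φ t • v t) volume := by
    have := hw.locallyIntegrable.locallyIntegrableOn univ |>.continuousOn_smul
      isOpen_univ.isLocallyClosed hφ.continuous.continuousOn
    exact locallyIntegrableOn_univ.1 this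
  have hac : AbsolutelyContinuousOnInterval (fun t => φ t • w t) (-R) R :=
    ((hφ.of_le (by simp)).contDiffOn.absolutelyContinuousOnInterval).fun_smul
      (hw.absolutelyContinuousOnInterval _ _)
  have hz : ∀ t, t ∉ Ioo (-R) R → φ t = 0 := fun t ht =>
    image_eq_zero_of_notMem_tsupport fun h => ht (hR h)
  have h3 := integral_eq_sub_of_absolutelyContinuousOnInterval hac
    (f' := fun t => φ t • v t + deriv φ t • w t)
    (by filter_upwards [hw.ae_hasDerivAt] with t ht using (hd t).smul ht) (h2.add h1)
  rw [hz R (by simp), hz (-R) (by simp), zero_smul, zero_smul, sub_zero,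
    intervalIntegral.integral_add (intervalIntegrable_of_locallyIntegrable h2 _ _)
      (intervalIntegrable_of_locallyIntegrable h1 _ _)] at h3
  rw [integral_eq_intervalIntegral_of_tsupport hR (g := fun t => deriv φ t • w t) fun t _ => ?_,
    integral_eq_intervalIntegral_of_tsupport hR (g := fun t => φ t • v t) fun t h => ?_]
  · exact eq_neg_of_add_eq_zero_right h3
  · exact Or.inl (by simp [h])
  · by_cases h : t ∈ tsupport φ
    · exact Or.inr h
    · exact Or.inl (by rw [image_eq_zero_of_notMem_tsupport fun h' => h (tsupport_deriv_subset h'),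
        zero_smul])

/-- The primitive starting left of the support is 0 there, and to the right of the support it equals
the total integral, again 0. -/
theorem exists_contDiff_antiderivative {g : ℝ → ℝ} (hg : ContDiff ℝ ∞ g)
    (hc : HasCompactSupport g) (h0 : ∫ t, g t = 0) :
    ∃ φ : ℝ → ℝ, ContDiff ℝ ∞ φ ∧ HasCompactSupport φ ∧ deriv φ = g := by
  obtain ⟨R, hR0, hR⟩ := exists_support_subset_Ioc hc
  have hd : ∀ t, HasDerivAt (fun t => ∫ r in (-R)..t, g r) (g t) t := fun t =>
    intervalIntegral.integral_hasDerivAt_right (hg.continuous.intervalIntegrable _ _)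
      hg.continuous.stronglyMeasurable.stronglyMeasurableAtFilter hg.continuous.continuousAt
  have hdv : deriv (fun t => ∫ r in (-R)..t, g r) = g := funext fun t => (hd t).deriv
  have hz : ∀ t, t ∉ Ioo (-R) R → g t = 0 := fun t ht =>
    image_eq_zero_of_notMem_tsupport fun h => ht (hR h)
  refine ⟨fun t => ∫ r in (-R)..t, g r, contDiff_infty_iff_deriv.2 ⟨fun t => (hd t).differentiableAt, by rwa [hdv]⟩,
    HasCompactSupport.intro (isCompact_Icc (a := -R) (b := R)) fun t ht => ?_, hdv⟩
  by_cases h : t < -R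
  · rw [intervalIntegral.integral_symm, neg_eq_zero]
    refine intervalIntegral.integral_zero_ae (Eventually.of_forall fun r hr => hz r ?_)
    rw [uIoc_of_le h.le] at hr
    exact fun h' => h'.1.not_ge hr.2
  · have hRt : R < t := by
      by_contra h'
      exact ht ⟨not_lt.1 h, not_lt.1 h'⟩
    have h1 : ∫ r in R..t, g r = 0 := by
      refine intervalIntegral.integral_zero_ae (Eventually.of_forall fun r hr => hz r ?_)
      rw [uIoc_of_le hRt.le] at hr
      exact fun h' => h'.2.not_gt hr.1
    rw [← intervalIntegral.integral_add_adjacent_intervals (b := R)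
      (hg.continuous.intervalIntegrable _ _) (hg.continuous.intervalIntegrable _ _), h1, add_zero,
      ← integral_eq_intervalIntegral_of_tsupport hR (fun t h => Or.inl h), h0]

/-- A locally integrable function with vanishing weak derivative is constant. -/
theorem exists_ae_eq_const {u : ℝ → E} (hu : LocallyIntegrable u volume)
    (h : ∀ φ : ℝ → ℝ, ContDiff ℝ ∞ φ → HasCompactSupport φ → ∫ t, deriv φ t • u t = 0) :
    ∃ c, ∀ᵐ t, u t = c := by
  obtain ⟨χ, hχs, hχd, hχ1⟩ : ∃ χ : ℝ → ℝ, HasCompactSupport χ ∧ ContDiff ℝ ∞ χ ∧ ∫ t, χ t = 1 := by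
    let f : ContDiffBump (0 : ℝ) := default
    exact ⟨f.normed volume, f.hasCompactSupport_normed, f.contDiff_normed, f.integral_normed⟩
  refine ⟨∫ t, χ t • u t, ?_⟩
  refine ae_eq_of_integral_contDiff_smul_eq hu (locallyIntegrable_const _) fun ψ hψ hψc => ?_
  -- Every test function is a multiple of `χ` plus the derivative of a test function. So `u` acts on
  -- `ψ` as `∫ ψ` times its value on `χ`, that is, like a constant.
  have hg : ContDiff ℝ ∞ (fun t => ψ t - (∫ r, ψ r) * χ t) := hψ.sub (contDiff_const.mul hχd)
  have hgc : HasCompactSupport (fun t => ψ t - (∫ r, ψ r) * χ t) := hψc.sub (hχs.mul_left)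
  have hiψ : Integrable ψ := hψ.continuous.integrable_of_hasCompactSupport hψc
  have hiχ : Integrable χ := hχd.continuous.integrable_of_hasCompactSupport hχs
  obtain ⟨φ, hφ, hφc, hφd⟩ := exists_contDiff_antiderivative hg hgc (by
    rw [integral_sub hiψ (hiχ.const_mul _), integral_const_mul, hχ1, mul_one, sub_self])
  have h1 := h φ hφ hφc
  rw [hφd] at h1
  have h2 : Integrable fun t => ψ t • u t :=
    hu.integrable_smul_left_of_hasCompactSupport hψ.continuous hψc
  have h3 : Integrable fun t => χ t • u t :=
    hu.integrable_smul_left_of_hasCompactSupport hχd.continuous hχs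
  simp only [sub_smul, mul_smul] at h1
  rw [integral_sub h2 (h3.smul (∫ r, ψ r) : Integrable fun t => (∫ r, ψ r) • χ t • u t), integral_smul, sub_eq_zero] at h1
  rw [h1, integral_smul_const]

end WeakDerivative

/-! ### The Sobolev space -/

section Sobolev

variable {n : ℕ}

theorem locallyIntegrable_L2 (u : L2 n) : LocallyIntegrable u volume :=
  (Lp.memLp u).locallyIntegrable (by norm_num)

/-- Subtracting the primitive of its weak derivative from an element leaves a function with weak
derivative 0. -/
theorem exists_ae_eq_of_mem (x : W12 n) :
    ∃ c, ∀ᵐ t, x.1.fst t = c + ∫ r in (0 : ℝ)..t, x.1.snd r := by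
  have hp : IsPrimitive (fun t => ∫ r in (0 : ℝ)..t, x.1.snd r) x.1.snd :=
    ⟨locallyIntegrable_L2 _, fun t => by simp⟩
  obtain ⟨c, hc⟩ := exists_ae_eq_const
    (u := fun t => x.1.fst t - ∫ r in (0 : ℝ)..t, x.1.snd r)
    ((locallyIntegrable_L2 _).sub hp.continuous.locallyIntegrable) fun φ hφ hφc => by
      have hd : Continuous (deriv φ) := hφ.continuous_deriv (by simp)
      simp only [smul_sub]
      rw [integral_sub (integrable_test_smul hd hφc.deriv _)
        (hp.continuous.locallyIntegrable.integrable_smul_left_of_hasCompactSupport hd hφc.deriv),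
        hp.integral_deriv_smul hφ hφc, x.2 φ hφ hφc, sub_self]
  exact ⟨c, hc.mono fun t ht => by rw [← ht]; abel⟩

/-- On an interval of length 1 the `L¹` norm is bounded by the `L²` norm. -/
theorem norm_integral_Ioc_le (u : L2 n) : ∫ t in (0 : ℝ)..1, ‖u t‖ ≤ ‖u‖ := by
  have : IsProbabilityMeasure (volume.restrict (Ioc (0 : ℝ) 1)) := ⟨by simp⟩
  have h1 : MemLp u 2 (volume.restrict (Ioc (0 : ℝ) 1)) := (Lp.memLp u).restrict _
  have h2 : eLpNorm u 1 (volume.restrict (Ioc (0 : ℝ) 1)) ≤ eLpNorm u 2 volume :=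
    (eLpNorm_le_eLpNorm_of_exponent_le (by norm_num) h1.1).trans
      (eLpNorm_restrict_le _ _ _ _)
  rw [intervalIntegral.integral_of_le zero_le_one, integral_norm_eq_lintegral_enorm h1.1, Lp.norm_def,
    ← eLpNorm_one_eq_lintegral_enorm]
  exact ENNReal.toReal_mono (Lp.eLpNorm_ne_top u) h2

theorem norm_fst_le (x : W12 n) : ‖x.1.fst‖ ≤ ‖x‖ := WithLp.norm_fst_le _ x.1

theorem norm_snd_le (x : W12 n) : ‖x.1.snd‖ ≤ ‖x‖ := WithLp.norm_snd_le _ x.1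

/-- The value at `0` of the continuous representative. -/
theorem exists_evalZero (n : ℕ) : ∃ ev : W12 n →L[ℝ] Rn n, ∀ x c,
    ev x = c ↔ ∀ᵐ t, x.1.fst t = c + ∫ r in (0 : ℝ)..t, x.1.snd r := by
  choose ev hev using exists_ae_eq_of_mem (n := n)
  have huniq : ∀ x c, (∀ᵐ t, x.1.fst t = c + ∫ r in (0 : ℝ)..t, x.1.snd r) → ev x = c := by
    intro x c hc
    obtain ⟨t, h1, h2⟩ := ((hev x).and hc).exists
    exact add_right_cancel (h1.symm.trans h2)
  have hii : ∀ (x : W12 n) a b, IntervalIntegrable x.1.snd volume a b := fun x =>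
    intervalIntegrable_of_locallyIntegrable (locallyIntegrable_L2 _)
  have hint : ∀ {u v : L2 n} (t : ℝ), u =ᵐ[volume] v →
      ∫ r in (0 : ℝ)..t, u r = ∫ r in (0 : ℝ)..t, v r := fun t h =>
    intervalIntegral.integral_congr_ae (h.mono fun r hr _ => hr)
  let L : W12 n →ₗ[ℝ] Rn n :=
    { toFun := ev
      map_add' := fun x y => by
        refine huniq _ _ ?_
        filter_upwards [hev x, hev y, Lp.coeFn_add x.1.fst y.1.fst] with t h1 h2 h3
        have h4 : ∫ r in (0 : ℝ)..t, (x + y).1.snd r =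
            (∫ r in (0 : ℝ)..t, x.1.snd r) + ∫ r in (0 : ℝ)..t, y.1.snd r := by
          rw [← intervalIntegral.integral_add (hii x _ _) (hii y _ _)]
          exact intervalIntegral.integral_congr_ae
            ((Lp.coeFn_add x.1.snd y.1.snd).mono fun r hr _ => hr)
        rw [h4]
        refine h3.trans ?_
        rw [Pi.add_apply, h1, h2]
        abel
      map_smul' := fun c x => by
        refine huniq _ _ ?_
        filter_upwards [hev x, Lp.coeFn_smul c x.1.fst] with t h1 h3
        have h4 : ∫ r in (0 : ℝ)..t, (c • x).1.snd r = c • ∫ r in (0 : ℝ)..t, x.1.snd r := by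
          rw [← intervalIntegral.integral_smul]
          exact intervalIntegral.integral_congr_ae
            ((Lp.coeFn_smul c x.1.snd).mono fun r hr _ => hr)
        rw [h4]
        refine h3.trans ?_
        rw [Pi.smul_apply, h1, smul_add]
        rfl }
  have hbound : ∀ x, ‖L x‖ ≤ 2 * ‖x‖ := by
    intro x
    -- The value at 0 differs from the value at `t` by at most `‖u'‖`; averaging over `(0, 1]`
    -- bounds it by `‖u‖ + ‖u'‖`.
    have h1 : ∀ᵐ t, t ∈ Ioc (0 : ℝ) 1 → ‖ev x‖ ≤ ‖x.1.fst t‖ + ‖x.1.snd‖ := by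
      filter_upwards [hev x] with t ht hmem
      have h2 : ev x = x.1.fst t - ∫ r in (0 : ℝ)..t, x.1.snd r := by rw [ht]; abel
      have h3 : ‖∫ r in (0 : ℝ)..t, x.1.snd r‖ ≤ ‖x.1.snd‖ :=
        calc ‖∫ r in (0 : ℝ)..t, x.1.snd r‖ ≤ ∫ r in (0 : ℝ)..t, ‖x.1.snd r‖ :=
              intervalIntegral.norm_integral_le_integral_norm hmem.1.le
          _ ≤ ∫ r in (0 : ℝ)..1, ‖x.1.snd r‖ :=
              intervalIntegral.integral_mono_interval le_rfl hmem.1.le hmem.2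
                (Eventually.of_forall fun r => norm_nonneg _) (hii x 0 1).norm
          _ ≤ _ := norm_integral_Ioc_le _
      rw [h2]
      exact (norm_sub_le _ _).trans (by gcongr)
    have hif : IntervalIntegrable (fun t => ‖x.1.fst t‖) volume 0 1 :=
      (intervalIntegrable_of_locallyIntegrable (locallyIntegrable_L2 _) _ _).norm
    have h2 : ∫ t in (0 : ℝ)..1, ‖ev x‖ ≤ ∫ t in (0 : ℝ)..1, (‖x.1.fst t‖ + ‖x.1.snd‖) := by
      rw [intervalIntegral.integral_of_le zero_le_one, intervalIntegral.integral_of_le zero_le_one]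
      refine setIntegral_mono_on_ae ?_ ?_ measurableSet_Ioc h1
      · exact integrableOn_const (by simp)
      · exact (intervalIntegrable_iff_integrableOn_Ioc_of_le zero_le_one).1
          (hif.add intervalIntegrable_const)
    rw [intervalIntegral.integral_add hif intervalIntegrable_const] at h2
    simp only [intervalIntegral.integral_const, sub_zero, one_smul] at h2
    have h3 := norm_integral_Ioc_le x.1.fst
    have h4 := norm_fst_le x
    have h5 := norm_snd_le x
    change ‖ev x‖ ≤ _
    linarith
  exact ⟨L.mkContinuous 2 hbound, fun x c => ⟨fun h => h ▸ hev x, huniq x c⟩⟩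

/-- The value at `0` of the continuous representative. -/
noncomputable def evalZero (n : ℕ) : W12 n →L[ℝ] Rn n := (exists_evalZero n).choose

theorem evalZero_eq_iff (x : W12 n) (c : Rn n) :
    evalZero n x = c ↔ ∀ᵐ t, x.1.fst t = c + ∫ r in (0 : ℝ)..t, x.1.snd r :=
  (exists_evalZero n).choose_spec x c

/-- The continuous representative. -/
noncomputable def rep (x : W12 n) (t : ℝ) : Rn n := evalZero n x + ∫ r in (0 : ℝ)..t, x.1.snd r

theorem rep_zero (x : W12 n) : rep x 0 = evalZero n x := by simp [rep]

theorem isPrimitive_rep (x : W12 n) : IsPrimitive (rep x) x.1.snd :=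
  ⟨locallyIntegrable_L2 _, fun t => by rw [rep_zero, rep]⟩

theorem rep_ae_eq (x : W12 n) : x.1.fst =ᵐ[volume] rep x := (evalZero_eq_iff x _).1 rfl

/-- Each test function imposes a condition that is continuous in the pair `(u, u')` for the `L²`
norms, so `W12 n` is closed in a complete space. -/
instance : CompleteSpace (W12 n) := by
  have hcont : ∀ {φ : ℝ → ℝ} (hφ : Continuous φ) (hc : HasCompactSupport φ),
      Continuous fun u : L2 n => ∫ t, φ t • u t := by
    intro φ hφ hc
    have hm : MemLp φ 2 (volume : Measure ℝ) := hφ.memLp_of_hasCompactSupport hc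
    have h1 := ((ContinuousLinearMap.lsmul ℝ ℝ (E := Rn n)).lpPairing volume 2 2 hm.toLp).continuous
    refine h1.congr fun u => ?_
    rw [ContinuousLinearMap.lpPairing_eq_integral]
    refine integral_congr_ae ?_
    filter_upwards [hm.coeFn_toLp] with t ht
    simp [ht]
  suffices h : IsClosed ((W12 n : Submodule ℝ _) : Set (WithLp 2 (L2 n × L2 n))) from
    h.completeSpace_coe
  have : ((W12 n : Submodule ℝ _) : Set (WithLp 2 (L2 n × L2 n))) =
      ⋂ (φ : ℝ → ℝ) (_ : ContDiff ℝ ∞ φ) (_ : HasCompactSupport φ),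
        {x | ∫ t, deriv φ t • x.fst t = -∫ t, φ t • x.snd t} := by
    ext x
    simp only [mem_iInter]
    rfl
  rw [this]
  refine isClosed_iInter fun φ => isClosed_iInter fun hφ => isClosed_iInter fun hc => ?_
  refine isClosed_eq ?_ ?_
  · exact (hcont (hφ.continuous_deriv (by simp)) hc.deriv).comp
      (WithLp.fstL 2 ℝ (L2 n) (L2 n)).continuous
  · exact ((hcont hφ.continuous hc).comp (WithLp.sndL 2 ℝ (L2 n) (L2 n)).continuous).neg

end Sobolev

/-! ### The operator on `W^{1,2}`, the jump functions, and the global estimate -/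

section Operators

variable {n : ℕ}

theorem norm_sq_L2 (u : L2 n) : ‖u‖ ^ 2 = ∫ t, ‖u t‖ ^ 2 := by
  rw [← real_inner_self_eq_norm_sq, L2.inner_def]
  exact integral_congr_ae (Eventually.of_forall fun t => real_inner_self_eq_norm_sq _)

theorem integrable_norm_sq {w : ℝ → Rn n} (hw : MemLp w 2 volume) :
    Integrable fun t => ‖w t‖ ^ 2 :=
  (memLp_two_iff_integrable_sq_norm hw.1).1 hw

theorem coeFn_mulOp {B : ℝ → Rn n →L[ℝ] Rn n} (hB : MemLp B ∞ (volume : Measure ℝ)) (u : L2 n) :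
    mulOp hB u =ᵐ[volume] fun t => B t (u t) := by
  refine ((ContinuousLinearMap.id ℝ (Rn n →L[ℝ] Rn n)).coeFn_holder hB.toLp u).trans ?_
  filter_upwards [hB.coeFn_toLp] with t ht
  rw [ht, ContinuousLinearMap.id_apply]

theorem norm_toLp_top_le {F : Type*} [NormedAddCommGroup F] {B : ℝ → F}
    (hB : MemLp B ∞ (volume : Measure ℝ)) {C : ℝ} (hC : ∀ t, ‖B t‖ ≤ C) : ‖hB.toLp‖ ≤ C := by
  have hC0 : 0 ≤ C := (norm_nonneg _).trans (hC 0)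
  rw [Lp.norm_toLp]
  refine ENNReal.toReal_le_of_le_ofReal hC0 ?_
  rw [eLpNorm_exponent_top]
  refine eLpNormEssSup_le_of_ae_enorm_bound (Eventually.of_forall fun t => ?_)
  rw [← ofReal_norm]
  exact ENNReal.ofReal_le_ofReal (hC t)

theorem norm_mulOp_le {B : ℝ → Rn n →L[ℝ] Rn n} (hB : MemLp B ∞ (volume : Measure ℝ)) {C : ℝ}
    (hC : ∀ t, ‖B t‖ ≤ C) : ‖mulOp hB‖ ≤ C := by
  refine (ContinuousLinearMap.le_opNorm _ _).trans ?_
  calc _ ≤ 1 * C := by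
        refine mul_le_mul ((ContinuousLinearMap.norm_holderL_le _).trans
          ContinuousLinearMap.norm_id_le) (norm_toLp_top_le hB hC) (norm_nonneg _)
          zero_le_one
    _ = C := one_mul C

theorem norm_mulOp_sub_le {B B' : ℝ → Rn n →L[ℝ] Rn n} (hB : MemLp B ∞ (volume : Measure ℝ))
    (hB' : MemLp B' ∞ (volume : Measure ℝ)) {C : ℝ} (hC : ∀ t, ‖B t - B' t‖ ≤ C) :
    ‖mulOp hB - mulOp hB'‖ ≤ C := by
  have h : mulOp hB - mulOp hB' = mulOp (hB.sub hB') := by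
    rw [mulOp, mulOp, mulOp, ← map_sub, MemLp.toLp_sub]
  rw [h]
  exact norm_mulOp_le _ hC

theorem coeFn_diffOp {S : ℝ → Matrix (Fin n) (Fin n) ℝ}
    (hS : MemLp (fun t => act (S t)) ∞ (volume : Measure ℝ)) (x : W12 n) :
    diffOp S hS x =ᵐ[volume] fun t => x.1.snd t - act (S t) (rep x t) := by
  refine (Lp.coeFn_sub x.1.snd (mulOp hS x.1.fst)).trans ?_
  filter_upwards [coeFn_mulOp hS x.1.fst, rep_ae_eq x] with t h1 h2
  rw [Pi.sub_apply, h1, h2]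

/-- The function `e^{-t}` on the positive half-line, extended by `0`. -/
noncomputable def expTail (t : ℝ) : ℝ := (Ioi (0 : ℝ)).indicator (fun t => Real.exp (-t)) t

theorem expTail_of_pos {t : ℝ} (ht : 0 < t) : expTail t = Real.exp (-t) :=
  indicator_of_mem (mem_Ioi.2 ht) _

theorem expTail_of_nonpos {t : ℝ} (ht : t ≤ 0) : expTail t = 0 :=
  indicator_of_notMem (by simpa using ht) _

theorem memLp_expTail : MemLp expTail 2 (volume : Measure ℝ) := by
  have hm : AEStronglyMeasurable (fun t : ℝ => Real.exp (-t)) (volume.restrict (Ioi 0)) :=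
    (by fun_prop : Continuous fun t : ℝ => Real.exp (-t)).aestronglyMeasurable
  refine (memLp_indicator_iff_restrict measurableSet_Ioi).2 ((memLp_two_iff_integrable_sq hm).2 ?_)
  refine (exp_neg_integrableOn_Ioi 0 two_pos).congr (Eventually.of_forall fun t => ?_)
  simp only [← Real.exp_nat_mul]
  congr 1
  push_cast
  ring

theorem memLp_expTail_smul (c : Rn n) : MemLp (fun t => expTail t • c) 2 (volume : Measure ℝ) :=
  (ContinuousLinearMap.toSpanSingleton ℝ c).comp_memLp' memLp_expTail

/-- The functions `c ↦ e^{-t} c` on the positive half-line, which jump by `c` at `0`. -/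
noncomputable def jump (n : ℕ) : Rn n →L[ℝ] L2 n :=
  LinearMap.toContinuousLinearMap
    { toFun := fun c => (memLp_expTail_smul c).toLp
      map_add' := fun c d => by
        rw [← MemLp.toLp_add]
        exact MemLp.toLp_congr _ _ (Eventually.of_forall fun t => smul_add _ _ _)
      map_smul' := fun r c => by
        rw [RingHom.id_apply, ← MemLp.toLp_const_smul]
        exact MemLp.toLp_congr _ _ (Eventually.of_forall fun t => smul_comm _ _ _) }

theorem coeFn_jump (c : Rn n) : jump n c =ᵐ[volume] fun t => expTail t • c :=
  (memLp_expTail_smul c).coeFn_toLp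

/-- The regular part of `d/dt - S` on the functions `e^{-t} c`, `t > 0`. -/
noncomputable def jumpOp {S : ℝ → Matrix (Fin n) (Fin n) ℝ}
    (hS : MemLp (fun t => act (S t)) ∞ (volume : Measure ℝ)) : Rn n →L[ℝ] L2 n :=
  -(jump n + mulOp hS ∘L jump n)

theorem coeFn_jumpOp {S : ℝ → Matrix (Fin n) (Fin n) ℝ}
    (hS : MemLp (fun t => act (S t)) ∞ (volume : Measure ℝ)) (c : Rn n) :
    jumpOp hS c =ᵐ[volume] fun t => -(expTail t • c + act (S t) (expTail t • c)) := by
  refine (Lp.coeFn_neg (jump n c + mulOp hS (jump n c))).trans ?_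
  filter_upwards [Lp.coeFn_add (jump n c) (mulOp hS (jump n c)), coeFn_mulOp hS (jump n c),
    coeFn_jump c] with t h1 h2 h3
  rw [Pi.neg_apply, h1, Pi.add_apply, h2, h3]

theorem coeFn_coprod {S : ℝ → Matrix (Fin n) (Fin n) ℝ}
    (hS : MemLp (fun t => act (S t)) ∞ (volume : Measure ℝ)) (x : W12 n) (c : Rn n) :
    (diffOp S hS x + jumpOp hS c : L2 n) =ᵐ[volume] fun t =>
      x.1.snd t - (act (S t) (rep x t + expTail t • c) + expTail t • c) := by
  filter_upwards [Lp.coeFn_add (diffOp S hS x) (jumpOp hS c), coeFn_diffOp hS x,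
    coeFn_jumpOp hS c] with t h1 h2 h3
  rw [h1, Pi.add_apply, h2, h3, map_add]
  abel

/-- An `L²` function with a derivative in `L²` is an element of `W^{1,2}`. -/
theorem IsPrimitive.exists_mem_W12 {w v : ℝ → Rn n} (h : IsPrimitive w v)
    (hw : MemLp w 2 volume) (hv : MemLp v 2 volume) :
    ∃ x : W12 n, x.1.snd =ᵐ[volume] v ∧ rep x = w := by
  have hx : WithLp.toLp 2 ((hw.toLp, hv.toLp) : L2 n × L2 n) ∈ W12 n := by
    intro φ hφ hc
    change ∫ t, deriv φ t • (hw.toLp : L2 n) t = -∫ t, φ t • (hv.toLp : L2 n) t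
    have e1 : ∫ t, deriv φ t • (hw.toLp : L2 n) t = ∫ t, deriv φ t • w t :=
      integral_congr_ae (hw.coeFn_toLp.mono fun t ht => congrArg (deriv φ t • ·) ht)
    have e2 : ∫ t, φ t • (hv.toLp : L2 n) t = ∫ t, φ t • v t :=
      integral_congr_ae (hv.coeFn_toLp.mono fun t ht => congrArg (φ t • ·) ht)
    rw [e1, e2]
    exact h.integral_deriv_smul hφ hc
  have hint : ∀ t, ∫ r in (0 : ℝ)..t, (hv.toLp : L2 n) r = ∫ r in (0 : ℝ)..t, v r := fun t =>
    intervalIntegral.integral_congr_ae (hv.coeFn_toLp.mono fun r hr _ => hr)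
  refine ⟨⟨_, hx⟩, hv.coeFn_toLp, funext fun t => ?_⟩
  have hev : evalZero n ⟨_, hx⟩ = w 0 := by
    rw [evalZero_eq_iff]
    filter_upwards [hw.coeFn_toLp] with t ht
    change (hw.toLp : L2 n) t = w 0 + ∫ r in (0 : ℝ)..t, (hv.toLp : L2 n) r
    rw [ht, hint, h.eq_add t]
  rw [rep, hev, h.eq_add t]
  exact congrArg _ (hint t)

theorem memLp_rep (x : W12 n) : MemLp (rep x) 2 volume :=
  (memLp_congr_ae (rep_ae_eq x)).1 (Lp.memLp _)

/-- Elements of `W^{1,2}` are controlled by `u' - S u` and `u(0)`. -/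
theorem exists_norm_le {S : ℝ → Matrix (Fin n) (Fin n) ℝ}
    (hS : MemLp (fun t => act (S t)) ∞ (volume : Measure ℝ)) {K : ℝ} (hK : ∀ t, ‖act (S t)‖ ≤ K)
    {b b' : Rn n →L[ℝ] Rn n →L[ℝ] ℝ} {δ δ' T T' : ℝ}
    (hp : IsLyapunov (fun t => act (S t)) b δ T)
    (hm : IsLyapunov (fun t => -act (S (-t))) b' δ' T') :
    ∃ C, 0 ≤ C ∧ ∀ x : W12 n, ‖x‖ ≤ C * (‖diffOp S hS x‖ + ‖evalZero n x‖) := by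
  have hK0 : 0 ≤ K := (norm_nonneg _).trans (hK 0)
  obtain ⟨C₁, hC₁0, hC₁⟩ := hp.exists_integral_le hK
  obtain ⟨C₂, hC₂0, hC₂⟩ := hm.exists_integral_le (K := K) fun t => by rw [norm_neg]; exact hK _
  -- Adding the half-line estimates bounds `‖u‖` by `D (‖y‖ + ‖u(0)‖)`; the equation gives `‖u'‖ ≤
  -- ‖y‖ + K ‖u‖`, whence the constant `D + (1 + K D)`.
  set D := Real.sqrt (C₁ + C₂) with hD
  have hD0 : 0 ≤ D := Real.sqrt_nonneg _
  refine ⟨D + (1 + K * D), by positivity, fun x => ?_⟩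
  set y := diffOp S hS x with hy
  have hiw : Integrable fun t => ‖rep x t‖ ^ 2 := integrable_norm_sq (memLp_rep x)
  have hye : (fun t => x.1.snd t - act (S t) (rep x t)) =ᵐ[volume] y := (coeFn_diffOp hS x).symm
  have hiy : Integrable fun t => ‖x.1.snd t - act (S t) (rep x t)‖ ^ 2 :=
    integrable_norm_sq ((memLp_congr_ae hye).2 (Lp.memLp y))
  have hyn : ∫ t, ‖x.1.snd t - act (S t) (rep x t)‖ ^ 2 = ‖y‖ ^ 2 := by
    rw [norm_sq_L2]
    exact integral_congr_ae (hye.mono fun t ht => by simp only [ht])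
  have hwn : ∫ t, ‖rep x t‖ ^ 2 = ‖x.1.fst‖ ^ 2 := by
    rw [norm_sq_L2]
    exact integral_congr_ae ((rep_ae_eq x).mono fun t ht => by simp only [ht])
  have h1 := hC₁ (rep x) x.1.snd (isPrimitive_rep x) hiw.integrableOn hiy.integrableOn
  have h2 := hC₂ _ _ (isPrimitive_rep x).comp_neg hiw.comp_neg.integrableOn (by
    refine (hiy.comp_neg.congr (Eventually.of_forall fun t => ?_)).integrableOn
    simp only [neg_apply]
    rw [← norm_neg]
    congr 2
    abel)
  have e1 : ∫ t in Ioi (0 : ℝ), ‖-x.1.snd (-t) - (-act (S (-t))) (rep x (-t))‖ ^ 2 =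
      ∫ t in Iic (0 : ℝ), ‖x.1.snd t - act (S t) (rep x t)‖ ^ 2 := by
    have := integral_comp_neg_Ioi (c := (0 : ℝ)) (f := fun t => ‖x.1.snd t - act (S t) (rep x t)‖ ^ 2)
    rw [neg_zero] at this
    rw [← this]
    refine integral_congr_ae (Eventually.of_forall fun t => ?_)
    simp only [neg_apply]
    rw [← norm_neg]
    congr 2
    abel
  have e2 : ∫ t in Ioi (0 : ℝ), ‖rep x (-t)‖ ^ 2 = ∫ t in Iic (0 : ℝ), ‖rep x t‖ ^ 2 := by
    have := integral_comp_neg_Ioi (c := (0 : ℝ)) (f := fun t => ‖rep x t‖ ^ 2)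
    rwa [neg_zero] at this
  have h3 := intervalIntegral.integral_Iic_add_Ioi (b := (0 : ℝ)) hiw.integrableOn hiw.integrableOn
  have h4 : ∫ t in Ioi (0 : ℝ), ‖x.1.snd t - act (S t) (rep x t)‖ ^ 2 ≤ ‖y‖ ^ 2 :=
    hyn ▸ setIntegral_le_integral hiy (Eventually.of_forall fun t => by positivity)
  have h5 : ∫ t in Iic (0 : ℝ), ‖x.1.snd t - act (S t) (rep x t)‖ ^ 2 ≤ ‖y‖ ^ 2 :=
    hyn ▸ setIntegral_le_integral hiy (Eventually.of_forall fun t => by positivity)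
  rw [e1, e2, neg_zero, rep_zero] at h2
  rw [rep_zero] at h1
  have h6 : ‖x.1.fst‖ ^ 2 ≤ (C₁ + C₂) * (‖evalZero n x‖ ^ 2 + ‖y‖ ^ 2) := by
    rw [← hwn, ← h3, add_mul]
    have h7 := mul_le_mul_of_nonneg_left h4 hC₁0
    have h8 := mul_le_mul_of_nonneg_left h5 hC₂0
    linarith
  have h7 : ‖x.1.fst‖ ≤ D * (‖y‖ + ‖evalZero n x‖) := by
    refine le_of_sq_le_sq ?_ (by positivity)
    rw [mul_pow, hD, Real.sq_sqrt (by positivity)]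
    refine h6.trans (mul_le_mul_of_nonneg_left ?_ (by positivity))
    have : 0 ≤ ‖y‖ * ‖evalZero n x‖ := by positivity
    linarith
  have h8 : ‖x.1.snd‖ ≤ ‖y‖ + K * ‖x.1.fst‖ := by
    have h9 : x.1.snd = y + mulOp hS x.1.fst := by
      rw [hy]
      exact (sub_add_cancel x.1.snd (mulOp hS x.1.fst)).symm
    rw [h9]
    exact (norm_add_le _ _).trans
      (add_le_add le_rfl (ContinuousLinearMap.le_of_opNorm_le _ (norm_mulOp_le hS hK) _))
  have h10 : ‖x‖ ≤ ‖x.1.fst‖ + ‖x.1.snd‖ := by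
    refine le_of_sq_le_sq ?_ (by positivity)
    have h11 : ‖x‖ ^ 2 = ‖x.1.fst‖ ^ 2 + ‖x.1.snd‖ ^ 2 := WithLp.prod_norm_sq_eq_of_L2 x.1
    have : 0 ≤ ‖x.1.fst‖ * ‖x.1.snd‖ := by positivity
    linarith
  have h12 := mul_le_mul_of_nonneg_left h7 hK0
  have h13 := norm_nonneg (evalZero n x)
  linarith

end Operators

/-! ### Solutions of the forced equation that vanish near one end -/

section ForcedEquation

variable {E : Type*} [NormedAddCommGroup E] [NormedSpace ℝ E]

theorem hasDerivAt_comp_neg {u : ℝ → E} {v : E} {t : ℝ} (h : HasDerivAt u v (-t)) :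
    HasDerivAt (fun t => u (-t)) (-v) t := by
  simpa [Function.comp_def] using h.scomp t (hasDerivAt_neg t)

theorem linear_solution_unique_right {a : ℝ → E →L[ℝ] E} {K : ℝ} (hK : ∀ t, ‖a t‖ ≤ K)
    {u v : ℝ → E} {t₀ : ℝ} (hu : ∀ t, t₀ ≤ t → HasDerivAt u (a t (u t)) t)
    (hv : ∀ t, t₀ ≤ t → HasDerivAt v (a t (v t)) t) (h : u t₀ = v t₀) {t : ℝ} (ht : t₀ ≤ t) :
    u t = v t := by
  have hK0 : 0 ≤ K := (norm_nonneg _).trans (hK 0)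
  refine ODE_solution_unique_of_mem_Icc_right (v := fun t x => a t x) (s := fun _ => univ)
    (K := ⟨K, hK0⟩) (a := t₀) (b := t) (fun r _ => ?_)
    (fun r hr => (hu r hr.1).continuousAt.continuousWithinAt)
    (fun r hr => (hu r hr.1).hasDerivWithinAt) (fun _ _ => mem_univ _)
    (fun r hr => (hv r hr.1).continuousAt.continuousWithinAt)
    (fun r hr => (hv r hr.1).hasDerivWithinAt) (fun _ _ => mem_univ _) h ⟨ht, le_rfl⟩
  exact LipschitzWith.lipschitzOnWith ((a r).lipschitz.weaken (hK r))

/-- If the forcing has compact support, there is a solution that vanishes near `+∞`. -/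
theorem exists_forced_solution [CompleteSpace E] {a : ℝ → E →L[ℝ] E} (ha : Continuous a) {K : ℝ}
    (hK : ∀ t, ‖a t‖ ≤ K) {f : ℝ → E} (hf : Continuous f) (hc : HasCompactSupport f) :
    ∃ (u : ℝ → E) (R : ℝ), (∀ t, HasDerivAt u (a t (u t) + f t) t) ∧ ∀ t, R ≤ t → u t = 0 := by
  obtain ⟨R, hR⟩ : ∃ R, ∀ t, R ≤ t → f t = 0 := by
    obtain ⟨R, hR⟩ := hc.isCompact.isBounded.subset_ball 0
    refine ⟨R, fun t ht => image_eq_zero_of_notMem_tsupport fun h => ?_⟩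
    have h1 : |t| < R := by simpa using hR h
    exact (ht.trans (le_abs_self t)).not_gt h1
  obtain ⟨M, hM⟩ := hf.bounded_above_of_compact_support hc
  -- The forced equation becomes linear with one more coordinate, constantly 1, that multiplies `f`.
  -- Time is shifted by `R`, so the initial value `u = 0` is imposed where the forcing has ended.
  let A : ℝ → (E × ℝ) →L[ℝ] (E × ℝ) := fun s =>
    ContinuousLinearMap.inl ℝ E ℝ ∘L (a (s + R) ∘L ContinuousLinearMap.fst ℝ E ℝ +
      (ContinuousLinearMap.snd ℝ E ℝ).smulRight (f (s + R)))
  have hAc : Continuous A := by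
    refine continuous_const.clm_comp (((ha.comp (by fun_prop)).clm_comp continuous_const).add ?_)
    exact (ContinuousLinearMap.smulRightL ℝ (E × ℝ) E
      (ContinuousLinearMap.snd ℝ E ℝ)).continuous.comp (hf.comp (by fun_prop))
  have hAK : ∀ s, ‖A s‖ ≤ ‖ContinuousLinearMap.inl ℝ E ℝ‖ *
      (K * ‖ContinuousLinearMap.fst ℝ E ℝ‖ + ‖ContinuousLinearMap.snd ℝ E ℝ‖ * M) := by
    intro s
    refine (ContinuousLinearMap.opNorm_comp_le _ _).trans (mul_le_mul_of_nonneg_left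
      ((norm_add_le _ _).trans (add_le_add ((ContinuousLinearMap.opNorm_comp_le _ _).trans ?_) ?_))
      (norm_nonneg _))
    · exact mul_le_mul_of_nonneg_right (hK _) (norm_nonneg _)
    · rw [ContinuousLinearMap.norm_smulRight_apply]
      exact mul_le_mul_of_nonneg_left (hM _) (norm_nonneg _)
  obtain ⟨U, hU0, hU⟩ := exists_linear_solution hAc hAK ((0 : E), (1 : ℝ))
  have h1 : ∀ s, HasDerivAt (fun s => (U s).1) (a (s + R) (U s).1 + (U s).2 • f (s + R)) s :=
    fun s => (ContinuousLinearMap.fst ℝ E ℝ).hasFDerivAt.comp_hasDerivAt s (hU s)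
  have h2 : ∀ s, HasDerivAt (fun s => (U s).2) 0 s :=
    fun s => (ContinuousLinearMap.snd ℝ E ℝ).hasFDerivAt.comp_hasDerivAt s (hU s)
  have h3 : ∀ s, (U s).2 = 1 := fun s => by
    have := is_const_of_deriv_eq_zero (fun s => (h2 s).differentiableAt)
      (fun s => (h2 s).deriv) s 0
    rw [this, hU0]
  have hu : ∀ t, HasDerivAt (fun t => (U (t - R)).1) (a t (U (t - R)).1 + f t) t := fun t => by
    have h4 := (h1 (t - R)).comp_sub_const t R
    rwa [sub_add_cancel, h3, one_smul] at h4
  refine ⟨fun t => (U (t - R)).1, R, hu, fun t ht => ?_⟩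
  refine linear_solution_unique_right hK (t₀ := R) (u := fun t => (U (t - R)).1) (v := fun _ => 0)
    (fun t ht => ?_)
    (fun t _ => by simpa using hasDerivAt_const t (0 : E)) (by simp [hU0]) ht
  have h5 := hu t
  rwa [hR t ht, add_zero] at h5

end ForcedEquation

/-! ### Surjectivity of the extended operator -/

section Surjective

variable {n : ℕ} {S : ℝ → Matrix (Fin n) (Fin n) ℝ}

theorem memLp_act {hS : MemLp (fun t => act (S t)) ∞ (volume : Measure ℝ)} {z : ℝ → Rn n}
    (hz : MemLp z 2 volume) : MemLp (fun t => act (S t) (z t)) 2 volume :=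
  (ContinuousLinearMap.id ℝ (Rn n →L[ℝ] Rn n)).memLp_of_bilin 2 hS hz

/-- Two solutions on the half-lines are glued to an element of the extended domain. -/
theorem exists_coprod_eq (hS : MemLp (fun t => act (S t)) ∞ (volume : Measure ℝ))
    {f u₁ u₂ : ℝ → Rn n} (hf : MemLp f 2 volume)
    (hu₁ : ∀ t, HasDerivAt u₁ (act (S t) (u₁ t) + f t) t)
    (hu₂ : ∀ t, HasDerivAt u₂ (act (S t) (u₂ t) + f t) t)
    (hi₁ : IntegrableOn (fun t => ‖u₁ t‖ ^ 2) (Ioi 0))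
    (hi₂ : IntegrableOn (fun t => ‖u₂ t‖ ^ 2) (Iic 0)) :
    ∃ x, diffOp S hS x + jumpOp hS (u₁ 0 - u₂ 0) = hf.toLp ∧ evalZero n x = u₂ 0 := by
  have hc₁ : Continuous u₁ := continuous_iff_continuousAt.2 fun t => (hu₁ t).continuousAt
  have hc₂ : Continuous u₂ := continuous_iff_continuousAt.2 fun t => (hu₂ t).continuousAt
  set c := u₁ 0 - u₂ 0 with hc
  classical
  -- Subtracting `e^{-t} c` on the right removes the jump `c = u₁(0) - u₂(0)`, so that `w` is
  -- continuous at 0.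
  set w : ℝ → Rn n := fun t => if t ≤ 0 then u₂ t else u₁ t - Real.exp (-t) • c with hw
  have hwc : Continuous w := by
    refine Continuous.if_le hc₂ (by fun_prop) continuous_id continuous_const fun t ht => ?_
    simp [ht, hc]
  have hwL : MemLp w 2 volume := by
    have h1 : MemLp u₂ 2 (volume.restrict (Iic 0)) :=
      (memLp_two_iff_integrable_sq_norm hc₂.aestronglyMeasurable).2 hi₂
    have h2 : MemLp u₁ 2 (volume.restrict (Iic (0 : ℝ))ᶜ) := by
      rw [compl_Iic]
      exact (memLp_two_iff_integrable_sq_norm hc₁.aestronglyMeasurable).2 hi₁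
    have h3 := MemLp.piecewise measurableSet_Iic h1 (h2.sub ((memLp_expTail_smul c).restrict _))
    refine (memLp_congr_ae (Eventually.of_forall fun t => ?_)).1 h3
    by_cases ht : t ≤ 0
    · simp [hw, ht, piecewise]
    · simp [hw, ht, piecewise, expTail_of_pos (not_le.1 ht)]
  set v : ℝ → Rn n := fun t => act (S t) (w t + expTail t • c) + expTail t • c + f t with hv
  have hvL : MemLp v 2 volume :=
    ((memLp_act (hS := hS) (hwL.add (memLp_expTail_smul c))).add (memLp_expTail_smul c)).add hf
  have hd : ∀ t, t ≠ 0 → HasDerivAt w (v t) t := by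
    intro t ht
    rcases lt_or_gt_of_ne ht with ht | ht
    · have h1 : w =ᶠ[𝓝 t] u₂ := by
        filter_upwards [Iio_mem_nhds ht] with r hr
        simp [hw, (mem_Iio.1 hr).le]
      have h2 : v t = act (S t) (u₂ t) + f t := by
        simp [hv, hw, ht.le, expTail_of_nonpos ht.le]
      rw [h2]
      exact (hu₂ t).congr_of_eventuallyEq h1
    · have h1 : w =ᶠ[𝓝 t] fun t => u₁ t - Real.exp (-t) • c := by
        filter_upwards [Ioi_mem_nhds ht] with r hr
        simp [hw, not_le.2 (mem_Ioi.1 hr)]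
      have h2 : v t = act (S t) (u₁ t) + f t - (Real.exp (-t) * -1) • c := by
        simp only [hv, hw, not_le.2 ht, if_false, expTail_of_pos ht, sub_add_cancel, mul_neg, mul_one,
          neg_smul, sub_neg_eq_add]
        abel
      rw [h2]
      exact ((hu₁ t).sub (((hasDerivAt_neg t).exp).smul_const c)).congr_of_eventuallyEq h1
  have hvl : LocallyIntegrable v volume := hvL.locallyIntegrable (by norm_num)
  -- `w` is continuous and differentiable except at 0, and one exceptional point does not affect the
  -- fundamental theorem of calculus.
  have hprim : IsPrimitive w v := ⟨hvl, fun t => by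
    rw [integral_eq_of_hasDerivAt_off_countable w v (countable_singleton (0 : ℝ)) hwc.continuousOn
      (fun r hr => hd r hr.2) (intervalIntegrable_of_locallyIntegrable hvl _ _)]
    abel⟩
  obtain ⟨x, hx1, hx2⟩ := hprim.exists_mem_W12 hwL hvL
  refine ⟨x, Lp.ext ?_, ?_⟩
  · filter_upwards [coeFn_coprod hS x c, hx1, hf.coeFn_toLp] with t h1 h2 h3
    rw [h1, h2, h3, hx2]
    exact add_sub_cancel_left _ _
  · rw [← rep_zero, hx2]
    simp [hw]

/-- On the functions vanishing at 0, a subspace of finite codimension, the estimate is a lower bound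
for the operator, so the image is closed; finitely many further dimensions keep it closed. -/
theorem isClosed_range_diffOp (hS : MemLp (fun t => act (S t)) ∞ (volume : Measure ℝ)) {C : ℝ}
    (hC0 : 0 ≤ C) (hC : ∀ x : W12 n, ‖x‖ ≤ C * (‖diffOp S hS x‖ + ‖evalZero n x‖)) :
    IsClosed ((diffOp S hS).range : Set (L2 n)) := by
  have := Submodule.CoFG.ker (evalZero n : W12 n →ₗ[ℝ] Rn n)
  refine LinearMap.isClosed_range_of_isClosed_map_of_finiteDimensional_quotient
    (s := (evalZero n).ker) ?_
  · have h1 : AntilipschitzWith ⟨C, hC0⟩ (diffOp S hS ∘L (evalZero n).ker.subtypeL) := by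
      refine AddMonoidHomClass.antilipschitz_of_bound _ fun x => ?_
      have h2 := hC x
      rw [show evalZero n (x : W12 n) = 0 from x.2, norm_zero, add_zero] at h2
      exact h2
    have h2 := h1.isClosed_range (diffOp S hS ∘L (evalZero n).ker.subtypeL).uniformContinuous
    convert h2 using 1
    ext y
    simp

/-- The range is closed, being a closed space plus a finite dimensional one, and it contains the
dense set of continuous compactly supported functions. -/
theorem surjective_coprod (hS : MemLp (fun t => act (S t)) ∞ (volume : Measure ℝ))
    (hSc : Continuous fun t => act (S t)) {K : ℝ} (hK : ∀ t, ‖act (S t)‖ ≤ K) {C : ℝ}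
    (hC0 : 0 ≤ C) (hC : ∀ x : W12 n, ‖x‖ ≤ C * (‖diffOp S hS x‖ + ‖evalZero n x‖)) :
    Function.Surjective ((diffOp S hS).coprod (jumpOp hS)) := by
  have hcl : IsClosed (((diffOp S hS).coprod (jumpOp hS)).range : Set (L2 n)) := by
    rw [show ((diffOp S hS).coprod (jumpOp hS)).range = (diffOp S hS).range ⊔ (jumpOp hS).range from
      LinearMap.range_coprod _ _]
    exact Submodule.isClosed_sup_finiteDimensional _ _ (isClosed_range_diffOp hS hC0 hC)
  intro y
  suffices h : y ∈ ((diffOp S hS).coprod (jumpOp hS)).range from h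
  rw [← SetLike.mem_coe, ← hcl.closure_eq, Metric.mem_closure_iff]
  intro ε hε
  obtain ⟨g, hgc, hgε, hg, hgL⟩ := (Lp.memLp y).exists_hasCompactSupport_eLpNorm_sub_le
    (by norm_num) (ε := ENNReal.ofReal (ε / 2)) (by simpa using hε)
  refine ⟨hgL.toLp, ?_, ?_⟩
  -- `u₁` vanishes near `+∞`, and the time reversal of `u₂` vanishes near `-∞`; their mismatch at 0
  -- is absorbed by the jump.
  · obtain ⟨u₁, R₁, hu₁, hR₁⟩ := exists_forced_solution hSc hK hg hgc
    obtain ⟨u₂, R₂, hu₂, hR₂⟩ := exists_forced_solution (a := fun t => -act (S (-t))) (K := K)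
      (hSc.comp continuous_neg).neg (fun t => by rw [norm_neg]; exact hK _)
      (f := fun t => -g (-t)) (hg.comp continuous_neg).neg
      ((hgc.comp_homeomorph (Homeomorph.neg ℝ)).neg)
    have hu₂' : ∀ t, HasDerivAt (fun t => u₂ (-t)) (act (S t) (u₂ (-t)) + g t) t := fun t => by
      have h1 := hasDerivAt_comp_neg (hu₂ (-t))
      have h2 : -((-act (S (- -t))) (u₂ (-t)) + -g (- -t)) = act (S t) (u₂ (-t)) + g t := by
        rw [neg_neg, neg_apply, neg_add, neg_neg, neg_neg]
      rwa [h2] at h1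
    have hint : ∀ {u : ℝ → Rn n} {R : ℝ}, Continuous u → (∀ t, R ≤ t → u t = 0) →
        IntegrableOn (fun t => ‖u t‖ ^ 2) (Ici 0) := by
      intro u R hu hR
      have h1 : IntegrableOn (fun t => ‖u t‖ ^ 2) (Icc 0 (max R 0)) :=
        (by fun_prop : Continuous fun t => ‖u t‖ ^ 2).integrableOn_Icc
      refine IntegrableOn.of_forall_sdiff_eq_zero h1 measurableSet_Ici fun t ht => ?_
      have h2 : R ≤ t := by
        by_contra h3
        exact ht.2 ⟨ht.1, (not_le.1 h3).le.trans (le_max_left _ _)⟩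
      simp [hR t h2]
    have hc₁ : Continuous u₁ := continuous_iff_continuousAt.2 fun t => (hu₁ t).continuousAt
    have hc₂ : Continuous u₂ := continuous_iff_continuousAt.2 fun t => (hu₂ t).continuousAt
    obtain ⟨x, hx, -⟩ := exists_coprod_eq hS hgL hu₁ hu₂'
      ((hint hc₁ hR₁).mono_set Ioi_subset_Ici_self) (by
        have h1 := hint hc₂ hR₂
        rw [← neg_zero] at h1
        exact h1.comp_neg_Iic)
    exact ⟨(x, u₁ 0 - u₂ (-0)), hx⟩
  · rw [dist_eq_norm]
    have h1 : ‖y - hgL.toLp‖ ≤ ε / 2 := by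
      rw [Lp.norm_def]
      refine ENNReal.toReal_le_of_le_ofReal (half_pos hε).le (le_of_eq_of_le ?_ hgε)
      refine eLpNorm_congr_ae ((Lp.coeFn_sub y hgL.toLp).trans ?_)
      filter_upwards [hgL.coeFn_toLp] with t ht
      simp [ht]
    linarith

end Surjective

/-! ### The kernel of the extended operator -/

section Kernel

variable {n : ℕ} {S : ℝ → Matrix (Fin n) (Fin n) ℝ}

theorem IsSolution.comp_neg {u : ℝ → Rn n} (hu : IsSolution S u) :
    IsSolution (fun t => -S (-t)) (fun t => u (-t)) := fun t => by
  simpa using hasDerivAt_comp_neg (hu (-t))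

/-- Time reversal, by which results at `+∞` apply at `-∞`. -/
theorem unstableSpace_eq (S : ℝ → Matrix (Fin n) (Fin n) ℝ) :
    unstableSpace S 0 = stableSpace (fun t => -S (-t)) 0 := by
  ext v
  constructor
  · rintro ⟨u, hu, rfl, h0⟩
    exact ⟨fun t => u (-t), hu.comp_neg, by simp, h0.comp tendsto_neg_atTop_atBot⟩
  · rintro ⟨u, hu, rfl, h0⟩
    exact ⟨fun t => u (-t), by simpa using hu.comp_neg, by simp, h0.comp tendsto_neg_atBot_atTop⟩

/-- `U` satisfies the equation on `[0, ∞)` only, in integral form. It agrees there with the global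
solution starting at `U 0`, which is therefore square integrable and decays. -/
theorem mem_stableSpace_of_integrable (hSc : Continuous fun t => act (S t)) {K : ℝ}
    (hK : ∀ t, ‖act (S t)‖ ≤ K) {U : ℝ → Rn n} (hU : Continuous U)
    (heq : ∀ t, 0 ≤ t → U t = U 0 + ∫ r in (0 : ℝ)..t, act (S r) (U r))
    (hi : IntegrableOn (fun t => ‖U t‖ ^ 2) (Ioi 0)) : U 0 ∈ stableSpace S 0 := by
  obtain ⟨Y, hY0, hY⟩ := exists_linear_solution hSc hK (U 0)
  have hg : Continuous fun r => act (S r) (U r) := hSc.clm_apply hU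
  set Z : ℝ → Rn n := fun t => U 0 + ∫ r in (0 : ℝ)..t, act (S r) (U r) with hZ
  have hZd : ∀ t, 0 ≤ t → HasDerivAt Z (act (S t) (Z t)) t := fun t ht => by
    rw [show Z t = U t from (heq t ht).symm]
    exact (intervalIntegral.integral_hasDerivAt_right (hg.intervalIntegrable _ _)
      hg.stronglyMeasurable.stronglyMeasurableAtFilter hg.continuousAt).const_add _
  have hZY : ∀ t, 0 ≤ t → Y t = U t := fun t ht => by
    rw [heq t ht]
    exact linear_solution_unique_right hK (fun r _ => hY r) hZd (by simp [hZ, hY0]) ht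
  refine ⟨Y, hY, hY0, tendsto_zero_of_solution_of_integrable hSc hK (fun t _ => hY t) ?_⟩
  exact hi.congr_fun (fun t ht => by simp only [hZY t (le_of_lt ht)]) measurableSet_Ioi

/-- The kernel of the extended operator consists of pairs of solutions on the half-lines. -/
theorem mem_of_coprod_eq_zero (hS : MemLp (fun t => act (S t)) ∞ (volume : Measure ℝ))
    (hSc : Continuous fun t => act (S t)) {K : ℝ} (hK : ∀ t, ‖act (S t)‖ ≤ K) {x : W12 n} {c : Rn n}
    (h : diffOp S hS x + jumpOp hS c = 0) :
    evalZero n x + c ∈ stableSpace S 0 ∧ evalZero n x ∈ unstableSpace S 0 := by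
  have hv : ∀ᵐ t, x.1.snd t = act (S t) (rep x t + expTail t • c) + expTail t • c := by
    have h1 := coeFn_coprod hS x c
    rw [h] at h1
    filter_upwards [h1, Lp.coeFn_zero (Rn n) 2 (volume : Measure ℝ)] with t h2 h3
    rw [h3, Pi.zero_apply] at h2
    exact (sub_eq_zero.1 h2.symm)
  have hp := isPrimitive_rep x
  have hwc := hp.continuous
  constructor
  -- The smooth exponential replaces `expTail`, which jumps at 0; the two agree for `t > 0`, the
  -- only times that matter here.
  · have hUc : Continuous fun t => rep x t + Real.exp (-t) • c := by fun_prop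
    have h1 := mem_stableSpace_of_integrable hSc hK hUc (fun t ht => ?_) ?_
    · simpa [rep_zero] using h1
    · have e1 : ∫ r in (0 : ℝ)..t, x.1.snd r =
          ∫ r in (0 : ℝ)..t, (act (S r) (rep x r + Real.exp (-r) • c) + Real.exp (-r) • c) := by
        refine intervalIntegral.integral_congr_ae (hv.mono fun r hr hmem => ?_)
        rw [uIoc_of_le ht] at hmem
        rw [hr, expTail_of_pos hmem.1]
      have e2 : ∫ r in (0 : ℝ)..t, Real.exp (-r) • c = c - Real.exp (-t) • c := by
        rw [intervalIntegral.integral_eq_sub_of_hasDerivAt (f := fun r => -(Real.exp (-r) • c))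
          (fun r _ => ?_) ((by fun_prop : Continuous _).intervalIntegrable _ _)]
        · simp
          abel
        · simpa [Pi.neg_def] using (((hasDerivAt_neg r).exp).smul_const c).neg
      have hc1 : Continuous fun r => act (S r) (rep x r + Real.exp (-r) • c) := hSc.clm_apply hUc
      rw [hp.eq_add t, e1, intervalIntegral.integral_add (hc1.intervalIntegrable _ _)
        ((by fun_prop : Continuous _).intervalIntegrable _ _), e2]
      simp
      abel
    · have h2 := integrable_norm_sq ((memLp_rep x).add (memLp_expTail_smul c))
      refine (h2.integrableOn (s := Ioi 0)).congr_fun (fun t ht => ?_) measurableSet_Ioi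
      simp [expTail_of_pos (mem_Ioi.1 ht)]
  · rw [unstableSpace_eq]
    have hSc' : Continuous fun t => act (-S (-t)) := by
      simp only [map_neg]
      exact (hSc.comp continuous_neg).neg
    have h1 := mem_stableSpace_of_integrable (S := fun t => -S (-t)) (K := K)
      (U := fun t => rep x (-t)) hSc' (fun t => by simpa using hK (-t)) (by fun_prop)
      (fun t ht => ?_) ?_
    · simpa [rep_zero] using h1
    · have e1 : ∫ r in (0 : ℝ)..(-t), x.1.snd r = ∫ r in (0 : ℝ)..(-t), act (S r) (rep x r) := by
        refine intervalIntegral.integral_congr_ae (hv.mono fun r hr hmem => ?_)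
        rw [uIoc_comm, uIoc_of_le (by linarith)] at hmem
        rw [hr, expTail_of_nonpos hmem.2]
        simp
      have e2 := intervalIntegral.integral_comp_neg (a := 0) (b := t) fun r => act (S r) (rep x r)
      rw [hp.eq_add (-t), e1, intervalIntegral.integral_symm, ← neg_zero, ← e2]
      simp
    · exact (integrable_norm_sq (memLp_rep x)).comp_neg.integrableOn

theorem exists_coprod_eq_zero (hS : MemLp (fun t => act (S t)) ∞ (volume : Measure ℝ))
    (hSc : Continuous fun t => act (S t)) {b b' : Rn n →L[ℝ] Rn n →L[ℝ] ℝ} {δ δ' T T' : ℝ}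
    (hp : IsLyapunov (fun t => act (S t)) b δ T)
    (hm : IsLyapunov (fun t => -act (S (-t))) b' δ' T') {v₁ v₂ : Rn n}
    (h₁ : v₁ ∈ stableSpace S 0) (h₂ : v₂ ∈ unstableSpace S 0) :
    ∃ x, diffOp S hS x + jumpOp hS (v₁ - v₂) = 0 ∧ evalZero n x = v₂ := by
  obtain ⟨u₁, hu₁, rfl, h0₁⟩ := h₁
  obtain ⟨u₂, hu₂, rfl, h0₂⟩ := h₂
  have hi₁ := hp.integrable_of_tendsto hSc hu₁ h0₁
  have hi₂ := hm.integrable_of_tendsto (hSc.comp continuous_neg).neg (u := fun t => u₂ (-t))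
    (fun t => by simpa using hu₂.comp_neg t) (h0₂.comp tendsto_neg_atTop_atBot)
  obtain ⟨x, hx, hx0⟩ := exists_coprod_eq hS (f := 0) MemLp.zero (fun t => by simpa using hu₁ t)
    (fun t => by simpa using hu₂ t) hi₁ (by
      rw [← integrableOn_Ici_iff_integrableOn_Ioi, ← neg_zero] at hi₂
      simpa using hi₂.comp_neg_Iic)
  exact ⟨x, by rw [hx, MemLp.toLp_zero], hx0⟩

end Kernel

theorem continuous_const_sub_comp {X Y Z ι : Type*} [NormedAddCommGroup X] [NormedSpace ℝ X]
    [NormedAddCommGroup Y] [NormedSpace ℝ Y] [NormedAddCommGroup Z] [NormedSpace ℝ Z]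
    [TopologicalSpace ι] {m : ι → Z →L[ℝ] Y} (hm : Continuous m) (d : X →L[ℝ] Y) (j : X →L[ℝ] Z) :
    Continuous fun l => d - m l ∘L j :=
  continuous_const.sub (hm.clm_comp continuous_const)

/-! ### Dependence on the parameter, and the extension for the whole family -/

section Family

variable {n : ℕ}

theorem uniformContinuous_act : UniformContinuous fun M : Matrix (Fin n) (Fin n) ℝ => act M := by
  have h : Continuous (Matrix.toEuclideanCLM (n := Fin n) (𝕜 := ℝ)).toAlgEquiv.toLinearMap :=
    LinearMap.continuous_of_finiteDimensional _
  exact uniformContinuous_addMonoidHom_of_continuous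
    (f := (Matrix.toEuclideanCLM (n := Fin n) (𝕜 := ℝ)).toAlgEquiv.toLinearMap.toAddMonoidHom) h

variable {S : ℝ → ℝ → Matrix (Fin n) (Fin n) ℝ} {Splus Sminus : ℝ → Matrix (Fin n) (Fin n) ℝ}

theorem AsymptoticallyHyperbolic.continuous_uncurry (h : AsymptoticallyHyperbolic S Splus Sminus) :
    Continuous fun p : I × ℝ => act (S p.1 p.2) := by
  refine uniformContinuous_act.continuous.comp (continuous_matrix fun i j => ?_)
  exact (h.smooth i j).continuousOn.comp_continuous
    (f := fun p : I × ℝ => ((p.1 : ℝ), p.2)) (by fun_prop) fun p => ⟨p.1.2, mem_univ _⟩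

theorem AsymptoticallyHyperbolic.continuous_act (h : AsymptoticallyHyperbolic S Splus Sminus)
    (l : I) : Continuous fun t => act (S l t) := by
  refine uniformContinuous_act.continuous.comp (continuous_matrix fun i j => ?_)
  exact (h.smooth i j).continuousOn.comp_continuous
    (f := fun t : ℝ => ((l : ℝ), t)) (by fun_prop) fun _ => ⟨l.2, mem_univ _⟩

theorem exists_bound_of_tendsto {F : Type*} [NormedAddCommGroup F] {a : ℝ → F} (ha : Continuous a)
    {x y : F} (hx : Tendsto a atTop (𝓝 x)) (hy : Tendsto a atBot (𝓝 y)) : ∃ K, ∀ t, ‖a t‖ ≤ K := by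
  obtain ⟨q, hq⟩ := eventually_atTop.1 (hx.norm.eventually_le_const (lt_add_one _))
  obtain ⟨p, hp⟩ := eventually_atBot.1 (hy.norm.eventually_le_const (lt_add_one _))
  obtain ⟨C, hC⟩ := (isCompact_Icc (a := p) (b := q)).exists_bound_of_continuousOn ha.continuousOn
  refine ⟨max C (max (‖x‖ + 1) (‖y‖ + 1)), fun t => ?_⟩
  rcases le_total t p with h1 | h1
  · exact (hp t h1).trans ((le_max_right _ _).trans (le_max_right _ _))
  rcases le_total q t with h2 | h2
  · exact (hq t h2).trans ((le_max_left _ _).trans (le_max_right _ _))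
  · exact (hC t ⟨h1, h2⟩).trans (le_max_left _ _)

theorem AsymptoticallyHyperbolic.tendsto_plus (h : AsymptoticallyHyperbolic S Splus Sminus) (l : I) :
    Tendsto (fun t => act (S l t)) atTop (𝓝 (act (Splus l))) :=
  (uniformContinuous_act.continuous.tendsto _).comp (h.tendsto_atTop.tendsto_at l.2)

theorem AsymptoticallyHyperbolic.tendsto_minus (h : AsymptoticallyHyperbolic S Splus Sminus)
    (l : I) : Tendsto (fun t => act (S l t)) atBot (𝓝 (act (Sminus l))) :=
  (uniformContinuous_act.continuous.tendsto _).comp (h.tendsto_atBot.tendsto_at l.2)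

/-- Five steps of size `ε`: from time `t` to the limit and back to time `R` at parameter `l`, across
to `l₀` at time `R`, and the same way back to `t`. -/
theorem dist_le_of_uniform_tail {F : Type*} [PseudoMetricSpace F] {a : I → ℝ → F} {A : I → F}
    {R ε : ℝ} {l l₀ : I} {t : ℝ} (h : ∀ r ∈ ({t, R} : Set ℝ), ∀ l, dist (A l) (a l r) < ε)
    (hR : dist (a l R) (a l₀ R) < ε) : dist (a l t) (a l₀ t) ≤ 5 * ε := by
  have h1 := dist_triangle4 (a l t) (A l) (a l R) (a l₀ R)
  have h2 := dist_triangle4 (a l t) (a l₀ R) (A l₀) (a l₀ t)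
  have h3 := h t (by simp) l
  have h4 := h R (by simp) l
  have h5 := h t (by simp) l₀
  have h6 := h R (by simp) l₀
  rw [dist_comm] at h3 h6
  linarith

theorem AsymptoticallyHyperbolic.eventually_forall_dist_le
    (h : AsymptoticallyHyperbolic S Splus Sminus) (l₀ : I) {ε : ℝ} (hε : 0 < ε) :
    ∀ᶠ l : I in 𝓝 l₀, ∀ t, dist (act (S l t)) (act (S l₀ t)) ≤ ε := by
  have hε' : 0 < ε / 5 := by positivity
  have hp := Metric.tendstoUniformlyOn_iff.1
    (uniformContinuous_act.comp_tendstoUniformlyOn h.tendsto_atTop) (ε / 5) hε'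
  have hm := Metric.tendstoUniformlyOn_iff.1
    (uniformContinuous_act.comp_tendstoUniformlyOn h.tendsto_atBot) (ε / 5) hε'
  obtain ⟨q, hq⟩ := eventually_atTop.1 hp
  obtain ⟨p, hp⟩ := eventually_atBot.1 hm
  -- Joint continuity is uniform over this compact interval; beyond `p` and `q` the uniform limits
  -- reduce the comparison to these two times.
  have hK : ∀ᶠ l : I in 𝓝 l₀, ∀ t ∈ Icc (min p q) (max p q),
      dist (act (S l t)) (act (S l₀ t)) < ε / 5 := by
    refine isCompact_Icc.eventually_forall_of_forall_eventually fun t _ => ?_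
    have hc : Continuous fun z : I × ℝ => dist (act (S z.1 z.2)) (act (S l₀ z.2)) :=
      h.continuous_uncurry.dist ((h.continuous_act l₀).comp continuous_snd)
    exact (hc.tendsto (l₀, t)).eventually_lt_const (by simpa using hε')
  filter_upwards [hK] with l hl t
  have hq' := hl q ⟨min_le_right _ _, le_max_right _ _⟩
  have hp' := hl p ⟨min_le_left _ _, le_max_left _ _⟩
  rcases le_total q t with h1 | h1
  · refine (dist_le_of_uniform_tail (a := fun l t => act (S l t)) (A := fun l => act (Splus l))
      (R := q) (ε := ε / 5) (fun r hr l' => ?_) hq').trans_eq (by ring)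
    rcases hr with rfl | rfl
    · exact hq _ h1 _ l'.2
    · exact hq _ le_rfl _ l'.2
  rcases le_total t p with h2 | h2
  · refine (dist_le_of_uniform_tail (a := fun l t => act (S l t)) (A := fun l => act (Sminus l))
      (R := p) (ε := ε / 5) (fun r hr l' => ?_) hp').trans_eq (by ring)
    rcases hr with rfl | rfl
    · exact hp _ h2 _ l'.2
    · exact hp _ le_rfl _ l'.2
  · have := hl t ⟨(min_le_left _ _).trans h2, h1.trans (le_max_right _ _)⟩
    linarith

theorem AsymptoticallyHyperbolic.continuous_mulOp (h : AsymptoticallyHyperbolic S Splus Sminus) :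
    Continuous fun l : I => mulOp (h.memLp l) := by
  refine continuous_iff_continuousAt.2 fun l₀ => Metric.tendsto_nhds.2 fun ε hε => ?_
  filter_upwards [h.eventually_forall_dist_le l₀ (half_pos hε)] with l hl
  rw [dist_eq_norm]
  refine (norm_mulOp_sub_le _ _ (C := ε / 2) fun t => ?_).trans_lt (half_lt_self hε)
  rw [← dist_eq_norm]
  exact hl t

theorem IsHyperbolic.exists_isLyapunov_plus {T : ℝ → Matrix (Fin n) (Fin n) ℝ}
    {M : Matrix (Fin n) (Fin n) ℝ} (hM : IsHyperbolic M)
    (hT : Tendsto (fun t => act (T t)) atTop (𝓝 (act M))) :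
    ∃ (b : Rn n →L[ℝ] Rn n →L[ℝ] ℝ) (δ R : ℝ), IsLyapunov (fun t => act (T t)) b δ R ∧
      (∀ x ∈ negSpace M, x ≠ 0 → b x x < 0) ∧ ∀ x ∈ posSpace M, x ≠ 0 → 0 < b x x := by
  obtain ⟨b, δ, hδ, hb, hle, hn, hp⟩ := exists_lyapunov hM
  obtain ⟨R, hR⟩ := exists_isLyapunov hT hb hδ hle
  exact ⟨b, _, R, hR, hn, hp⟩

theorem IsHyperbolic.exists_isLyapunov_minus {T : ℝ → Matrix (Fin n) (Fin n) ℝ}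
    {M : Matrix (Fin n) (Fin n) ℝ} (hM : IsHyperbolic M)
    (hT : Tendsto (fun t => act (T t)) atBot (𝓝 (act M))) :
    ∃ (b : Rn n →L[ℝ] Rn n →L[ℝ] ℝ) (δ R : ℝ), IsLyapunov (fun t => -act (T (-t))) b δ R ∧
      (∀ x ∈ posSpace M, x ≠ 0 → b x x < 0) ∧ ∀ x ∈ negSpace M, x ≠ 0 → 0 < b x x := by
  obtain ⟨b, δ, hδ, hb, hle, hn, hp⟩ := exists_lyapunov hM
  obtain ⟨R, hR⟩ := exists_isLyapunov (a := fun t => -act (T (-t))) (b := -b)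
    (hT.comp tendsto_neg_atTop_atBot).neg (fun x y => by simp [hb x y]) hδ
    (fun x => by simpa using hle x)
  exact ⟨-b, _, R, hR, fun x hx h0 => by simpa using hp x hx h0,
    fun x hx h0 => by simpa using hn x hx h0⟩

/-- The extended operators of an asymptotically hyperbolic family. -/
theorem AsymptoticallyHyperbolic.splitExtension (h : AsymptoticallyHyperbolic S Splus Sminus) :
    SplitExtension (fun l : I => diffOp (S l) (h.memLp l)) (fun l : I => jumpOp (h.memLp l))
      (evalZero n) (fun l : I => stableSpace (S l) 0) (fun l : I => unstableSpace (S l) 0) := by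
  have hK := fun l : I =>
    exists_bound_of_tendsto (h.continuous_act l) (h.tendsto_plus l) (h.tendsto_minus l)
  choose K hK using hK
  have hp := fun l : I => (h.hyperbolic_plus l l.2).exists_isLyapunov_plus (h.tendsto_plus l)
  have hm := fun l : I => (h.hyperbolic_minus l l.2).exists_isLyapunov_minus (h.tendsto_minus l)
  choose b δ R hp _ _ using hp
  choose b' δ' R' hm _ _ using hm
  have hC := fun l : I => exists_norm_le (h.memLp l) (hK l) (hp l) (hm l)
  choose C hC0 hC using hC
  refine ⟨?_, ?_, fun l => ?_, fun l x c hx => ?_, fun l v₁ h₁ v₂ h₂ => ?_, fun l x hx h0 => ?_⟩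
  · exact continuous_const_sub_comp h.continuous_mulOp (sobolevDeriv n) (sobolevIncl n)
  · exact (continuous_const.add (h.continuous_mulOp.clm_comp continuous_const)).neg
  · exact surjective_coprod (h.memLp l) (h.continuous_act l) (hK l) (hC0 l) (hC l)
  · exact mem_of_coprod_eq_zero (h.memLp l) (h.continuous_act l) (hK l) hx
  · exact exists_coprod_eq_zero (h.memLp l) (h.continuous_act l) (hp l) (hm l) h₁ h₂
  · have := hC l x
    rw [hx, h0, norm_zero, norm_zero, add_zero, mul_zero] at this
    exact norm_le_zero_iff.1 this

theorem AsymptoticallyHyperbolic.finrank_stableSpace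
    (h : AsymptoticallyHyperbolic S Splus Sminus) (l : I) :
    Module.finrank ℝ (stableSpace (S l) 0) = Module.finrank ℝ (negSpace (Splus l)) := by
  obtain ⟨K, hK⟩ :=
    exists_bound_of_tendsto (h.continuous_act l) (h.tendsto_plus l) (h.tendsto_minus l)
  have hM := h.hyperbolic_plus l l.2
  obtain ⟨b, δ, R, hR, hn, hp⟩ := hM.exists_isLyapunov_plus (h.tendsto_plus l)
  exact Z2Index.finrank_stableSpace (h.continuous_act l) hK hR hM.isCompl hn hp

theorem AsymptoticallyHyperbolic.finrank_unstableSpace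
    (h : AsymptoticallyHyperbolic S Splus Sminus) (l : I) :
    Module.finrank ℝ (unstableSpace (S l) 0) = Module.finrank ℝ (posSpace (Sminus l)) := by
  obtain ⟨K, hK⟩ :=
    exists_bound_of_tendsto (h.continuous_act l) (h.tendsto_plus l) (h.tendsto_minus l)
  have hM := h.hyperbolic_minus l l.2
  obtain ⟨b, δ, R, hR, hn, hp⟩ := hM.exists_isLyapunov_minus (h.tendsto_minus l)
  have he : (fun t => act (-S l (-t))) = fun t => -act (S l (-t)) := funext fun t => map_neg _ _
  rw [unstableSpace_eq]
  refine Z2Index.finrank_stableSpace (S := fun t => -S l (-t)) (K := K) ?_ (fun t => ?_) (he ▸ hR)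
    hM.isCompl.symm hn hp
  · rw [he]
    exact ((h.continuous_act l).comp continuous_neg).neg
  · simpa using hK (-t)

theorem AsymptoticallyHyperbolic.inf_eq_bot (h : AsymptoticallyHyperbolic S Splus Sminus) (l : I)
    (ht : OnlyTrivialSolution (S l)) : stableSpace (S l) 0 ⊓ unstableSpace (S l) 0 = ⊥ := by
  obtain ⟨K, hK⟩ :=
    exists_bound_of_tendsto (h.continuous_act l) (h.tendsto_plus l) (h.tendsto_minus l)
  rw [eq_bot_iff]
  rintro v ⟨⟨u₁, hu₁, rfl, h₁⟩, ⟨u₂, hu₂, h0, h₂⟩⟩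
  rw [linear_solution_unique hK hu₂ hu₁ h0] at h₂
  rw [ht u₁ hu₁ h₂ h₁]
  simp

end Family

end Z2Index

/-! ### The main theorem -/

theorem theorem1p1 (n k : ℕ) (S : ℝ → ℝ → Matrix (Fin n) (Fin n) ℝ)
    (Splus Sminus : ℝ → Matrix (Fin n) (Fin n) ℝ)
    (hA1 : Z2Index.AsymptoticallyHyperbolic S Splus Sminus)
    (hA2 : Z2Index.OnlyTrivialSolution (S 0) ∧ Z2Index.OnlyTrivialSolution (S 1))
    (hA3 : ∀ l ∈ Set.Icc (0 : ℝ) 1,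
      Module.finrank ℝ (Z2Index.posSpace (Sminus l)) = k ∧
      Module.finrank ℝ (Z2Index.negSpace (Splus l)) = n - k) :
    ∃ p : ZMod 2,
      Z2Index.HasParity (fun l : unitInterval => Z2Index.diffOp (S l) (hA1.memLp l)) p ∧
      Z2Index.HasZ2Index (fun l : unitInterval => Z2Index.stableSpace (S l) 0)
        (fun l : unitInterval => Z2Index.unstableSpace (S l) 0) p := by
  -- `k` is the dimension of a subspace of `ℝⁿ`, so the natural number subtraction `n - k` is not
  -- truncated.
  have hkn : k ≤ n := by
    have h := Submodule.finrank_le (Z2Index.posSpace (Sminus 0))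
    rwa [(hA3 0 (by simp)).1, finrank_euclideanSpace_fin] at h
  -- The stable spaces come first: the dimensions of the pair are `n - k` and `k`.
  exact hA1.splitExtension.exists_hasParity_hasZ2Index (Nat.sub_add_cancel hkn)
    (fun l => (hA1.finrank_stableSpace l).trans (hA3 l l.2).2)
    (fun l => (hA1.finrank_unstableSpace l).trans (hA3 l l.2).1)
    (hA1.inf_eq_bot 0 hA2.1) (hA1.inf_eq_bot 1 hA2.2)
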